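/- **Setting.** Let $G$ be a connected, simply connected, simple compact Lie group with Lie algebra $\mathfrak g$ (that is, $\mathfrak g$ is a finite-dimensional simple real Lie algebra carrying an invariant scalar product $(\cdot|\cdot)$), and let $\mathfrak t\cong\mathbb R^n$ be the Lie algebra of a maximal torus (a maximal abelian subalgebra), with the restricted scalar product. Let $\Phi\subset\mathfrak t^*$ be the set of real roots, i.e. the nonzero $\alpha\in\mathfrak t^*$ such that for some nonzero $X\in\mathbb C\otimes\mathfrak g$ one has $[H,X]=2i\pi\,\alpha(H)X$ for all $H\in\mathfrak t$. Fix simple roots $\alpha_1,\dots,\alpha_n$, with positive roots $\Phi_+$ and highest root $\theta$, and normalize the scalar product by $(\theta|\theta)=2$. Let $\alpha^\vee=2\nu^{-1}(\alpha)/(\alpha|\alpha)$ with $\nu(a)=\phi_a=(a|\cdot)$. For $\tau\ge0$ put $$A_\tau=\{x\in\mathfrak t:\ 0\le\alpha(x)\le\tau\ \ \forall\alpha\in\Phi_+\},\quad A=A_1,\quad C_W=\{(\tau,x):\tau\ge 0,\ x\in A_\tau\},\quad \pi(h)=\prod_{\alpha\in\Phi_+}\sin(\pi\alpha(h)).$$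 Let $\widehat{\mathfrak h}=\mathbb Rc\oplus\mathfrak t\oplus\mathbb Rd$ and $\widehat{\mathfrak h}^*=\mathbb R\Lambda_0\oplus\mathfrak t^*\oplus\mathbb R\delta$, with $\Lambda_0(c)=\delta(d)=1$, the usual pairing of $\mathfrak t^*$ with $\mathfrak t$, and all other pairings equal to $0$. Put $\alpha_0=\delta-\theta$, $\alpha_0^\vee=c-\theta^\vee$. The affine Weyl group $\widehat W\subset GL(\widehat{\mathfrak h}^*)$ is generated by the reflections $s_i(\lambda)=\lambda-\lambda(\alpha_i^\vee)\alpha_i$, $0\le i\le n$. For $\tau>0$, $a\in\mathfrak t$ and $b\in\mathfrak t$ with $\pi(b)\ne0$ let $$\psi_b(\tau,a)=\frac1{\pi(b)}\sum_{w\in\widehat W}\det(w)\,e^{\langle w(\tau\Lambda_0+\phi_a),\,d+b\rangle}.$$ Let $\gamma\in A$. If $\pi(\gamma)=0$, define $\psi_\gamma(\tau,a)$ as the limit of $\psi_b(\tau,a)$ as $b\to\gamma$ with $\pi(b)\ne0$. Put $\Psi_\gamma(t,x)=e^{-(\gamma|x)}\psi_\gamma(t,x)$ for $t>0$. **Statement.**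 For all $t>0$ and $x\in\mathfrak t$ the series converges absolutely for every $b\in\mathfrak t$, and $\psi_b(t,x)\to\psi_\gamma(t,x)$ as $b\to\gamma$ with $\pi(b)\neq0$ (so $\psi_\gamma$ is well defined for every $\gamma\in A$). Moreover: 1. (constant sign) $\Psi_\gamma(t,x)\ge 0$ for all $(t,x)\in C_W$ with $t>0$; 2. (boundary values) $\Psi_\gamma(t,x)=0$ for all $(t,x)\in\partial C_W$ with $t>0$; 3. (harmonicity) for every standard Brownian motion $(b_t)_{t\ge0}$ in $\mathfrak t$ started at $0$ and every $(r,x)\in C_W$ with $r>0$, let $B_t=(r+t,\ x+b_t+\gamma t)$ and $T=\inf\{t\ge0: B_t\notin C_W\}$ (with $\inf\emptyset=+\infty$). Then for every $t\ge0$ the variable $\Psi_\gamma(B_{t\wedge T})$ is integrable and $\mathbb E[\Psi_\gamma(B_{t\wedge T})]=\Psi_\gamma(r,x)$. -/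

import Mathlib

open MeasureTheory ProbabilityTheory Filter Topology
open scoped NNReal TensorProduct

noncomputable section

namespace AffineTheta

/-- The Euclidean space `𝔱`, written in orthonormal coordinates. -/
abbrev E (n : ℕ) : Type := EuclideanSpace ℝ (Fin n)

/-- The dual space `𝔱*`. -/
abbrev EDual (n : ℕ) : Type := StrongDual ℝ (E n)

/-! ### The compact Lie algebra, its maximal torus and its real roots -/

section Lie

variable {𝔤 : Type*} [LieRing 𝔤] [LieAlgebra ℝ 𝔤]

/-- `B` is a scalar product on `𝔤` which is invariant under the adjoint action. -/
structure IsInvariantScalarProduct (B : LinearMap.BilinForm ℝ 𝔤) : Prop where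
  symm : ∀ X Y : 𝔤, B X Y = B Y X
  pos : ∀ X : 𝔤, X ≠ 0 → 0 < B X X
  invariant : ∀ X Y Z : 𝔤, B ⁅X, Y⁆ Z = -B Y ⁅X, Z⁆

/-- `j` identifies the Euclidean space `E n` isometrically with a maximal abelian subalgebra of
`𝔤`, that is, with the Lie algebra of a maximal torus. -/
structure IsMaximalTorus (B : LinearMap.BilinForm ℝ 𝔤) {n : ℕ} (j : E n →ₗ[ℝ] 𝔤) : Prop where
  isometry : ∀ x y, B (j x) (j y) = inner ℝ x y
  abelian : ∀ x y, ⁅j x, j y⁆ = 0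
  maximal : ∀ Z : 𝔤, (∀ x, ⁅j x, Z⁆ = 0) → Z ∈ LinearMap.range j

/-- The set `Φ` of real roots: the nonzero `α ∈ 𝔱*` such that `[H, X] = 2iπ α(H) X` for all
`H ∈ 𝔱` and some nonzero `X` in the complexified Lie algebra. -/
def realRoots {n : ℕ} (j : E n →ₗ[ℝ] 𝔤) : Set (EDual n) :=
  {α | α ≠ 0 ∧ ∃ X : ℂ ⊗[ℝ] 𝔤, X ≠ 0 ∧
    ∀ H : E n, ⁅(1 : ℂ) ⊗ₜ[ℝ] j H, X⁆ = (2 * Complex.I * (Real.pi : ℂ) * ((α H : ℝ) : ℂ)) • X}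

end Lie

variable {n : ℕ}

/-- `α` is a system of simple roots of `Φ`. -/
structure IsSimpleSystem (Φ : Set (EDual n)) (α : Fin n → EDual n) : Prop where
  mem : ∀ i, α i ∈ Φ
  linearIndependent : LinearIndependent ℝ α
  mem_or_neg_mem : ∀ β ∈ Φ, β ∈ AddSubmonoid.closure (Set.range α) ∨
    -β ∈ AddSubmonoid.closure (Set.range α)

/-- The set `Φ₊` of positive roots. -/
def posRoots (Φ : Set (EDual n)) (α : Fin n → EDual n) : Set (EDual n) :=
  {β | β ∈ Φ ∧ β ∈ AddSubmonoid.closure (Set.range α)}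

/-- `θ` is the highest root. -/
structure IsHighestRoot (Φ : Set (EDual n)) (α : Fin n → EDual n) (θ : EDual n) : Prop where
  mem : θ ∈ Φ
  highest : ∀ β ∈ Φ, θ - β ∈ AddSubmonoid.closure (Set.range α)

/-- The linear form `φ_a = (a | ·)`. -/
def flat (a : E n) : EDual n := InnerProductSpace.toDual ℝ (E n) a

/-- The coroot `α^∨ = 2 ν⁻¹(α) / (α | α)`, where `ν(a) = (a | ·)`. -/
def coroot (α : EDual n) : E n :=
  (2 / ‖α‖ ^ 2) • (InnerProductSpace.toDual ℝ (E n)).symm α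

/-- The alcove `A_τ` of level `τ`. -/
def alcove (Φp : Set (EDual n)) (τ : ℝ) : Set (E n) :=
  {x | ∀ β ∈ Φp, 0 ≤ β x ∧ β x ≤ τ}

/-- The affine Weyl chamber `C_W`. -/
def chamber (Φp : Set (EDual n)) : Set (ℝ × E n) :=
  {p | 0 ≤ p.1 ∧ p.2 ∈ alcove Φp p.1}

/-- The product `π(h) = ∏_{α ∈ Φ₊} sin (π α(h))`. -/
def sinProd (Φp : Set (EDual n)) (h : E n) : ℝ :=
  ∏ᶠ β ∈ Φp, Real.sin (Real.pi * β h)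

/-! ### The affine Weyl group -/

/-- The real form of `𝔥̂`; the triple `(p, h, q)` stands for `p c + h + q d`. -/
abbrev AffCartan (n : ℕ) : Type := ℝ × E n × ℝ

/-- The real form of `𝔥̂*`; the triple `(τ, φ, k)` stands for `τ Λ₀ + φ + k δ`. -/
abbrev AffDual (n : ℕ) : Type := ℝ × EDual n × ℝ

/-- The duality bracket between `𝔥̂*` and `𝔥̂`: `Λ₀(c) = 1`, `δ(d) = 1`, `𝔱*` is paired with `𝔱`,
and all the other pairings vanish. -/
def pairing (l : AffDual n) (h : AffCartan n) : ℝ :=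
  l.1 * h.1 + l.2.1 h.2.1 + l.2.2 * h.2.2

/-- The simple affine roots: `α_0 = δ - θ` (index `none`) and `α_1, …, α_n`. -/
def affRoot (α : Fin n → EDual n) (θ : EDual n) : Option (Fin n) → AffDual n
  | none => (0, -θ, 1)
  | some i => (0, α i, 0)

/-- The simple affine coroots: `α_0^∨ = c - θ^∨` (index `none`) and `α_1^∨, …, α_n^∨`. -/
def affCoroot (α : Fin n → EDual n) (θ : EDual n) : Option (Fin n) → AffCartan n
  | none => (1, -coroot θ, 0)
  | some i => (0, coroot (α i), 0)

/-- The affine Weyl group `Ŵ`: the subgroup of `GL(𝔥̂*)` generated by the fundamental reflections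
`s_i(l) = l - l(α_i^∨) α_i`. -/
def affineWeylGroup (α : Fin n → EDual n) (θ : EDual n) :
    Subgroup (AffDual n ≃ₗ[ℝ] AffDual n) :=
  Subgroup.closure {s | ∃ i, ∀ l, s l = l - pairing l (affCoroot α θ i) • affRoot α θ i}

/-! ### The theta function -/

/-- The summand `det(w) exp ⟨w(τ Λ₀ + φ_a), d + b⟩`. -/
def thetaTerm (b : E n) (τ : ℝ) (a : E n) (w : AffDual n ≃ₗ[ℝ] AffDual n) : ℝ :=
  LinearMap.det (w : AffDual n →ₗ[ℝ] AffDual n) *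
    Real.exp (pairing (w (τ, flat a, 0)) (0, b, 1))

/-- The function `ψ̂_b(τ, a) = π(b)⁻¹ ∑_{w ∈ Ŵ} det(w) exp ⟨w(τ Λ₀ + φ_a), d + b⟩`, meaningful when
`π(b) ≠ 0`. -/
def psiHat (Φp : Set (EDual n)) (α : Fin n → EDual n) (θ : EDual n) (b : E n) (τ : ℝ) (a : E n) :
    ℝ :=
  (sinProd Φp b)⁻¹ * ∑' w : affineWeylGroup α θ, thetaTerm b τ a w

open Classical in
/-- The function `ψ_γ`: it is `ψ̂_γ` if `π(γ) ≠ 0`, and the limit of `ψ̂_b` as `b → γ` with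
`π(b) ≠ 0` otherwise. -/
def psi (Φp : Set (EDual n)) (α : Fin n → EDual n) (θ : EDual n) (γ : E n) (τ : ℝ) (a : E n) : ℝ :=
  if sinProd Φp γ ≠ 0 then psiHat Φp α θ γ τ a
  else limUnder (𝓝[{b | sinProd Φp b ≠ 0}] γ) (fun b => psiHat Φp α θ b τ a)

/-- The function `Ψ_γ(t, x) = e^{-(γ | x)} ψ_γ(t, x)`. -/
def Psi (Φp : Set (EDual n)) (α : Fin n → EDual n) (θ : EDual n) (γ : E n) (p : ℝ × E n) : ℝ :=
  Real.exp (-inner ℝ γ p.2) * psi Φp α θ γ p.1 p.2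

/-! ### Space-time Brownian motion and harmonic functions -/

/-- `b` is a standard Brownian motion with values in `E n`, starting from `0`. -/
structure IsStandardBrownian {Ω : Type*} [MeasurableSpace Ω] (P : Measure Ω)
    (b : ℝ≥0 → Ω → E n) : Prop where
  measurable : ∀ t, Measurable (b t)
  brownian : ∀ i, IsBrownianReal (fun t ω => b t ω i) P
  indep : iIndepFun (fun (i : Fin n) (ω : Ω) (t : ℝ≥0) => b t ω i) P

/-- The space-time Brownian motion with drift `γ` starting from `p`. -/
def spaceTime {Ω : Type*} (b : ℝ≥0 → Ω → E n) (γ : E n) (p : ℝ × E n) (t : ℝ≥0) (ω : Ω) :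
    ℝ × E n :=
  (p.1 + t, p.2 + b t ω + (t : ℝ) • γ)

/-- The exit time `T = inf {t ≥ 0 : B_t ∉ C}` (equal to `⊤` when there is no such `t`). -/
def exitTime {Ω S : Type*} (X : ℝ≥0 → Ω → S) (C : Set S) : Ω → WithTop ℝ≥0 :=
  hittingAfter X Cᶜ 0

/-- The process `B_{t ∧ T}`, where `B` is the space-time Brownian motion with drift `γ` starting
from `p` and `T` is its exit time from `C`. -/
def killed {Ω : Type*} (b : ℝ≥0 → Ω → E n) (γ : E n) (C : Set (ℝ × E n)) (p : ℝ × E n) :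
    ℝ≥0 → Ω → ℝ × E n :=
  stoppedProcess (spaceTime b γ p) (exitTime (spaceTime b γ p) C)

/-- `h` is harmonic on `D` for the space-time Brownian motion with drift `γ` killed when it leaves
`C`: for every starting point `p ∈ D` and every `t ≥ 0`, `E_p[h(B_{t ∧ T})] = h(p)`. -/
def IsHarmonicForKilled {Ω : Type*} [MeasurableSpace Ω] (P : Measure Ω) (b : ℝ≥0 → Ω → E n)
    (γ : E n) (C D : Set (ℝ × E n)) (h : ℝ × E n → ℝ) : Prop :=
  ∀ p ∈ D, ∀ t : ℝ≥0, Integrable (fun ω => h (killed b γ C p t ω)) P ∧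
    ∫ ω, h (killed b γ C p t ω) ∂P = h p

end AffineTheta

end

/-!
The proof reduces everything to the root system and then works with explicit exponential series.

*Root system.* The invariant scalar product makes every `ad H`, `H ∈ 𝔱`, skew, and the
complexification of `𝔱` is a Cartan subalgebra on which the Killing form is nondegenerate, so the
real roots form a finite reduced root set, stable under reflections and with integral coroot values
(`isRootSet_realRoots`). Simplicity of `𝔤` enters through this nondegeneracy. Each `w ∈ Ŵ` is
contragredient to an affine isometry `b ↦ act w b` of `𝔱` with linear part in the finite Weyl group
and translation part in a lattice, and `⟨w(t Λ₀ + φ_x), d + b⟩` equals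
`⟪x, act w b⟫ + t (‖b‖² - ‖act w b‖²) / 2` (`IsAffineDatum.thetaTerm_eq`). Absolute convergence for
`t > 0` is therefore the summability of a Gaussian over a lattice.

*Existence of the limit.* The affine Weyl group contains the reflections in the hyperplanes
`β = 0` and `β = 1` for every positive root `β`, so the series vanishes when `b` lies on one of them
(`thetaSum_eq_zero_of_reflection`). For `γ` in the alcove these are exactly the hyperplanes through
`γ` on which the denominator `π` vanishes. As a superposition of exponentials in `b`, the series can
be divided by the equations of these hyperplanes one after the other, with a quotient of the same
kind (`ExpFamily.eval_div`, `ExpFamily.exists_eval_eq_prod_mul`); hence `ψ_b(t, x)` extends to a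
jointly continuous function of `(t, x, b)` near `b = γ`
(`IsAffineDatum.exists_continuousOn_extension`).

*Boundary values.* On a wall of the chamber the weight `t Λ₀ + φ_x` is fixed by a fundamental
reflection, so that the alternating sum vanishes for every `b`.

*Sign.* For `b` inside the alcove the sum `u(t, x)` of `det(w) exp (⟪x, y⟫ - t ‖y‖² / 2)`, where
`y = act w b`, solves the backward heat equation and vanishes on the walls. For large `t` its
negative terms are dominated by `exp (‖x‖² / 2t - δ t)`, because the points `act w b` with
`det w = -1` keep a positive distance from the alcove. The function `u + ε φ`, where
`φ(t, x) = t ^ (-(n + 1)) exp (‖x‖² / 2t)` is a strict supersolution, then has no negative minimum on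
the part of the chamber below a late time, and `ε → 0` gives `u ≥ 0`
(`IsAffineDatum.heatSum_nonneg`).

*Harmonicity.* Along the Brownian motion with drift `γ` the functions
`exp (⟪y - γ, x⟫ + t (‖γ‖² - ‖y‖²) / 2)` are exponential martingales. They are stopped at the exit
time by approximating it from above with exit times tested on finitely many dates
(`integral_martingale_truncExit`). Summation over `Ŵ` gives harmonicity for all parameters `b` with
`π(b) ≠ 0`, and the limit `b → γ` is taken by dominated convergence, the killed process staying in a
compact part of the chamber.
-/

noncomputable section

namespace AffineTheta

/-! ### The complexified Lie algebra and its Cartan subalgebra -/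

section Complexification

variable {𝔤 : Type*} [LieRing 𝔤] [LieAlgebra ℝ 𝔤]

/-- The real part `ℂ ⊗ 𝔤 → 𝔤`. -/
def tensorRe : ℂ ⊗[ℝ] 𝔤 →ₗ[ℝ] 𝔤 :=
  (TensorProduct.lid ℝ 𝔤).toLinearMap ∘ₗ Complex.reLm.rTensor 𝔤

/-- The imaginary part `ℂ ⊗ 𝔤 → 𝔤`. -/
def tensorIm : ℂ ⊗[ℝ] 𝔤 →ₗ[ℝ] 𝔤 :=
  (TensorProduct.lid ℝ 𝔤).toLinearMap ∘ₗ Complex.imLm.rTensor 𝔤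

@[simp] lemma tensorRe_tmul (z : ℂ) (x : 𝔤) : tensorRe (z ⊗ₜ[ℝ] x) = z.re • x := by
  simp [tensorRe]

@[simp] lemma tensorIm_tmul (z : ℂ) (x : 𝔤) : tensorIm (z ⊗ₜ[ℝ] x) = z.im • x := by
  simp [tensorIm]

lemma tensorRe_add_tensorIm (X : ℂ ⊗[ℝ] 𝔤) :
    (1 : ℂ) ⊗ₜ[ℝ] tensorRe X + Complex.I ⊗ₜ[ℝ] tensorIm X = X := by
  induction X using TensorProduct.induction_on with
  | zero => simp
  | tmul z x =>
    rw [tensorRe_tmul, tensorIm_tmul, ← TensorProduct.smul_tmul, ← TensorProduct.smul_tmul,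
      ← TensorProduct.add_tmul]
    congr 1
    apply Complex.ext <;> simp
  | add X Y hX hY =>
    rw [map_add, map_add, TensorProduct.tmul_add, TensorProduct.tmul_add, add_add_add_comm, hX, hY]

lemma tensor_ext {X Y : ℂ ⊗[ℝ] 𝔤} (hre : tensorRe X = tensorRe Y)
    (him : tensorIm X = tensorIm Y) : X = Y := by
  rw [← tensorRe_add_tensorIm X, ← tensorRe_add_tensorIm Y, hre, him]

lemma tensorRe_lie (x : 𝔤) (X : ℂ ⊗[ℝ] 𝔤) :
    tensorRe ⁅(1 : ℂ) ⊗ₜ[ℝ] x, X⁆ = ⁅x, tensorRe X⁆ := by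
  induction X using TensorProduct.induction_on with
  | zero => rw [lie_zero ((1 : ℂ) ⊗ₜ[ℝ] x), map_zero, lie_zero]
  | tmul z y => simp
  | add X Y hX hY => rw [lie_add ((1 : ℂ) ⊗ₜ[ℝ] x) X Y, map_add, hX, hY, map_add, lie_add]

lemma tensorIm_lie (x : 𝔤) (X : ℂ ⊗[ℝ] 𝔤) :
    tensorIm ⁅(1 : ℂ) ⊗ₜ[ℝ] x, X⁆ = ⁅x, tensorIm X⁆ := by
  induction X using TensorProduct.induction_on with
  | zero => rw [lie_zero ((1 : ℂ) ⊗ₜ[ℝ] x), map_zero, lie_zero]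
  | tmul z y => simp
  | add X Y hX hY => rw [lie_add ((1 : ℂ) ⊗ₜ[ℝ] x) X Y, map_add, hX, hY, map_add, lie_add]

/-- Complexification preserves nondegeneracy of the Killing form. -/
lemma isKilling_complexification [FiniteDimensional ℝ 𝔤] [LieAlgebra.IsKilling ℝ 𝔤] :
    LieAlgebra.IsKilling ℂ (ℂ ⊗[ℝ] 𝔤) := by
  refine ⟨(LieSubmodule.eq_bot_iff _).2 fun X hX => ?_⟩
  rw [LieIdeal.mem_killingCompl] at hX
  have key : ∀ Y : 𝔤, (killingForm ℝ 𝔤 Y (tensorRe X) : ℂ)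
      + Complex.I * (killingForm ℝ 𝔤 Y (tensorIm X) : ℂ) = 0 := by
    intro Y
    have h := hX ((1 : ℂ) ⊗ₜ[ℝ] Y) (LieSubmodule.mem_top _)
    rw [← tensorRe_add_tensorIm X, killingForm] at h
    erw [LieModule.traceForm_baseChange] at h
    simp only [map_add, LinearMap.BilinForm.baseChange_tmul] at h
    simpa [killingForm, mul_comm] using h
  have hz : ∀ Z : 𝔤, (∀ Y, killingForm ℝ 𝔤 Y Z = 0) → Z = 0 := by
    intro Z hZ
    have : Z ∈ LieIdeal.killingCompl ℝ 𝔤 ⊤ :=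
      (LieIdeal.mem_killingCompl ℝ 𝔤 ⊤).2 fun Y _ => hZ Y
    simpa using this
  apply tensor_ext
  · rw [map_zero]
    refine hz _ fun Y => ?_
    simpa using congrArg Complex.re (key Y)
  · rw [map_zero]
    refine hz _ fun Y => ?_
    simpa using congrArg Complex.im (key Y)

variable {n : ℕ}

lemma lie_eq_zero_of_mem_baseChange_range {j : E n →ₗ[ℝ] 𝔤} (hj : ∀ x y, ⁅j x, j y⁆ = 0)
    {X Y : ℂ ⊗[ℝ] 𝔤} (hX : X ∈ (LinearMap.range j).baseChange ℂ)
    (hY : Y ∈ (LinearMap.range j).baseChange ℂ) : ⁅X, Y⁆ = 0 := by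
  rw [Submodule.baseChange_eq_span] at hX hY
  refine Submodule.span_induction₂ (p := fun X Y _ _ => ⁅X, Y⁆ = 0) ?_
    (fun Y _ => zero_lie Y) (fun X _ => lie_zero X) (fun X Y Z _ _ _ h h' => ?_)
    (fun X Y Z _ _ _ h h' => ?_) (fun c X Y _ _ h => ?_) (fun c X Y _ _ h => ?_) hX hY
  · rintro - - ⟨_, ⟨x, rfl⟩, rfl⟩ ⟨_, ⟨y, rfl⟩, rfl⟩
    simp [hj]
  · rw [add_lie X Y Z, h, h', add_zero]
  · rw [lie_add X Y Z, h, h', add_zero]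
  · rw [smul_lie c X Y, h, smul_zero]
  · rw [lie_smul c X Y, h, smul_zero]

/-- The complexification `ℂ ⊗ 𝔱` of the Lie algebra of the torus. -/
def torusComplexification (j : E n →ₗ[ℝ] 𝔤) (hj : ∀ x y, ⁅j x, j y⁆ = 0) :
    LieSubalgebra ℂ (ℂ ⊗[ℝ] 𝔤) where
  toSubmodule := (LinearMap.range j).baseChange ℂ
  lie_mem' := by
    intro X Y hX hY
    rw [Submodule.mem_carrier, SetLike.mem_coe] at hX hY ⊢
    rw [lie_eq_zero_of_mem_baseChange_range hj hX hY]
    exact Submodule.zero_mem _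

variable {B : LinearMap.BilinForm ℝ 𝔤} {j : E n →ₗ[ℝ] 𝔤}

lemma mem_torusComplexification (hj : ∀ x y, ⁅j x, j y⁆ = 0) {X : ℂ ⊗[ℝ] 𝔤} :
    X ∈ torusComplexification j hj ↔
      tensorRe X ∈ LinearMap.range j ∧ tensorIm X ∈ LinearMap.range j := by
  constructor
  · intro hX
    change X ∈ (LinearMap.range j).baseChange ℂ at hX
    rw [Submodule.baseChange_eq_span] at hX
    induction hX using Submodule.span_induction with
    | mem X h =>
      obtain ⟨x, hx, rfl⟩ := h
      simpa using hx
    | zero => simp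
    | add X Y _ _ h h' =>
      rw [map_add, map_add]
      exact ⟨Submodule.add_mem _ h.1 h'.1, Submodule.add_mem _ h.2 h'.2⟩
    | smul c X _ h =>
      have hre : tensorRe (c • X) = c.re • tensorRe X - c.im • tensorIm X := by
        conv_lhs => rw [← tensorRe_add_tensorIm X]
        simp [TensorProduct.smul_tmul', sub_eq_add_neg]
      have him : tensorIm (c • X) = c.im • tensorRe X + c.re • tensorIm X := by
        conv_lhs => rw [← tensorRe_add_tensorIm X]
        simp [TensorProduct.smul_tmul']
      rw [hre, him]
      exact ⟨Submodule.sub_mem _ (Submodule.smul_mem _ _ h.1) (Submodule.smul_mem _ _ h.2),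
        Submodule.add_mem _ (Submodule.smul_mem _ _ h.1) (Submodule.smul_mem _ _ h.2)⟩
  · rintro ⟨h, h'⟩
    rw [← tensorRe_add_tensorIm X]
    exact Submodule.add_mem _ (Submodule.tmul_mem_baseChange_of_mem _ h)
      (Submodule.tmul_mem_baseChange_of_mem _ h')

lemma tmul_mem_torusComplexification (hj : ∀ x y, ⁅j x, j y⁆ = 0) (x : E n) :
    (1 : ℂ) ⊗ₜ[ℝ] j x ∈ torusComplexification j hj :=
  Submodule.tmul_mem_baseChange_of_mem _ (LinearMap.mem_range_self j x)

/-- For skew-symmetric `ad X`, the kernel of `(ad X)²` is the kernel of `ad X`. -/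
lemma IsInvariantScalarProduct.lie_eq_zero_of_lie_lie_eq_zero (hB : IsInvariantScalarProduct B)
    {X Y : 𝔤} (h : ⁅X, ⁅X, Y⁆⁆ = 0) : ⁅X, Y⁆ = 0 := by
  by_contra h0
  have := hB.pos _ h0
  rw [hB.invariant, h] at this
  simp at this

/-- The complexification of a maximal torus is a Cartan subalgebra: it is abelian, and it is its
own normalizer because `ad H` is semisimple for `H ∈ 𝔱`. -/
lemma isCartanSubalgebra_torusComplexification (hB : IsInvariantScalarProduct B)
    (hj : IsMaximalTorus B j) : (torusComplexification j hj.abelian).IsCartanSubalgebra where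
  nilpotent := by
    have : IsLieAbelian (torusComplexification j hj.abelian) := by
      refine ⟨fun X Y => ?_⟩
      obtain ⟨X, hX⟩ := X
      obtain ⟨Y, hY⟩ := Y
      apply Subtype.ext
      change ⁅X, Y⁆ = 0
      exact lie_eq_zero_of_mem_baseChange_range hj.abelian hX hY
    infer_instance
  self_normalizing := by
    refine le_antisymm (fun X hX => ?_) (LieSubalgebra.le_normalizer _)
    rw [LieSubalgebra.mem_normalizer_iff'] at hX
    have key : ∀ x : E n, ⁅j x, tensorRe X⁆ ∈ LinearMap.range j ∧
        ⁅j x, tensorIm X⁆ ∈ LinearMap.range j := fun x => by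
      have := hX _ (tmul_mem_torusComplexification hj.abelian x)
      rwa [mem_torusComplexification, tensorRe_lie, tensorIm_lie] at this
    rw [mem_torusComplexification]
    constructor
    · refine hj.maximal _ fun x => hB.lie_eq_zero_of_lie_lie_eq_zero ?_
      obtain ⟨y, hy⟩ := (key x).1
      rw [← hy, hj.abelian]
    · refine hj.maximal _ fun x => hB.lie_eq_zero_of_lie_lie_eq_zero ?_
      obtain ⟨y, hy⟩ := (key x).2
      rw [← hy, hj.abelian]

end Complexification

/-! ### The real roots form a root system -/

variable {n : ℕ}

/-- The properties of a reduced crystallographic root system which are used below. -/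
structure IsRootSet (Φ : Set (EDual n)) : Prop where
  finite : Φ.Finite
  ne_zero : ∀ β ∈ Φ, β ≠ 0
  integral : ∀ β ∈ Φ, ∀ β' ∈ Φ, ∃ k : ℤ, β' (coroot β) = k
  reflect : ∀ β ∈ Φ, ∀ β' ∈ Φ, β' - β' (coroot β) • β ∈ Φ
  reduced : ∀ β ∈ Φ, ∀ c : ℝ, c • β ∈ Φ → c = 1 ∨ c = -1

section Roots

variable {𝔤 : Type*} [LieRing 𝔤] [LieAlgebra ℝ 𝔤]
variable {B : LinearMap.BilinForm ℝ 𝔤} {j : E n →ₗ[ℝ] 𝔤}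

lemma IsMaximalTorus.injective (hj : IsMaximalTorus B j) : Function.Injective j := by
  rw [injective_iff_map_eq_zero]
  intro x hx
  have := hj.isometry x x
  rw [hx, map_zero, eq_comm, inner_self_eq_zero] at this
  exact this

open LieAlgebra LieAlgebra.IsKilling LieModule in
/-- The weight `a` of `ℂ ⊗ 𝔱` restricts to `2iπ β` on `𝔱`. -/
def WeightRestricts (hj : IsMaximalTorus B j)
    [LieRing.IsNilpotent (torusComplexification j hj.abelian)]
    (a : LieModule.Weight ℂ (torusComplexification j hj.abelian) (ℂ ⊗[ℝ] 𝔤)) (β : EDual n) : Prop :=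
  ∀ x : E n, a ⟨(1 : ℂ) ⊗ₜ[ℝ] j x, tmul_mem_torusComplexification hj.abelian x⟩
    = 2 * Complex.I * (Real.pi : ℂ) * ((β x : ℝ) : ℂ)

lemma exists_eq_add_smul_of_mem_torusComplexification (hj : IsMaximalTorus B j)
    (h : torusComplexification j hj.abelian) : ∃ x y : E n,
      h = ⟨(1 : ℂ) ⊗ₜ[ℝ] j x, tmul_mem_torusComplexification hj.abelian x⟩ + Complex.I •
        (⟨(1 : ℂ) ⊗ₜ[ℝ] j y, tmul_mem_torusComplexification hj.abelian y⟩ :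
          torusComplexification j hj.abelian) := by
  obtain ⟨h, hh⟩ := h
  obtain ⟨⟨x, hx⟩, ⟨y, hy⟩⟩ := (mem_torusComplexification hj.abelian).1 hh
  refine ⟨x, y, Subtype.ext ?_⟩
  change h = (1 : ℂ) ⊗ₜ[ℝ] j x + Complex.I • ((1 : ℂ) ⊗ₜ[ℝ] j y)
  rw [hx, hy, TensorProduct.smul_tmul', smul_eq_mul, mul_one, tensorRe_add_tensorIm]

lemma exists_weightRestricts (hj : IsMaximalTorus B j)
    [LieRing.IsNilpotent (torusComplexification j hj.abelian)] {β : EDual n} {X : ℂ ⊗[ℝ] 𝔤}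
    (hX : X ≠ 0) (h : ∀ H : E n, ⁅(1 : ℂ) ⊗ₜ[ℝ] j H, X⁆ =
      (2 * Complex.I * (Real.pi : ℂ) * ((β H : ℝ) : ℂ)) • X) :
    ∃ a, WeightRestricts hj a β ∧ X ∈ LieModule.genWeightSpace (ℂ ⊗[ℝ] 𝔤) a := by
  obtain ⟨f, hf⟩ := j.exists_leftInverse_of_injective (LinearMap.ker_eq_bot.2 hj.injective)
  have hf' : ∀ x, f (j x) = x := fun x => LinearMap.congr_fun hf x
  let χ : torusComplexification j hj.abelian → ℂ := fun h =>
    2 * Complex.I * (Real.pi : ℂ) *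
      ((β (f (tensorRe h.1)) : ℝ) + Complex.I * (β (f (tensorIm h.1)) : ℝ))
  have hmem : X ∈ LieModule.genWeightSpace (ℂ ⊗[ℝ] 𝔤) χ := by
    rw [LieModule.mem_genWeightSpace]
    intro h'
    obtain ⟨x, y, rfl⟩ := exists_eq_add_smul_of_mem_torusComplexification hj h'
    refine ⟨1, ?_⟩
    have e : (((⟨(1 : ℂ) ⊗ₜ[ℝ] j x, tmul_mem_torusComplexification hj.abelian x⟩ + Complex.I •
        (⟨(1 : ℂ) ⊗ₜ[ℝ] j y, tmul_mem_torusComplexification hj.abelian y⟩ :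
          torusComplexification j hj.abelian) : torusComplexification j hj.abelian)) : ℂ ⊗[ℝ] 𝔤)
        = (1 : ℂ) ⊗ₜ[ℝ] j x + Complex.I • ((1 : ℂ) ⊗ₜ[ℝ] j y) := rfl
    simp only [χ]
    rw [pow_one, LinearMap.sub_apply, LieModule.toEnd_apply_apply]
    simp only [LinearMap.smul_apply, Module.End.one_apply]
    change ⁅(1 : ℂ) ⊗ₜ[ℝ] j x + Complex.I • ((1 : ℂ) ⊗ₜ[ℝ] j y), X⁆ - _ = _
    rw [e, add_lie ((1 : ℂ) ⊗ₜ[ℝ] j x) _ X, smul_lie Complex.I ((1 : ℂ) ⊗ₜ[ℝ] j y) X, h, h,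
      smul_smul, ← add_smul, sub_eq_zero]
    congr 1
    simp [TensorProduct.smul_tmul', hf']
    ring
  refine ⟨⟨χ, fun hbot => hX ?_⟩, fun x => ?_, hmem⟩
  · rw [hbot] at hmem
    exact (LieSubmodule.mem_bot _).1 hmem
  · change χ _ = _
    simp [χ, hf']

section

variable [FiniteDimensional ℝ 𝔤] [LieAlgebra.IsSimple ℝ 𝔤]

open LieAlgebra LieAlgebra.IsKilling LieModule in
/-- The real roots of a compact simple Lie algebra form a reduced crystallographic root system. The
coroot of the complexified Lie algebra is compared with the metric coroot through `⁅X, X̄⁆`, for `X`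
a root vector and `X̄` its complex conjugate. -/
theorem isRootSet_realRoots (hB : IsInvariantScalarProduct B) (hj : IsMaximalTorus B j) :
    IsRootSet (realRoots j) := by
  have : LieAlgebra.IsKilling ℂ (ℂ ⊗[ℝ] 𝔤) := isKilling_complexification
  have := isCartanSubalgebra_torusComplexification hB hj
  set H := torusComplexification j hj.abelian with hH
  have huniq : ∀ {a a' : Weight ℂ H (ℂ ⊗[ℝ] 𝔤)} {β : EDual n}, WeightRestricts hj a β →
      WeightRestricts hj a' β → a = a' := by
    intro a a' β h h'
    ext u
    obtain ⟨x, y, rfl⟩ := exists_eq_add_smul_of_mem_torusComplexification hj u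
    rw [← Weight.toLinear_apply, ← Weight.toLinear_apply, map_add, map_add, map_smul, map_smul]
    simp only [Weight.toLinear_apply]
    rw [h x, h y, h' x, h' y]
  have hex : ∀ β ∈ realRoots j, ∃ a : Weight ℂ H (ℂ ⊗[ℝ] 𝔤), WeightRestricts hj a β ∧
      a.IsNonZero := by
    rintro β ⟨h0, X, hX, h⟩
    obtain ⟨a, ha, -⟩ := exists_weightRestricts hj hX h
    refine ⟨a, ha, fun hz => h0 ?_⟩
    ext x
    have := ha x
    rw [hz] at this
    simpa [Real.pi_ne_zero] using this.symm
  have hback : ∀ {a : Weight ℂ H (ℂ ⊗[ℝ] 𝔤)} {β : EDual n}, WeightRestricts hj a β →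
      a.IsNonZero → β ∈ realRoots j := by
    intro a β h ha
    refine ⟨?_, ?_⟩
    · rintro rfl
      refine ha (funext fun u => ?_)
      obtain ⟨x, y, rfl⟩ := exists_eq_add_smul_of_mem_torusComplexification hj u
      rw [← Weight.toLinear_apply, map_add, map_smul]
      simp only [Weight.toLinear_apply]
      rw [h x, h y]
      simp
    · obtain ⟨X, hX, hX0⟩ := a.exists_ne_zero
      refine ⟨X, hX0, fun x => ?_⟩
      rw [← h x]
      exact lie_eq_smul_of_mem_rootSpace hX ⟨_, tmul_mem_torusComplexification hj.abelian x⟩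
  have hco : ∀ β ∈ realRoots j, ∀ a : Weight ℂ H (ℂ ⊗[ℝ] 𝔤), WeightRestricts hj a β →
      ∀ β' : EDual n, ∀ a' : Weight ℂ H (ℂ ⊗[ℝ] 𝔤), WeightRestricts hj a' β' →
        a' (LieAlgebra.IsKilling.coroot a) = (β' (AffineTheta.coroot β) : ℝ) := by
    rintro β ⟨h0, X, hX, h⟩ a ha
    obtain ⟨b, hb, hXb⟩ := exists_weightRestricts hj hX h
    obtain rfl := huniq ha hb
    set U := tensorRe X with hU
    set V := tensorIm X with hV
    have hreI : ∀ (c : ℝ) (Z : ℂ ⊗[ℝ] 𝔤), tensorRe ((2 * Complex.I * (Real.pi : ℂ) * (c : ℂ)) • Z)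
        = -(2 * Real.pi * c) • tensorIm Z := by
      intro c Z
      conv_lhs => rw [← tensorRe_add_tensorIm Z]
      simp [TensorProduct.smul_tmul']
    have himI : ∀ (c : ℝ) (Z : ℂ ⊗[ℝ] 𝔤), tensorIm ((2 * Complex.I * (Real.pi : ℂ) * (c : ℂ)) • Z)
        = (2 * Real.pi * c) • tensorRe Z := by
      intro c Z
      conv_lhs => rw [← tensorRe_add_tensorIm Z]
      simp [TensorProduct.smul_tmul']
    have hlU : ∀ x, ⁅j x, U⁆ = -(2 * Real.pi * β x) • V := fun x => by
      rw [hU, ← tensorRe_lie, h, hreI]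
    have hlV : ∀ x, ⁅j x, V⁆ = (2 * Real.pi * β x) • U := fun x => by
      rw [hV, ← tensorIm_lie, h, himI]
    have hV0 : V ≠ 0 := by
      intro hV0
      obtain ⟨x, hx⟩ : ∃ x, β x ≠ 0 := by
        by_contra! hc
        exact h0 (by ext x; simpa using hc x)
      have h1 := hlV x
      rw [hV0, lie_zero, eq_comm, smul_eq_zero] at h1
      have hU0 : U = 0 := h1.resolve_left (by positivity)
      exact hX (tensor_ext (by rw [map_zero]; exact hU0) (by rw [map_zero]; exact hV0))
    set v : E n := (InnerProductSpace.toDual ℝ (E n)).symm β with hv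
    have hvx : ∀ x, inner ℝ v x = β x := fun x => by
      rw [hv, InnerProductSpace.toDual_symm_apply]
    have hβ0 : ‖β‖ ≠ 0 := norm_ne_zero_iff.2 h0
    have hvv : β v = ‖β‖ ^ 2 := by
      rw [← hvx, real_inner_self_eq_norm_sq, hv, LinearIsometryEquiv.norm_map]
    have hUV : ⁅U, V⁆ = j ((-(2 * Real.pi * B V V)) • v) := by
      obtain ⟨k, hk⟩ := hj.maximal ⁅U, V⁆ fun x => by
        rw [leibniz_lie, hlU, hlV, smul_lie, lie_smul, lie_self, lie_self, smul_zero, smul_zero,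
          add_zero]
      rw [← hk]
      congr 1
      refine ext_inner_right ℝ fun x => ?_
      rw [← hj.isometry, hk, hB.invariant, ← lie_skew, hlU, real_inner_smul_left, hvx]
      simp
      ring
    -- the complex conjugate of `X` is a root vector for `-a`
    set Y : ℂ ⊗[ℝ] 𝔤 := (1 : ℂ) ⊗ₜ[ℝ] U - Complex.I ⊗ₜ[ℝ] V with hY
    have hYl : ∀ x : E n, ⁅(1 : ℂ) ⊗ₜ[ℝ] j x, Y⁆ =
        (2 * Complex.I * (Real.pi : ℂ) * (((-β) x : ℝ) : ℂ)) • Y := by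
      intro x
      apply tensor_ext
      · rw [tensorRe_lie, hreI]
        simp [hY, hlU]
      · rw [tensorIm_lie, himI]
        simp [hY, hlV]
    have hY0 : Y ≠ 0 := by
      intro hc
      have := congrArg tensorIm hc
      simp [hY] at this
      exact hV0 this
    obtain ⟨b, hb, hYb⟩ := exists_weightRestricts hj hY0 hYl
    have hba : b = -a := by
      refine huniq hb fun x => ?_
      rw [Weight.coe_neg, Pi.neg_apply, ha x]
      simp
    have hXY : ⁅X, Y⁆ = (4 * Real.pi * B V V * Complex.I : ℂ) • ((1 : ℂ) ⊗ₜ[ℝ] j v) := by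
      conv_lhs => rw [← tensorRe_add_tensorIm X]
      rw [← hU, ← hV, hY, add_lie ((1 : ℂ) ⊗ₜ[ℝ] U) (Complex.I ⊗ₜ[ℝ] V) _,
        lie_sub ((1 : ℂ) ⊗ₜ[ℝ] U), lie_sub (Complex.I ⊗ₜ[ℝ] V)]
      simp only [LieAlgebra.ExtendScalars.bracket_tmul, lie_self, zero_sub, sub_zero,
        one_mul, mul_one]
      rw [← lie_skew V U, TensorProduct.tmul_neg, hUV, map_smul]
      have : (4 * Real.pi * B V V * Complex.I : ℂ) • ((1 : ℂ) ⊗ₜ[ℝ] j v)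
          = Complex.I ⊗ₜ[ℝ] ((4 * Real.pi * B V V) • j v) := by
        rw [← TensorProduct.smul_tmul, TensorProduct.smul_tmul']
        congr 1
        simp
      rw [this, ← sub_eq_zero, ← TensorProduct.tmul_neg, ← TensorProduct.tmul_add,
        ← TensorProduct.tmul_sub, ← neg_smul, ← add_smul, ← sub_smul,
        show - -(2 * Real.pi * B V V) + - -(2 * Real.pi * B V V) - 4 * Real.pi * B V V = 0 by ring,
        zero_smul, TensorProduct.tmul_zero]
    set h0' : H := ⟨(1 : ℂ) ⊗ₜ[ℝ] j v, tmul_mem_torusComplexification hj.abelian v⟩ with hh0'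
    have hmem : h0' ∈ corootSpace a := by
      rw [mem_corootSpace]
      have hne : (4 * Real.pi * B V V * Complex.I : ℂ) ≠ 0 := by
        have := (hB.pos V hV0).ne'
        simp [Real.pi_ne_zero, this]
      have : (h0' : ℂ ⊗[ℝ] 𝔤) = (4 * Real.pi * B V V * Complex.I : ℂ)⁻¹ • ⁅X, Y⁆ := by
        rw [hXY, inv_smul_smul₀ hne]
      rw [this]
      refine Submodule.smul_mem _ _ (Submodule.subset_span ⟨X, hXb, Y, ?_, rfl⟩)
      rw [hba] at hYb
      exact hYb
    have hπ : (Real.pi * Complex.I * (‖β‖ : ℂ) ^ 2) ≠ 0 := by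
      simp [Real.pi_ne_zero, hβ0]
    have hβC : (‖β‖ : ℂ) ≠ 0 := by exact_mod_cast hβ0
    have hcor : (Real.pi * Complex.I * (‖β‖ : ℂ) ^ 2)⁻¹ • h0' = LieAlgebra.IsKilling.coroot a := by
      refine eq_coroot_of_mem_corootSpace_of_two a ?_ ?_
      · exact (corootSpace a).smul_mem _ hmem
      · rw [← Weight.toLinear_apply, map_smul, Weight.toLinear_apply, ha v, hvv, smul_eq_mul]
        push_cast
        field_simp
    intro β' a' ha'
    rw [← hcor, ← Weight.toLinear_apply, map_smul, Weight.toLinear_apply, ha' v, smul_eq_mul,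
      AffineTheta.coroot, map_smul, smul_eq_mul, ← hv]
    push_cast
    have := Complex.I_ne_zero
    have : (Real.pi : ℂ) ≠ 0 := by exact_mod_cast Real.pi_ne_zero
    field_simp
  rcases (realRoots j).eq_empty_or_nonempty with he | ⟨β₀, hβ₀⟩
  · rw [he]
    constructor <;> simp
  have : Nonempty (Weight ℂ H (ℂ ⊗[ℝ] 𝔤)) := ⟨(hex β₀ hβ₀).choose⟩
  choose! w hw hw0 using hex
  constructor
  · refine Set.Finite.of_finite_image (f := w) (Set.toFinite _) fun β hβ β' hβ' he => ?_
    ext x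
    have h1 := hw β hβ x
    have h2 := hw β' hβ' x
    rw [he, h2] at h1
    have hne : (2 * Complex.I * (Real.pi : ℂ)) ≠ 0 := by simp [Real.pi_ne_zero]
    exact_mod_cast (mul_left_cancel₀ hne h1).symm
  · exact fun β hβ => hβ.1
  · intro β hβ β' hβ'
    have h1 := hco β hβ _ (hw β hβ) β' _ (hw β' hβ')
    rw [apply_coroot_eq_cast] at h1
    exact ⟨chainBotCoeff (w β) (w β') - chainTopCoeff (w β) (w β'), by exact_mod_cast h1.symm⟩
  · intro β hβ β' hβ'
    refine hback (a := reflectRoot (w β) (w β')) (fun x => ?_)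
      (reflectRoot_isNonZero _ _ (hw0 β' hβ'))
    have h1 := hco β hβ _ (hw β hβ) β' _ (hw β' hβ')
    change (w β' - (w β') (LieAlgebra.IsKilling.coroot (w β)) • (w β) : H → ℂ) _ = _
    rw [Pi.sub_apply, Pi.smul_apply, h1, hw β hβ x, hw β' hβ' x]
    simp
    ring
  · intro β hβ c hc
    have h1 : (w (c • β) : H → ℂ) = (c : ℂ) • w β := by
      funext u
      obtain ⟨x, y, rfl⟩ := exists_eq_add_smul_of_mem_torusComplexification hj u
      rw [Pi.smul_apply, ← Weight.toLinear_apply, ← Weight.toLinear_apply, map_add, map_add,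
        map_smul, map_smul]
      simp only [Weight.toLinear_apply]
      rw [hw _ hc x, hw _ hc y, hw β hβ x, hw β hβ y]
      simp
      ring
    rcases eq_neg_one_or_eq_zero_or_eq_one_of_eq_smul (w β) (w (c • β)) (hw0 β hβ) _ h1 with
      h | h | h
    · right; simpa using congrArg Complex.re h
    · exfalso
      have : c = 0 := by exact_mod_cast h
      exact hc.1 (by rw [this, zero_smul])
    · left; exact_mod_cast h

end

end Roots

/-! ### Affine reflections -/

/-- The vector `ν⁻¹(β)`. -/
def sharp (β : EDual n) : E n := (InnerProductSpace.toDual ℝ (E n)).symm β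

lemma inner_sharp (β : EDual n) (x : E n) : inner ℝ (sharp β) x = β x :=
  InnerProductSpace.toDual_symm_apply

lemma norm_sharp (β : EDual n) : ‖sharp β‖ = ‖β‖ := LinearIsometryEquiv.norm_map _ _

lemma sharp_sub (β β' : EDual n) : sharp (β - β') = sharp β - sharp β' := map_sub _ _ _

lemma sharp_smul (c : ℝ) (β : EDual n) : sharp (c • β) = c • sharp β := by
  simp [sharp]

lemma apply_sharp_self (β : EDual n) : β (sharp β) = ‖β‖ ^ 2 := by
  rw [← inner_sharp, real_inner_self_eq_norm_sq, norm_sharp]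

lemma apply_sharp_comm (β β' : EDual n) : β (sharp β') = β' (sharp β) := by
  rw [← inner_sharp, ← inner_sharp, real_inner_comm]

lemma coroot_eq (β : EDual n) : coroot β = (2 / ‖β‖ ^ 2) • sharp β := rfl

lemma apply_coroot (β β' : EDual n) : β (coroot β') = 2 / ‖β'‖ ^ 2 * β (sharp β') := by
  rw [coroot_eq, map_smul, smul_eq_mul]

lemma apply_coroot_self {β : EDual n} (hβ : β ≠ 0) : β (coroot β) = 2 := by
  have : ‖β‖ ≠ 0 := norm_ne_zero_iff.2 hβ
  rw [apply_coroot, apply_sharp_self]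
  field_simp

lemma coroot_neg (β : EDual n) : coroot (-β) = -coroot β := by
  simp [coroot]

lemma apply_coroot_pos_iff {β β' : EDual n} (hβ' : β' ≠ 0) :
    0 < β (coroot β') ↔ 0 < β (sharp β') := by
  have : 0 < ‖β'‖ := norm_pos_iff.2 hβ'
  rw [apply_coroot]
  exact mul_pos_iff_of_pos_left (by positivity)

lemma apply_coroot_neg_iff {β β' : EDual n} (hβ' : β' ≠ 0) :
    β (coroot β') < 0 ↔ β (sharp β') < 0 := by
  have : 0 < ‖β'‖ := norm_pos_iff.2 hβ'
  have h2 : 0 < 2 / ‖β'‖ ^ 2 := by positivity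
  rw [apply_coroot]
  exact ⟨fun h => (pos_iff_neg_of_mul_neg h).1 h2, fun h => mul_neg_of_pos_of_neg h2 h⟩

/-- The dual reflection `s_{β'}(β) = β - β(β'^∨) β'`. -/
def dualRefl (β' β : EDual n) : EDual n := β - β (coroot β') • β'

lemma norm_dualRefl {β β' : EDual n} (hβ' : β' ≠ 0) : ‖dualRefl β' β‖ = ‖β‖ := by
  have h0 : ‖β'‖ ≠ 0 := norm_ne_zero_iff.2 hβ'
  have h : ‖dualRefl β' β‖ ^ 2 = ‖β‖ ^ 2 := by
    rw [← norm_sharp, ← norm_sharp β, dualRefl, sharp_sub, sharp_smul, norm_sub_sq_real,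
      inner_smul_right, inner_sharp, norm_smul, norm_sharp, norm_sharp, apply_coroot, mul_pow,
      Real.norm_eq_abs, sq_abs]
    field_simp
    ring
  exact (sq_eq_sq₀ (norm_nonneg _) (norm_nonneg _)).1 h

lemma coroot_dualRefl {β β' : EDual n} (hβ' : β' ≠ 0) :
    coroot (dualRefl β' β) = coroot β - β' (coroot β) • coroot β' := by
  have h0 : ‖β'‖ ≠ 0 := norm_ne_zero_iff.2 hβ'
  rw [coroot_eq, norm_dualRefl hβ', dualRefl, sharp_sub, sharp_smul, coroot_eq β, coroot_eq β',
    smul_sub, smul_smul, smul_smul, map_smul, map_smul, smul_eq_mul, smul_eq_mul,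
    apply_sharp_comm β' β]
  congr 2
  ring

lemma dualRefl_dualRefl {β β' : EDual n} (hβ' : β' ≠ 0) : dualRefl β' (dualRefl β' β) = β := by
  simp only [dualRefl, sub_apply, smul_apply,
    apply_coroot_self hβ', smul_eq_mul]
  module

lemma dualRefl_apply (β β' : EDual n) (x : E n) : dualRefl β' β x = β x - β (coroot β') * β' x := by
  simp [dualRefl]

/-- The reflection of `E n` in the affine hyperplane `β = k`. -/
def affRefl (β : EDual n) (k : ℝ) (b : E n) : E n := b - (β b - k) • coroot β

lemma apply_affRefl (β β' : EDual n) (k : ℝ) (b : E n) :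
    β (affRefl β' k b) = dualRefl β' β b + k * β (coroot β') := by
  simp only [affRefl, dualRefl_apply, map_sub, map_smul, smul_eq_mul]
  ring

lemma affRefl_affRefl {β : EDual n} (hβ : β ≠ 0) (k : ℝ) (b : E n) :
    affRefl β k (affRefl β k b) = b := by
  have h : β (affRefl β k b) = 2 * k - β b := by
    rw [apply_affRefl, dualRefl_apply, apply_coroot_self hβ]
    ring
  rw [affRefl, h, affRefl]
  module

lemma affRefl_of_apply_eq {β : EDual n} {k : ℝ} {b : E n} (h : β b = k) : affRefl β k b = b := by
  rw [affRefl, h, sub_self, zero_smul, sub_zero]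

lemma affRefl_neg (β : EDual n) (k : ℝ) (b : E n) : affRefl (-β) (-k) b = affRefl β k b := by
  rw [affRefl, affRefl, coroot_neg]
  simp only [neg_apply]
  module

/-- Conjugating an affine reflection by another one gives the reflection in the image of its
hyperplane. -/
lemma affRefl_conj {β β' : EDual n} (hβ' : β' ≠ 0) (k k' : ℝ) (b : E n) :
    affRefl β' k' (affRefl β k (affRefl β' k' b)) =
      affRefl (dualRefl β' β) (k - k' * β (coroot β')) b := by
  have h1 : ∀ (x v : E n), affRefl β' k' (x - v) = affRefl β' k' x - (v - β' v • coroot β') := by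
    intro x v
    simp only [affRefl, map_sub]
    module
  have h2 : β (affRefl β' k' b) - k = dualRefl β' β b - (k - k' * β (coroot β')) := by
    rw [apply_affRefl]
    ring
  conv_lhs => rw [affRefl.eq_def β k, h1, affRefl_affRefl hβ', h2]
  rw [affRefl, coroot_dualRefl hβ', map_smul, smul_eq_mul, mul_smul, smul_sub]

/-! ### Combinatorics of positive roots -/

section Combinatorics

variable {Φ : Set (EDual n)} {α : Fin n → EDual n} {θ : EDual n}

lemma IsRootSet.dualRefl_mem (hΦ : IsRootSet Φ) {β β' : EDual n} (hβ : β ∈ Φ) (hβ' : β' ∈ Φ) :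
    dualRefl β β' ∈ Φ := hΦ.reflect β hβ β' hβ'

lemma IsRootSet.neg_mem (hΦ : IsRootSet Φ) {β : EDual n} (hβ : β ∈ Φ) : -β ∈ Φ := by
  have h := hΦ.reflect β hβ β hβ
  rw [apply_coroot_self (hΦ.ne_zero β hβ)] at h
  convert h using 1
  module

lemma IsSimpleSystem.eq_zero_of_apply (hα : IsSimpleSystem Φ α) {x : E n}
    (hx : ∀ i, α i x = 0) : x = 0 := by
  have hspan : Submodule.span ℝ (Set.range α) = ⊤ := by
    apply hα.linearIndependent.span_eq_top_of_card_eq_finrank'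
    rw [LinearEquiv.finrank_eq (InnerProductSpace.toDual ℝ (E n)).symm.toLinearEquiv]
    simp
  have hall : ∀ β : EDual n, β x = 0 := by
    intro β
    have hβ : β ∈ Submodule.span ℝ (Set.range α) := by rw [hspan]; trivial
    induction hβ using Submodule.span_induction with
    | mem β h => obtain ⟨i, rfl⟩ := h; exact hx i
    | zero => rfl
    | add β β' _ _ h h' => simp [h, h']
    | smul c β _ h => simp [h]
  have := hall (InnerProductSpace.toDual ℝ (E n) x)
  simpa using this

/-- The fundamental coweights. -/
lemma IsSimpleSystem.exists_coweights (hα : IsSimpleSystem Φ α) :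
    ∃ ω : Fin n → E n, ∀ i k, α i (ω k) = if i = k then 1 else 0 := by
  let f : E n →ₗ[ℝ] (Fin n → ℝ) := LinearMap.pi fun i => (α i : E n →ₗ[ℝ] ℝ)
  have hinj : Function.Injective f := by
    rw [injective_iff_map_eq_zero]
    exact fun x hx => hα.eq_zero_of_apply fun i => congrFun hx i
  have hsurj : Function.Surjective f :=
    (LinearMap.injective_iff_surjective_of_finrank_eq_finrank (by simp)).1 hinj
  choose g hg using hsurj
  refine ⟨fun k => g (Pi.single k 1), fun i k => ?_⟩
  have := congrFun (hg (Pi.single k 1)) i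
  simpa [f, Pi.single_apply] using this

lemma cone_coord {ω : Fin n → E n} (hω : ∀ i k, α i (ω k) = if i = k then 1 else 0)
    {β : EDual n} (hβ : β ∈ AddSubmonoid.closure (Set.range α)) :
    (∀ i, ∃ m : ℕ, β (ω i) = m) ∧ β = ∑ i, β (ω i) • α i := by
  obtain ⟨a, rfl⟩ := AddSubmonoid.exists_of_mem_closure_range α β hβ
  have h : ∀ i, (∑ k, a k • α k) (ω i) = (a i : ℝ) := by
    intro i
    simp [hω]
  refine ⟨fun i => ⟨a i, h i⟩, ?_⟩
  refine Finset.sum_congr rfl fun i _ => ?_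
  rw [h, Nat.cast_smul_eq_nsmul]

/-- A root system with simple roots `α`, highest root `θ` of square length `2`, and fundamental
coweights `ω`. -/
structure IsAffineDatum (Φ : Set (EDual n)) (α : Fin n → EDual n) (θ : EDual n)
    (ω : Fin n → E n) : Prop where
  rootSet : IsRootSet Φ
  simple : IsSimpleSystem Φ α
  highest : IsHighestRoot Φ α θ
  norm_sq : ‖θ‖ ^ 2 = 2
  coweight : ∀ i k, α i (ω k) = if i = k then 1 else 0

variable {ω : Fin n → E n}

namespace IsAffineDatum

lemma ne_zero (h : IsAffineDatum Φ α θ ω) {β : EDual n} (hβ : β ∈ Φ) : β ≠ 0 :=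
  h.rootSet.ne_zero β hβ

lemma posRoots_finite (h : IsAffineDatum Φ α θ ω) : (posRoots Φ α).Finite :=
  h.rootSet.finite.subset fun _ hβ => hβ.1

lemma simple_mem_posRoots (h : IsAffineDatum Φ α θ ω) (i : Fin n) : α i ∈ posRoots Φ α :=
  ⟨h.simple.mem i, AddSubmonoid.subset_closure ⟨i, rfl⟩⟩

lemma eq_sum (h : IsAffineDatum Φ α θ ω) {β : EDual n} (hβ : β ∈ Φ) :
    β = ∑ i, β (ω i) • α i := by
  rcases h.simple.mem_or_neg_mem β hβ with hp | hp
  · exact (cone_coord h.coweight hp).2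
  · rw [← neg_inj]
    conv_lhs => rw [(cone_coord h.coweight hp).2]
    rw [← Finset.sum_neg_distrib]
    refine Finset.sum_congr rfl fun i _ => ?_
    rw [neg_apply]
    module

lemma coord_nonneg (h : IsAffineDatum Φ α θ ω) {β : EDual n} (hβ : β ∈ posRoots Φ α) (i : Fin n) :
    0 ≤ β (ω i) := by
  obtain ⟨m, hm⟩ := (cone_coord h.coweight hβ.2).1 i
  rw [hm]
  positivity

lemma mem_posRoots_of_coord_pos (h : IsAffineDatum Φ α θ ω) {β : EDual n} (hβ : β ∈ Φ) {i : Fin n}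
    (hi : 0 < β (ω i)) : β ∈ posRoots Φ α := by
  refine ⟨hβ, (h.simple.mem_or_neg_mem β hβ).resolve_right fun hp => ?_⟩
  obtain ⟨m, hm⟩ := (cone_coord h.coweight hp).1 i
  have : (0 : ℝ) ≤ m := by positivity
  rw [neg_apply] at hm
  linarith

lemma exists_coord_pos (h : IsAffineDatum Φ α θ ω) {β : EDual n} (hβ : β ∈ posRoots Φ α) :
    ∃ i, 0 < β (ω i) := by
  by_contra! hc
  refine h.ne_zero hβ.1 ?_
  rw [h.eq_sum hβ.1]
  refine Finset.sum_eq_zero fun i _ => ?_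
  rw [le_antisymm (hc i) (h.coord_nonneg hβ i), zero_smul]

lemma neg_notMem_posRoots (h : IsAffineDatum Φ α θ ω) {β : EDual n} (hβ : β ∈ posRoots Φ α) :
    -β ∉ posRoots Φ α := fun hn => by
  obtain ⟨i, hi⟩ := h.exists_coord_pos hβ
  have := h.coord_nonneg hn i
  rw [neg_apply] at this
  linarith

lemma mem_or_neg_mem_posRoots (h : IsAffineDatum Φ α θ ω) {β : EDual n} (hβ : β ∈ Φ) :
    β ∈ posRoots Φ α ∨ -β ∈ posRoots Φ α :=
  (h.simple.mem_or_neg_mem β hβ).imp (fun hp => ⟨hβ, hp⟩) fun hp => ⟨h.rootSet.neg_mem hβ, hp⟩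

lemma coord_le_highest (h : IsAffineDatum Φ α θ ω) {β : EDual n} (hβ : β ∈ Φ) (i : Fin n) :
    β (ω i) ≤ θ (ω i) := by
  obtain ⟨m, hm⟩ := (cone_coord h.coweight (h.highest.highest β hβ)).1 i
  have : (0 : ℝ) ≤ m := by positivity
  rw [sub_apply] at hm
  linarith

lemma highest_mem_posRoots (h : IsAffineDatum Φ α θ ω) : θ ∈ posRoots Φ α := by
  refine ⟨h.highest.mem, (h.simple.mem_or_neg_mem θ h.highest.mem).resolve_right fun hp => ?_⟩
  refine h.ne_zero h.highest.mem ?_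
  rw [h.eq_sum h.highest.mem]
  refine Finset.sum_eq_zero fun i _ => ?_
  obtain ⟨m, hm⟩ := (cone_coord h.coweight hp).1 i
  have h1 := h.coord_le_highest (h.rootSet.neg_mem h.highest.mem) i
  have : (0 : ℝ) ≤ m := by positivity
  rw [neg_apply] at hm h1
  rw [show θ (ω i) = 0 by linarith, zero_smul]

/-- Positive roots which are proportional to a positive root are equal to it. -/
lemma eq_of_eq_smul (h : IsAffineDatum Φ α θ ω) {β β' : EDual n} (hβ : β ∈ posRoots Φ α)
    (hβ' : β' ∈ posRoots Φ α) {c : ℝ} (hc : β' = c • β) : β' = β := by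
  rcases h.rootSet.reduced β hβ.1 c (hc ▸ hβ'.1) with rfl | rfl
  · rw [hc, one_smul]
  · replace hc : β' = -β := by rw [hc]; module
    exact absurd (hc ▸ hβ') (h.neg_notMem_posRoots hβ)

/-- A positive root other than `α i` involves another simple root. -/
lemma exists_other_coord_pos (h : IsAffineDatum Φ α θ ω) {β : EDual n} (hβ : β ∈ posRoots Φ α)
    {i : Fin n} (hi : β ≠ α i) : ∃ k, k ≠ i ∧ 0 < β (ω k) := by
  by_contra! hc
  refine hi (h.eq_of_eq_smul (c := β (ω i)) (h.simple_mem_posRoots i) hβ ?_)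
  conv_lhs => rw [h.eq_sum hβ.1]
  refine Finset.sum_eq_single i (fun k _ hk => ?_) (by simp)
  rw [le_antisymm (hc k hk) (h.coord_nonneg hβ k), zero_smul]

/-- A simple reflection permutes the other positive roots. -/
lemma dualRefl_simple_mem (h : IsAffineDatum Φ α θ ω) {β : EDual n} (hβ : β ∈ posRoots Φ α)
    {i : Fin n} (hi : β ≠ α i) : dualRefl (α i) β ∈ posRoots Φ α := by
  obtain ⟨k, hk, hpos⟩ := h.exists_other_coord_pos hβ hi
  refine h.mem_posRoots_of_coord_pos (h.rootSet.dualRefl_mem (h.simple.mem i) hβ.1) (i := k) ?_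
  rw [dualRefl_apply, h.coweight, if_neg (Ne.symm hk)]
  simpa using hpos

/-- The pairing of a positive root other than `θ` with the coroot of `θ` is `0` or `1`. -/
lemma apply_coroot_highest (h : IsAffineDatum Φ α θ ω) {β : EDual n} (hβ : β ∈ posRoots Φ α)
    (hne : β ≠ θ) : β (coroot θ) = 0 ∨ (β (coroot θ) = 1 ∧ θ - β ∈ posRoots Φ α) := by
  obtain ⟨k, hk⟩ := h.rootSet.integral θ h.highest.mem β hβ.1
  have hr := h.rootSet.dualRefl_mem h.highest.mem hβ.1
  -- the coordinates of `β - k θ` lie between those of `-θ` and `θ`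
  have hup : ∀ i, β (ω i) - k * θ (ω i) ≤ θ (ω i) := fun i => by
    have := h.coord_le_highest hr i
    rwa [dualRefl_apply, hk] at this
  have hlow : ∀ i, -(β (ω i) - k * θ (ω i)) ≤ θ (ω i) := fun i => by
    have := h.coord_le_highest (h.rootSet.neg_mem hr) i
    rwa [neg_apply, dualRefl_apply, hk] at this
  obtain ⟨i, hi⟩ := h.exists_coord_pos hβ
  have hle := fun i => h.coord_le_highest hβ.1 i
  have hθi : 0 < θ (ω i) := hi.trans_le (hle i)
  have hk0 : -1 < k := by
    by_contra! hk1
    have : (k : ℝ) ≤ -1 := by exact_mod_cast hk1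
    nlinarith [hup i]
  have hk2 : k < 2 := by
    by_contra! hk1
    have hk1' : (2 : ℝ) ≤ k := by exact_mod_cast hk1
    apply hne
    rw [h.eq_sum hβ.1, h.eq_sum h.highest.mem]
    refine Finset.sum_congr rfl fun l _ => ?_
    have h1 := h.coord_nonneg hβ l
    have h2 : β (ω l) = θ (ω l) := by
      refine le_antisymm (hle l) ?_
      nlinarith [hlow l, h.coord_nonneg h.highest_mem_posRoots l]
    rw [h2]
  obtain rfl | rfl : k = 0 ∨ k = 1 := by omega
  · left; simpa using hk
  · right
    refine ⟨by simpa using hk, ?_, h.highest.highest β hβ.1⟩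
    have := h.rootSet.neg_mem hr
    rw [dualRefl, hk] at this
    simpa using this

end IsAffineDatum

end Combinatorics

/-! ### The action of the affine Weyl group on `E n` -/

/-- `w` is contragredient to the map `r` of `E n`: modulo `c`, the transpose of `w` maps `d + b` to
`d + r b`, and the coefficient of `c` is prescribed by the invariance of `2 p q + ‖b‖²`. -/
structure Represents (w : AffDual n ≃ₗ[ℝ] AffDual n) (r : E n → E n) : Prop where
  level : ∀ l, (w l).1 = l.1
  pair : ∀ l b, pairing (w l) (0, b, 1) = l.1 * ((‖b‖ ^ 2 - ‖r b‖ ^ 2) / 2) + l.2.1 (r b) + l.2.2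

lemma represents_one : Represents (1 : AffDual n ≃ₗ[ℝ] AffDual n) id where
  level l := rfl
  pair l b := by simp [pairing]

lemma Represents.mul {w w' : AffDual n ≃ₗ[ℝ] AffDual n} {r r' : E n → E n} (h : Represents w r)
    (h' : Represents w' r') : Represents (w * w') (fun b => r' (r b)) where
  level l := by
    rw [LinearEquiv.mul_apply, h.level, h'.level]
  pair l b := by
    have h1 := h.pair (w' l) b
    have h2 := h'.pair l (r b)
    have h3 := h'.level l
    simp only [pairing] at h1 h2
    rw [LinearEquiv.mul_apply]
    simp only [pairing]
    rw [h1, h3]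
    linarith

lemma Represents.congr {w : AffDual n ≃ₗ[ℝ] AffDual n} {r r' : E n → E n} (h : Represents w r)
    (hr : ∀ b, r b = r' b) : Represents w r' := by
  rwa [← funext hr]

lemma Represents.injective {w w' : AffDual n ≃ₗ[ℝ] AffDual n} {r : E n → E n}
    (h : Represents w r) (h' : Represents w' r) : w = w' := by
  ext1 l
  have key : ∀ b : E n, (w l).2.1 b + (w l).2.2 = (w' l).2.1 b + (w' l).2.2 := by
    intro b
    have h1 := h.pair l b
    rw [← h'.pair l b] at h1
    simpa [pairing] using h1
  have h0 : (w l).2.2 = (w' l).2.2 := by simpa using key 0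
  refine Prod.ext ?_ (Prod.ext ?_ h0)
  · rw [h.level, h'.level]
  · ext b
    have := key b
    rw [h0] at this
    linarith

/-- The isometry `b ↦ g b + m` maps roots to roots and `m` has integral pairings with the roots. -/
structure IsAffineSymm (Φ : Set (EDual n)) (g : E n ≃ₗᵢ[ℝ] E n) (m : E n) : Prop where
  root : ∀ β ∈ Φ, ∃ β' ∈ Φ, ∀ x, β' x = β (g x)
  int : ∀ β ∈ Φ, ∃ k : ℤ, β m = k

/-- The linear reflection `b ↦ b - β(b) β^∨`. -/
def linRefl (β : EDual n) (hβ : β ≠ 0) : E n ≃ₗᵢ[ℝ] E n where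
  toLinearEquiv := LinearEquiv.ofInvolutive
    (LinearMap.id - ((β : E n →ₗ[ℝ] ℝ).smulRight (coroot β))) fun b => by
      simpa [affRefl] using affRefl_affRefl hβ 0 b
  norm_map' b := by
    have h0 : ‖β‖ ≠ 0 := norm_ne_zero_iff.2 hβ
    have h : ‖b - β b • coroot β‖ ^ 2 = ‖b‖ ^ 2 := by
      rw [norm_sub_sq_real, coroot_eq, inner_smul_right, inner_smul_right, real_inner_comm,
        inner_sharp, norm_smul, norm_smul, norm_sharp, mul_pow, mul_pow, Real.norm_eq_abs,
        Real.norm_eq_abs, sq_abs, sq_abs]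
      field_simp
      ring
    exact (sq_eq_sq₀ (norm_nonneg _) (norm_nonneg _)).1 h

lemma linRefl_apply {β : EDual n} (hβ : β ≠ 0) (b : E n) :
    linRefl β hβ b = b - β b • coroot β := rfl

section

variable {Φ : Set (EDual n)} {α : Fin n → EDual n} {θ : EDual n} {ω : Fin n → E n}

lemma IsRootSet.isAffineSymm_linRefl (hΦ : IsRootSet Φ) {β : EDual n} (hβ : β ∈ Φ) (k : ℤ) :
    IsAffineSymm Φ (linRefl β (hΦ.ne_zero β hβ)) ((k : ℝ) • coroot β) where
  root β' hβ' := ⟨_, hΦ.dualRefl_mem hβ hβ', fun x => by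
    rw [dualRefl_apply, linRefl_apply, map_sub, map_smul, smul_eq_mul, mul_comm]⟩
  int β' hβ' := by
    obtain ⟨l, hl⟩ := hΦ.integral β hβ β' hβ'
    exact ⟨k * l, by rw [map_smul, hl, smul_eq_mul]; push_cast; ring⟩

lemma IsAffineSymm.comp {g g' : E n ≃ₗᵢ[ℝ] E n} {m m' : E n} (h : IsAffineSymm Φ g m)
    (h' : IsAffineSymm Φ g' m') : IsAffineSymm Φ (g.trans g') (g' m + m') where
  root β hβ := by
    obtain ⟨β', hβ', e⟩ := h'.root β hβ
    obtain ⟨β'', hβ'', e'⟩ := h.root β' hβ'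
    exact ⟨β'', hβ'', fun x => by rw [e', e]; rfl⟩
  int β hβ := by
    obtain ⟨β', hβ', e⟩ := h'.root β hβ
    obtain ⟨k, hk⟩ := h.int β' hβ'
    obtain ⟨k', hk'⟩ := h'.int β hβ
    exact ⟨k + k', by rw [map_add, ← e, hk, hk']; push_cast; ring⟩

namespace IsAffineDatum

lemma sinProd_eq (h : IsAffineDatum Φ α θ ω) (b : E n) :
    sinProd (posRoots Φ α) b = ∏ β ∈ h.posRoots_finite.toFinset, Real.sin (Real.pi * β b) := by
  rw [sinProd, finprod_mem_eq_finite_toFinset_prod _ h.posRoots_finite]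

/-- A map which flips the sign of one factor of `sinProd` and permutes the other ones changes the
sign of `sinProd`. -/
lemma sinProd_comp_eq_neg (h : IsAffineDatum Φ α θ ω) {ρ : EDual n} (hρ : ρ ∈ posRoots Φ α)
    {r : E n → E n} {σ : EDual n → EDual n}
    (hσ : ∀ β ∈ posRoots Φ α, β ≠ ρ → σ β ∈ posRoots Φ α ∧ σ β ≠ ρ ∧ σ (σ β) = β)
    (hsin : ∀ β ∈ posRoots Φ α, β ≠ ρ → ∀ b,
      Real.sin (Real.pi * β (r b)) = Real.sin (Real.pi * σ β b))
    (hneg : ∀ b, Real.sin (Real.pi * ρ (r b)) = -Real.sin (Real.pi * ρ b)) (b : E n) :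
    sinProd (posRoots Φ α) (r b) = -sinProd (posRoots Φ α) b := by
  classical
  have hm : ρ ∈ h.posRoots_finite.toFinset := by simpa using hρ
  rw [h.sinProd_eq, h.sinProd_eq, ← Finset.mul_prod_erase _ _ hm, ← Finset.mul_prod_erase _ _ hm,
    hneg, neg_mul, neg_inj]
  congr 1
  refine Finset.prod_bij' (fun β _ => σ β) (fun β _ => σ β) ?_ ?_ ?_ ?_ ?_
  · intro β hβ
    simp only [Finset.mem_erase, Set.Finite.mem_toFinset] at hβ ⊢
    exact ⟨(hσ β hβ.2 hβ.1).2.1, (hσ β hβ.2 hβ.1).1⟩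
  · intro β hβ
    simp only [Finset.mem_erase, Set.Finite.mem_toFinset] at hβ ⊢
    exact ⟨(hσ β hβ.2 hβ.1).2.1, (hσ β hβ.2 hβ.1).1⟩
  · intro β hβ
    simp only [Finset.mem_erase, Set.Finite.mem_toFinset] at hβ
    exact (hσ β hβ.2 hβ.1).2.2
  · intro β hβ
    simp only [Finset.mem_erase, Set.Finite.mem_toFinset] at hβ
    exact (hσ β hβ.2 hβ.1).2.2
  · intro β hβ
    simp only [Finset.mem_erase, Set.Finite.mem_toFinset] at hβ
    exact hsin β hβ.2 hβ.1 b

lemma sinProd_affRefl_simple (h : IsAffineDatum Φ α θ ω) (i : Fin n) (b : E n) :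
    sinProd (posRoots Φ α) (affRefl (α i) 0 b) = -sinProd (posRoots Φ α) b := by
  have h0 := h.ne_zero (h.simple.mem i)
  refine h.sinProd_comp_eq_neg (h.simple_mem_posRoots i) (r := affRefl (α i) 0)
    (σ := dualRefl (α i)) (fun β hβ hne => ⟨h.dualRefl_simple_mem hβ hne, fun he => ?_,
      dualRefl_dualRefl h0⟩) (fun β hβ hne b => ?_) (fun b => ?_) b
  · have h1 : β = dualRefl (α i) (α i) :=
      (dualRefl_dualRefl h0).symm.trans (congrArg _ he)
    refine h.neg_notMem_posRoots (h.simple_mem_posRoots i) ?_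
    convert hβ using 1
    rw [h1, dualRefl, apply_coroot_self h0]
    module
  · rw [apply_affRefl, zero_mul, add_zero]
  · rw [apply_affRefl, dualRefl_apply, apply_coroot_self h0, ← Real.sin_neg]
    congr 1
    ring

lemma sinProd_affRefl_highest (h : IsAffineDatum Φ α θ ω) (b : E n) :
    sinProd (posRoots Φ α) (affRefl θ 1 b) = -sinProd (posRoots Φ α) b := by
  classical
  have h0 := h.ne_zero h.highest.mem
  refine h.sinProd_comp_eq_neg h.highest_mem_posRoots (r := affRefl θ 1)
    (σ := fun β => if β (coroot θ) = 0 then β else θ - β) (fun β hβ hne => ?_)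
    (fun β hβ hne b => ?_) (fun b => ?_) b
  · rcases h.apply_coroot_highest hβ hne with hk | ⟨hk, hm⟩
    · simp [hk, hβ, hne]
    · have h1 : (θ - β) (coroot θ) = 1 := by
        rw [sub_apply, apply_coroot_self h0, hk]
        norm_num
      simp only [hk, h1, one_ne_zero, if_false, sub_sub_cancel, and_true]
      refine ⟨hm, fun he => h.ne_zero hβ.1 ?_⟩
      simpa using he
  · rcases h.apply_coroot_highest hβ hne with hk | ⟨hk, hm⟩
    · rw [apply_affRefl, dualRefl_apply, hk]
      simp
    · rw [apply_affRefl, dualRefl_apply, hk, if_neg one_ne_zero, sub_apply,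
        ← Real.sin_pi_sub]
      congr 1
      ring
  · rw [apply_affRefl, dualRefl_apply, apply_coroot_self h0, ← Real.sin_neg,
      ← Real.sin_add_two_pi (-(Real.pi * θ b))]
    congr 1
    ring

end IsAffineDatum

/-- The finite part of the simple affine root with index `i`, up to sign. -/
def nodeRoot (α : Fin n → EDual n) (θ : EDual n) : Option (Fin n) → EDual n
  | none => θ
  | some i => α i

/-- The level of the wall with index `i` of the fundamental alcove. -/
def nodeLevel : Option (Fin n) → ℤ
  | none => 1
  | some _ => 0

/-- The pairing with a fixed vector, as a linear form. -/
def pairingForm (h : AffCartan n) : AffDual n →ₗ[ℝ] ℝ where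
  toFun l := pairing l h
  map_add' l l' := by simp [pairing]; ring
  map_smul' c l := by simp [pairing]; ring

lemma pairing_sub_smul (l l' : AffDual n) (c : ℝ) (h : AffCartan n) :
    pairing (l - c • l') h = pairing l h - c * pairing l' h := by
  change pairingForm h _ = pairingForm h _ - c * pairingForm h _
  rw [map_sub, map_smul, smul_eq_mul]

/-- The reflections `s_i` act as the reflections in the walls of the fundamental alcove. -/
lemma represents_fundamental (hn : ‖θ‖ ^ 2 = 2) {s : AffDual n ≃ₗ[ℝ] AffDual n}
    {i : Option (Fin n)}
    (hs : ∀ l, s l = l - pairing l (affCoroot α θ i) • affRoot α θ i) (h0 : nodeRoot α θ i ≠ 0) :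
    Represents s (affRefl (nodeRoot α θ i) (nodeLevel i)) := by
  rcases i with _ | i
  · have hc : coroot θ = sharp θ := by rw [coroot_eq, hn]; norm_num
    constructor
    · intro l
      simp [hs, affRoot]
    · intro l b
      have hb : ‖affRefl θ 1 b‖ ^ 2 = ‖b‖ ^ 2 + 2 * (1 - θ b) := by
        rw [affRefl, norm_sub_sq_real, hc, inner_smul_right, real_inner_comm, inner_sharp,
          norm_smul, mul_pow, norm_sharp, hn, Real.norm_eq_abs, sq_abs]
        ring
      have hr : l.2.1 (affRefl θ 1 b) = l.2.1 b + (1 - θ b) * l.2.1 (coroot θ) := by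
        rw [affRefl, map_sub, map_smul, smul_eq_mul]
        ring
      simp only [nodeRoot, nodeLevel, Int.cast_one]
      rw [hb, hr, hs, pairing_sub_smul]
      simp only [pairing, affCoroot, affRoot, map_neg, neg_apply]
      ring
  · constructor
    · intro l
      simp [hs, affRoot]
    · intro l b
      have hb : ‖affRefl (α i) 0 b‖ ^ 2 = ‖b‖ ^ 2 := by
        have h0' : α i ≠ 0 := h0
        have h1 : affRefl (α i) 0 b = linRefl (α i) h0' b := by
          rw [linRefl_apply, affRefl, sub_zero]
        rw [h1, LinearIsometryEquiv.norm_map]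
      have hr : l.2.1 (affRefl (α i) 0 b) = l.2.1 b - α i b * l.2.1 (coroot (α i)) := by
        rw [affRefl, map_sub, map_smul, smul_eq_mul]
        ring
      simp only [nodeRoot, nodeLevel, Int.cast_zero]
      rw [hb, hr, hs, pairing_sub_smul]
      simp only [pairing, affCoroot, affRoot]
      ring

lemma pairing_affRoot_affCoroot (i : Option (Fin n)) (h0 : nodeRoot α θ i ≠ 0) :
    pairing (affRoot α θ i) (affCoroot α θ i) = 2 := by
  rcases i with _ | i
  · have := apply_coroot_self (β := θ) h0
    simp [pairing, affRoot, affCoroot, this]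
  · have := apply_coroot_self (β := α i) h0
    simp [pairing, affRoot, affCoroot, this]

lemma det_fundamental {s : AffDual n ≃ₗ[ℝ] AffDual n} {i : Option (Fin n)}
    (hs : ∀ l, s l = l - pairing l (affCoroot α θ i) • affRoot α θ i) (h0 : nodeRoot α θ i ≠ 0) :
    LinearMap.det (s : AffDual n →ₗ[ℝ] AffDual n) = -1 := by
  have : (s : AffDual n →ₗ[ℝ] AffDual n) =
      LinearMap.transvection (-pairingForm (affCoroot α θ i)) (affRoot α θ i) := by
    refine LinearMap.ext fun l => ?_
    rw [LinearEquiv.coe_coe, hs, LinearMap.transvection.apply, LinearMap.neg_apply]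
    change _ = l + (-pairing l _) • _
    module
  rw [this, LinearMap.transvection.det, LinearMap.neg_apply]
  change 1 + -pairing _ _ = _
  rw [pairing_affRoot_affCoroot i h0]
  norm_num

lemma mul_self_fundamental {s : AffDual n ≃ₗ[ℝ] AffDual n} {i : Option (Fin n)}
    (hs : ∀ l, s l = l - pairing l (affCoroot α θ i) • affRoot α θ i) (h0 : nodeRoot α θ i ≠ 0) :
    s * s = 1 := by
  ext1 l
  have h1 : pairing (s l) (affCoroot α θ i) = -pairing l (affCoroot α θ i) := by
    rw [hs l, pairing_sub_smul, pairing_affRoot_affCoroot i h0]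
    ring
  rw [LinearEquiv.mul_apply, hs (s l), h1, hs l, LinearEquiv.coe_one, id]
  module

namespace IsAffineDatum

lemma nodeRoot_mem (h : IsAffineDatum Φ α θ ω) (i : Option (Fin n)) :
    nodeRoot α θ i ∈ posRoots Φ α := by
  rcases i with _ | i
  · exact h.highest_mem_posRoots
  · exact h.simple_mem_posRoots i

/-- Each fundamental reflection belongs to the affine Weyl group. -/
lemma exists_fundamental (h : IsAffineDatum Φ α θ ω) (i : Option (Fin n)) :
    ∃ s ∈ affineWeylGroup α θ, ∀ l, s l = l - pairing l (affCoroot α θ i) • affRoot α θ i := by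
  have h0 := h.ne_zero (h.nodeRoot_mem i).1
  have hp := pairing_affRoot_affCoroot i h0
  let f : AffDual n →ₗ[ℝ] AffDual n :=
    LinearMap.id - (pairingForm (affCoroot α θ i)).smulRight (affRoot α θ i)
  have hf : ∀ l, f l = l - pairing l (affCoroot α θ i) • affRoot α θ i := fun l => rfl
  have hinv : Function.Involutive f := fun l => by
    rw [hf l, map_sub, map_smul, hf, hf, hp]
    module
  exact ⟨LinearEquiv.ofInvolutive f hinv, Subgroup.subset_closure ⟨i, hf⟩, hf⟩

/-- Each element of the affine Weyl group acts on `E n` by an affine isometry preserving the root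
hyperplanes, and its determinant is the sign by which it changes `sinProd`. -/
lemma exists_represents (h : IsAffineDatum Φ α θ ω) {w : AffDual n ≃ₗ[ℝ] AffDual n}
    (hw : w ∈ affineWeylGroup α θ) : ∃ (g : E n ≃ₗᵢ[ℝ] E n) (m : E n),
      IsAffineSymm Φ g m ∧ Represents w (fun b => g b + m) ∧
      (LinearMap.det (w : AffDual n →ₗ[ℝ] AffDual n) = 1 ∨
        LinearMap.det (w : AffDual n →ₗ[ℝ] AffDual n) = -1) ∧
      ∀ b, sinProd (posRoots Φ α) (g b + m) =
        LinearMap.det (w : AffDual n →ₗ[ℝ] AffDual n) * sinProd (posRoots Φ α) b := by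
  have step : ∀ s ∈ {s : AffDual n ≃ₗ[ℝ] AffDual n | ∃ i, ∀ l, s l =
      l - pairing l (affCoroot α θ i) • affRoot α θ i}, ∀ w : AffDual n ≃ₗ[ℝ] AffDual n,
      (∃ (g : E n ≃ₗᵢ[ℝ] E n) (m : E n),
      IsAffineSymm Φ g m ∧ Represents w (fun b => g b + m) ∧
      (LinearMap.det (w : AffDual n →ₗ[ℝ] AffDual n) = 1 ∨
        LinearMap.det (w : AffDual n →ₗ[ℝ] AffDual n) = -1) ∧
      ∀ b, sinProd (posRoots Φ α) (g b + m) =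
        LinearMap.det (w : AffDual n →ₗ[ℝ] AffDual n) * sinProd (posRoots Φ α) b) →
      (∃ (g : E n ≃ₗᵢ[ℝ] E n) (m : E n),
      IsAffineSymm Φ g m ∧ Represents (s * w) (fun b => g b + m) ∧
      (LinearMap.det ((s * w : AffDual n ≃ₗ[ℝ] AffDual n) : AffDual n →ₗ[ℝ] AffDual n) = 1 ∨
        LinearMap.det ((s * w : AffDual n ≃ₗ[ℝ] AffDual n) : AffDual n →ₗ[ℝ] AffDual n) = -1) ∧
      ∀ b, sinProd (posRoots Φ α) (g b + m) =
        LinearMap.det ((s * w : AffDual n ≃ₗ[ℝ] AffDual n) : AffDual n →ₗ[ℝ] AffDual n)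
          * sinProd (posRoots Φ α) b) := by
    rintro s ⟨i, hs⟩ w ⟨g, m, hsymm, hrep, hdet, hsin⟩
    have hmem := (h.nodeRoot_mem i).1
    have h0 := h.ne_zero hmem
    have hd : LinearMap.det ((s * w : AffDual n ≃ₗ[ℝ] AffDual n) : AffDual n →ₗ[ℝ] AffDual n)
        = -LinearMap.det (w : AffDual n →ₗ[ℝ] AffDual n) := by
      have : ((s * w : AffDual n ≃ₗ[ℝ] AffDual n) : AffDual n →ₗ[ℝ] AffDual n)
          = (s : AffDual n →ₗ[ℝ] AffDual n) * (w : AffDual n →ₗ[ℝ] AffDual n) := rfl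
      rw [this, map_mul, det_fundamental hs h0]
      ring
    have hrs := represents_fundamental h.norm_sq hs h0
    have he : ∀ b, g (affRefl (nodeRoot α θ i) (nodeLevel i) b) + m =
        ((linRefl _ h0).trans g) b + (g (((nodeLevel i : ℤ) : ℝ) • coroot (nodeRoot α θ i)) + m) := by
      intro b
      rw [LinearIsometryEquiv.trans_apply, ← add_assoc, ← map_add]
      congr 2
      rw [affRefl, linRefl_apply]
      module
    refine ⟨_, _, (h.rootSet.isAffineSymm_linRefl hmem (nodeLevel i)).comp hsymm,
      (hrs.mul hrep).congr he, ?_, fun b => ?_⟩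
    · rw [hd]
      rcases hdet with hdet | hdet <;> simp [hdet]
    · rw [← he, hsin, hd]
      have : sinProd (posRoots Φ α) (affRefl (nodeRoot α θ i) (nodeLevel i) b)
          = -sinProd (posRoots Φ α) b := by
        rcases i with _ | i
        · simpa [nodeRoot, nodeLevel] using h.sinProd_affRefl_highest b
        · simpa [nodeRoot, nodeLevel] using h.sinProd_affRefl_simple i b
      rw [this]
      ring
  induction hw using Subgroup.closure_induction_left with
  | one =>
    refine ⟨LinearIsometryEquiv.refl ℝ _, 0, ⟨fun β hβ => ⟨β, hβ, fun x => rfl⟩,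
      fun β hβ => ⟨0, by simp⟩⟩, represents_one.congr fun b => by simp, ?_, ?_⟩
    · left
      exact LinearMap.det_id
    · intro b
      have : LinearMap.det ((1 : AffDual n ≃ₗ[ℝ] AffDual n) : AffDual n →ₗ[ℝ] AffDual n) = 1 :=
        LinearMap.det_id
      rw [this]
      simp
  | mul_left s hs w hw ih => exact step s hs w ih
  | inv_mul_cancel s hs w hw ih =>
    have : s⁻¹ = s := by
      obtain ⟨i, hi⟩ := hs
      exact inv_eq_of_mul_eq_one_left (mul_self_fundamental hi (h.ne_zero (h.nodeRoot_mem i).1))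
    rw [this]
    exact step s hs w ih

end IsAffineDatum

end

/-! ### Reflections in the affine Weyl group and vanishing of the theta series -/

section

variable {Φ : Set (EDual n)} {α : Fin n → EDual n} {θ : EDual n} {ω : Fin n → E n}

/-- The affine Weyl group contains the reflection in the hyperplane `β = k`. -/
def HasReflection (α : Fin n → EDual n) (θ : EDual n) (β : EDual n) (k : ℝ) : Prop :=
  ∃ s ∈ affineWeylGroup α θ, Represents s (affRefl β k) ∧
    LinearMap.det (s : AffDual n →ₗ[ℝ] AffDual n) = -1

lemma HasReflection.neg {β : EDual n} {k : ℝ} (h : HasReflection α θ β k) :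
    HasReflection α θ (-β) (-k) := by
  obtain ⟨s, hs, hr, hd⟩ := h
  exact ⟨s, hs, hr.congr fun b => (affRefl_neg β k b).symm, hd⟩

lemma HasReflection.conj {β β' : EDual n} {k k' : ℝ} (h : HasReflection α θ β k)
    (h' : HasReflection α θ β' k') (hβ' : β' ≠ 0) :
    HasReflection α θ (dualRefl β' β) (k - k' * β (coroot β')) := by
  obtain ⟨s, hs, hr, hd⟩ := h
  obtain ⟨s', hs', hr', hd'⟩ := h'
  refine ⟨s' * (s * s'), mul_mem hs' (mul_mem hs hs'),
    (hr'.mul (hr.mul hr')).congr fun b => affRefl_conj hβ' k k' b, ?_⟩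
  have : ((s' * (s * s') : AffDual n ≃ₗ[ℝ] AffDual n) : AffDual n →ₗ[ℝ] AffDual n) =
      (s' : AffDual n →ₗ[ℝ] AffDual n) * ((s : AffDual n →ₗ[ℝ] AffDual n) * s') := rfl
  rw [this, map_mul, map_mul, hd, hd']
  norm_num

namespace IsAffineDatum

lemma hasReflection_node (h : IsAffineDatum Φ α θ ω) (i : Option (Fin n)) :
    HasReflection α θ (nodeRoot α θ i) (nodeLevel i) := by
  obtain ⟨s, hs, hl⟩ := h.exists_fundamental i
  have h0 := h.ne_zero (h.nodeRoot_mem i).1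
  exact ⟨s, hs, represents_fundamental h.norm_sq hl h0, det_fundamental hl h0⟩

lemma hasReflection_simple (h : IsAffineDatum Φ α θ ω) (i : Fin n) :
    HasReflection α θ (α i) 0 := by
  simpa [nodeRoot, nodeLevel] using h.hasReflection_node (some i)

lemma hasReflection_highest (h : IsAffineDatum Φ α θ ω) : HasReflection α θ θ 1 := by
  simpa [nodeRoot, nodeLevel] using h.hasReflection_node none

/-- Reflecting a positive root in a simple root changes one coordinate. -/
lemma sum_coord_dualRefl (h : IsAffineDatum Φ α θ ω) (β : EDual n) (i : Fin n) :
    ∑ k, dualRefl (α i) β (ω k) = ∑ k, β (ω k) - β (coroot (α i)) := by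
  simp [dualRefl_apply, h.coweight, Finset.sum_sub_distrib]

lemma norm_sq_eq_sum (h : IsAffineDatum Φ α θ ω) {β : EDual n} (hβ : β ∈ Φ) :
    ‖β‖ ^ 2 = ∑ i, β (ω i) * β (sharp (α i)) := by
  rw [← apply_sharp_self]
  conv_lhs => rw [h.eq_sum hβ]
  simp only [sum_apply, smul_apply, smul_eq_mul]
  refine Finset.sum_congr rfl fun i _ => ?_
  rw [← h.eq_sum hβ, apply_sharp_comm]

lemma hasReflection_posRoot_zero_aux (h : IsAffineDatum Φ α θ ω) (N : ℕ) :
    ∀ β ∈ posRoots Φ α, ∑ k, β (ω k) ≤ N → HasReflection α θ β 0 := by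
  induction N with
  | zero =>
    intro β hβ hN
    obtain ⟨i, hi⟩ := h.exists_coord_pos hβ
    have : 0 < ∑ k, β (ω k) :=
      Finset.sum_pos' (fun k _ => h.coord_nonneg hβ k) ⟨i, Finset.mem_univ i, hi⟩
    simp only [Nat.cast_zero] at hN
    linarith
  | succ N ih =>
    intro β hβ hN
    -- since `(β | β) > 0`, some simple root has positive product with `β`
    have hpos : 0 < ∑ i, β (ω i) * β (sharp (α i)) := by
      rw [← h.norm_sq_eq_sum hβ.1]
      have := norm_pos_iff.2 (h.ne_zero hβ.1)
      positivity
    obtain ⟨i, -, hi⟩ := Finset.exists_lt_of_sum_lt (s := Finset.univ) (f := fun _ => (0 : ℝ))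
      (g := fun i => β (ω i) * β (sharp (α i))) (by simpa using hpos)
    have h0 := h.ne_zero (h.simple.mem i)
    have hi' : 0 < β (sharp (α i)) := (pos_iff_pos_of_mul_pos hi).1
      ((h.coord_nonneg hβ i).lt_of_ne fun he => by simp [← he] at hi)
    obtain ⟨k, hk⟩ := h.rootSet.integral _ (h.simple.mem i) β hβ.1
    have hk1 : (1 : ℝ) ≤ k := by
      have : 0 < β (coroot (α i)) := (apply_coroot_pos_iff h0).2 hi'
      rw [hk] at this
      exact_mod_cast this
    by_cases hne : β = α i
    · rw [hne]
      exact h.hasReflection_simple i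
    · have := (ih _ (h.dualRefl_simple_mem hβ hne) (by
        rw [h.sum_coord_dualRefl, hk]
        push_cast at hN
        linarith)).conj (h.hasReflection_simple i) h0
      rwa [dualRefl_dualRefl h0, zero_mul, sub_zero] at this

lemma hasReflection_posRoot_zero (h : IsAffineDatum Φ α θ ω) {β : EDual n}
    (hβ : β ∈ posRoots Φ α) : HasReflection α θ β 0 := by
  obtain ⟨N, hN⟩ := exists_nat_ge (∑ k, β (ω k))
  exact h.hasReflection_posRoot_zero_aux N β hβ hN

lemma hasReflection_posRoot_one_aux (h : IsAffineDatum Φ α θ ω) (N : ℕ) :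
    ∀ β ∈ posRoots Φ α, ∑ k, (θ - β) (ω k) < N → HasReflection α θ β 1 := by
  induction N with
  | zero =>
    intro β hβ hN
    have : 0 ≤ ∑ k, (θ - β) (ω k) := Finset.sum_nonneg fun k _ => by
      rw [sub_apply]
      linarith [h.coord_le_highest hβ.1 k]
    simp only [Nat.cast_zero] at hN
    linarith
  | succ N ih =>
    intro β hβ hN
    by_cases hne : β = θ
    · rw [hne]
      exact h.hasReflection_highest
    rcases h.apply_coroot_highest hβ hne with hk | ⟨hk, hm⟩
    · -- `β` is orthogonal to `θ`, so `(β | θ - β) < 0`, and some simple root raises `β`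
      have hθ : β (sharp θ) = 0 := by
        rw [apply_coroot, h.norm_sq] at hk
        linarith
      have hneg : ∑ i, (θ (ω i) - β (ω i)) * β (sharp (α i)) < 0 := by
        have h1 : β (sharp θ) = ∑ i, θ (ω i) * β (sharp (α i)) := by
          conv_lhs => rw [apply_sharp_comm, h.eq_sum h.highest.mem]
          simp only [sum_apply, smul_apply, smul_eq_mul]
          refine Finset.sum_congr rfl fun i _ => ?_
          rw [apply_sharp_comm]
        have h2 := h.norm_sq_eq_sum hβ.1
        have h3 := norm_pos_iff.2 (h.ne_zero hβ.1)
        have h4 : 0 < ‖β‖ ^ 2 := by positivity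
        simp only [sub_mul, Finset.sum_sub_distrib]
        linarith
      obtain ⟨i, -, hi⟩ := Finset.exists_lt_of_sum_lt (s := Finset.univ) (g := fun _ => (0 : ℝ))
        (f := fun i => (θ (ω i) - β (ω i)) * β (sharp (α i))) (by simpa using hneg)
      have h0 := h.ne_zero (h.simple.mem i)
      have hi' : β (sharp (α i)) < 0 := by
        by_contra! hc
        have := mul_nonneg (sub_nonneg.2 (h.coord_le_highest hβ.1 i)) hc
        linarith
      obtain ⟨k, hk⟩ := h.rootSet.integral _ (h.simple.mem i) β hβ.1
      have hk1 : (k : ℝ) ≤ -1 := by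
        have : β (coroot (α i)) < 0 := (apply_coroot_neg_iff h0).2 hi'
        rw [hk] at this
        have : k < 0 := by exact_mod_cast this
        exact_mod_cast (by omega : k ≤ -1)
      have hpos : dualRefl (α i) β ∈ posRoots Φ α := by
        refine h.dualRefl_simple_mem hβ fun he => ?_
        rw [he, apply_sharp_self] at hi'
        linarith [sq_nonneg ‖α i‖]
      have := (ih _ hpos (by
        simp only [sub_apply, Finset.sum_sub_distrib] at hN ⊢
        rw [h.sum_coord_dualRefl, hk]
        push_cast at hN
        linarith)).conj (h.hasReflection_simple i) h0
      rwa [dualRefl_dualRefl h0, zero_mul, sub_zero] at this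
    · have h0 := h.ne_zero h.highest.mem
      have h1 : (θ - β) (coroot θ) = 1 := by
        rw [sub_apply, apply_coroot_self h0, hk]
        norm_num
      have := ((h.hasReflection_posRoot_zero hm).conj h.hasReflection_highest h0).neg
      convert! this using 1
      · rw [dualRefl, h1]
        module
      · rw [h1]
        norm_num

lemma hasReflection_posRoot_one (h : IsAffineDatum Φ α θ ω) {β : EDual n}
    (hβ : β ∈ posRoots Φ α) : HasReflection α θ β 1 := by
  obtain ⟨N, hN⟩ := exists_nat_gt (∑ k, (θ - β) (ω k))
  exact h.hasReflection_posRoot_one_aux N β hβ hN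

end IsAffineDatum

/-- The numerator of `psiHat`. -/
def thetaSum (α : Fin n → EDual n) (θ : EDual n) (b : E n) (t : ℝ) (x : E n) : ℝ :=
  ∑' w : affineWeylGroup α θ, thetaTerm b t x w

lemma psiHat_eq (Φp : Set (EDual n)) (b : E n) (t : ℝ) (x : E n) :
    psiHat Φp α θ b t x = (sinProd Φp b)⁻¹ * thetaSum α θ b t x := rfl

/-- The theta series vanishes when `b` lies on a reflection hyperplane. -/
lemma thetaSum_eq_zero_of_reflection {β : EDual n} {k : ℝ} (h : HasReflection α θ β k) {b : E n}
    (hb : β b = k) (t : ℝ) (x : E n) : thetaSum α θ b t x = 0 := by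
  obtain ⟨s, hs, hr, hd⟩ := h
  have hneg : ∀ w : affineWeylGroup α θ, thetaTerm b t x ((⟨s, hs⟩ * w : affineWeylGroup α θ)) =
      -thetaTerm b t x w := by
    intro w
    have h1 : (((⟨s, hs⟩ * w : affineWeylGroup α θ) : AffDual n ≃ₗ[ℝ] AffDual n) :
        AffDual n →ₗ[ℝ] AffDual n) = (s : AffDual n →ₗ[ℝ] AffDual n) *
          ((w : AffDual n ≃ₗ[ℝ] AffDual n) : AffDual n →ₗ[ℝ] AffDual n) := rfl
    have h2 : ((⟨s, hs⟩ * w : affineWeylGroup α θ) : AffDual n ≃ₗ[ℝ] AffDual n) (t, flat x, 0) =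
      s ((w : AffDual n ≃ₗ[ℝ] AffDual n) (t, flat x, 0)) := rfl
    rw [thetaTerm, thetaTerm, h1, map_mul, hd, h2, hr.pair, affRefl_of_apply_eq hb]
    simp [pairing]
  have h3 := (Equiv.mulLeft (⟨s, hs⟩ : affineWeylGroup α θ)).tsum_eq
    (fun w : affineWeylGroup α θ => thetaTerm b t x w)
  simp only [Equiv.coe_mulLeft, hneg, tsum_neg] at h3
  rw [thetaSum]
  linarith

/-- The theta series vanishes when `τ Λ₀ + φ_x` is fixed by a fundamental reflection. -/
lemma IsAffineDatum.thetaSum_eq_zero_of_node (h : IsAffineDatum Φ α θ ω) {i : Option (Fin n)}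
    {t : ℝ} {x : E n} (hx : nodeRoot α θ i x = t * nodeLevel i) (b : E n) :
    thetaSum α θ b t x = 0 := by
  obtain ⟨s, hs, hl⟩ := h.exists_fundamental i
  have h0 := h.ne_zero (h.nodeRoot_mem i).1
  have hd := det_fundamental hl h0
  have hfix : s (t, flat x, 0) = (t, flat x, 0) := by
    have : pairing (t, flat x, 0) (affCoroot α θ i) = 0 := by
      have hf : ∀ β : EDual n, flat x (coroot β) = 2 / ‖β‖ ^ 2 * β x := fun β => by
        rw [flat, InnerProductSpace.toDual_apply_apply, coroot_eq, inner_smul_right,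
          real_inner_comm, inner_sharp]
      rcases i with _ | i
      · simp only [nodeRoot, nodeLevel, Int.cast_one, mul_one] at hx
        simp only [pairing, affCoroot, map_neg, hf, hx, h.norm_sq]
        ring
      · simp only [nodeRoot, nodeLevel, Int.cast_zero, mul_zero] at hx
        simp only [pairing, affCoroot, hf, hx]
        ring
    rw [hl, this, zero_smul, sub_zero]
  have hneg : ∀ w : affineWeylGroup α θ, thetaTerm b t x ((w * ⟨s, hs⟩ : affineWeylGroup α θ)) =
      -thetaTerm b t x w := by
    intro w
    have h1 : (((w * ⟨s, hs⟩ : affineWeylGroup α θ) : AffDual n ≃ₗ[ℝ] AffDual n) :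
        AffDual n →ₗ[ℝ] AffDual n) = ((w : AffDual n ≃ₗ[ℝ] AffDual n) : AffDual n →ₗ[ℝ] AffDual n) *
          (s : AffDual n →ₗ[ℝ] AffDual n) := rfl
    have h2 : ((w * ⟨s, hs⟩ : affineWeylGroup α θ) : AffDual n ≃ₗ[ℝ] AffDual n) (t, flat x, 0) =
      (w : AffDual n ≃ₗ[ℝ] AffDual n) (s (t, flat x, 0)) := rfl
    rw [thetaTerm, thetaTerm, h1, map_mul, hd, h2, hfix]
    ring
  have h3 := (Equiv.mulRight (⟨s, hs⟩ : affineWeylGroup α θ)).tsum_eq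
    (fun w : affineWeylGroup α θ => thetaTerm b t x w)
  simp only [Equiv.coe_mulRight, hneg, tsum_neg] at h3
  rw [thetaSum]
  linarith

end

/-! ### Gaussian summability over the affine Weyl group -/

lemma summable_pi_prod {f : ℤ → ℝ} (hf : Summable f) (h0 : ∀ k, 0 ≤ f k) (n : ℕ) :
    Summable fun k : Fin n → ℤ => ∏ i, f (k i) := by
  induction n with
  | zero => exact Summable.of_finite
  | succ n ih =>
    rw [← (Fin.consEquiv fun _ => ℤ).summable_iff]
    have := hf.mul_of_nonneg ih h0 fun k => Finset.prod_nonneg fun i _ => h0 _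
    refine this.congr fun p => ?_
    simp [Fin.consEquiv, Fin.prod_univ_succ]

lemma summable_finite_prod {ι κ : Type*} [Finite ι] {f : κ → ℝ} (hf : Summable f) :
    Summable fun p : ι × κ => f p.2 := by
  rw [← (Equiv.prodComm κ ι).summable_iff]
  have h1 : Summable fun _ : ι => (1 : ℝ) := Summable.of_finite
  have := (hf.norm.mul_of_nonneg h1 (fun _ => norm_nonneg _) fun _ => zero_le_one)
  refine Summable.of_norm (this.congr fun p => ?_)
  simp

lemma summable_exp_neg_int_sq {ε : ℝ} (hε : 0 < ε) :
    Summable fun k : ℤ => Real.exp (-ε * (k : ℝ) ^ 2) := by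
  have h : Summable fun k : ℕ => Real.exp (-ε * (k : ℝ) ^ 2) := by
    refine Summable.of_nonneg_of_le (fun _ => (Real.exp_pos _).le) (fun k => ?_)
      (Real.summable_exp_nat_mul_iff.2 (neg_lt_zero.2 hε))
    have hk : (k : ℝ) ≤ (k : ℝ) ^ 2 := by exact_mod_cast Nat.le_self_pow two_ne_zero k
    exact Real.exp_le_exp.2 (by nlinarith)
  refine Summable.of_nat_of_neg (by simpa using h) (by simpa using h)

/-- A Gaussian in `‖m‖` is bounded by a product of Gaussians in the coordinates `α i m`. -/
lemma exists_exp_le_prod (α : Fin n → EDual n) (K : ℝ) {ε : ℝ} (hε : 0 < ε) :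
    ∃ C δ : ℝ, 0 < δ ∧ ∀ m : E n, Real.exp (K * ‖m‖ - ε * ‖m‖ ^ 2) ≤
      C * ∏ i, Real.exp (-δ * (α i m) ^ 2) := by
  obtain ⟨A, hA⟩ : ∃ A : ℝ, A = ∑ i, ‖α i‖ ^ 2 + 1 := ⟨_, rfl⟩
  have hA0 : 0 < A := by rw [hA]; positivity
  refine ⟨Real.exp (K ^ 2 / (2 * ε)), ε / 2 / A, by positivity, fun m => ?_⟩
  rw [← Real.exp_sum, ← Real.exp_add, Real.exp_le_exp, ← Finset.mul_sum]
  have h1 : ∑ i, (α i m) ^ 2 ≤ A * ‖m‖ ^ 2 := by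
    have : ∀ i, (α i m) ^ 2 ≤ ‖α i‖ ^ 2 * ‖m‖ ^ 2 := fun i => by
      rw [← mul_pow, sq_le_sq, abs_of_nonneg (by positivity : 0 ≤ ‖α i‖ * ‖m‖)]
      exact (α i).le_opNorm _
    calc ∑ i, (α i m) ^ 2 ≤ ∑ i, ‖α i‖ ^ 2 * ‖m‖ ^ 2 := Finset.sum_le_sum fun i _ => this i
      _ = (∑ i, ‖α i‖ ^ 2) * ‖m‖ ^ 2 := by rw [Finset.sum_mul]
      _ ≤ A * ‖m‖ ^ 2 := by rw [hA]; nlinarith [sq_nonneg ‖m‖]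
  have h2 : ε / 2 / A * ∑ i, (α i m) ^ 2 ≤ ε / 2 * ‖m‖ ^ 2 := by
    calc ε / 2 / A * ∑ i, (α i m) ^ 2 ≤ ε / 2 / A * (A * ‖m‖ ^ 2) :=
          mul_le_mul_of_nonneg_left h1 (by positivity)
      _ = ε / 2 * ‖m‖ ^ 2 := by field_simp
  have h3 : K * ‖m‖ ≤ K ^ 2 / (2 * ε) + ε / 2 * ‖m‖ ^ 2 := by
    have : K ^ 2 / (2 * ε) + ε / 2 * ‖m‖ ^ 2 - K * ‖m‖ = (K - ε * ‖m‖) ^ 2 / (2 * ε) := by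
      field_simp
      ring
    have h4 : 0 ≤ (K - ε * ‖m‖) ^ 2 / (2 * ε) := by positivity
    linarith
  linarith

section

variable {Φ : Set (EDual n)} {α : Fin n → EDual n} {θ : EDual n} {ω : Fin n → E n}

namespace IsAffineDatum

/-- The linear part of the action of `w` on `E n`. -/
def linPart (h : IsAffineDatum Φ α θ ω) (w : affineWeylGroup α θ) : E n ≃ₗᵢ[ℝ] E n :=
  (h.exists_represents w.2).choose

/-- The translation part of the action of `w` on `E n`. -/
def transPart (h : IsAffineDatum Φ α θ ω) (w : affineWeylGroup α θ) : E n :=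
  (h.exists_represents w.2).choose_spec.choose

/-- The affine isometry of `E n` contragredient to `w`. -/
def act (h : IsAffineDatum Φ α θ ω) (w : affineWeylGroup α θ) (b : E n) : E n :=
  h.linPart w b + h.transPart w

lemma isAffineSymm (h : IsAffineDatum Φ α θ ω) (w : affineWeylGroup α θ) :
    IsAffineSymm Φ (h.linPart w) (h.transPart w) :=
  (h.exists_represents w.2).choose_spec.choose_spec.1

lemma represents_act (h : IsAffineDatum Φ α θ ω) (w : affineWeylGroup α θ) :
    Represents (w : AffDual n ≃ₗ[ℝ] AffDual n) (h.act w) :=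
  (h.exists_represents w.2).choose_spec.choose_spec.2.1

/-- The determinant of an element of the affine Weyl group. -/
def _root_.AffineTheta.sgn (w : affineWeylGroup α θ) : ℝ :=
  LinearMap.det ((w : AffDual n ≃ₗ[ℝ] AffDual n) : AffDual n →ₗ[ℝ] AffDual n)

lemma sgn_eq (h : IsAffineDatum Φ α θ ω) (w : affineWeylGroup α θ) : sgn w = 1 ∨ sgn w = -1 :=
  (h.exists_represents w.2).choose_spec.choose_spec.2.2.1

lemma abs_sgn (h : IsAffineDatum Φ α θ ω) (w : affineWeylGroup α θ) : |sgn w| = 1 := by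
  rcases h.sgn_eq w with e | e <;> simp [e]

lemma sinProd_act (h : IsAffineDatum Φ α θ ω) (w : affineWeylGroup α θ) (b : E n) :
    sinProd (posRoots Φ α) (h.act w b) = sgn w * sinProd (posRoots Φ α) b :=
  (h.exists_represents w.2).choose_spec.choose_spec.2.2.2 b

lemma thetaTerm_eq (h : IsAffineDatum Φ α θ ω) (b : E n) (t : ℝ) (x : E n)
    (w : affineWeylGroup α θ) : thetaTerm b t x w =
      sgn w * Real.exp (inner ℝ x (h.act w b) + t * ((‖b‖ ^ 2 - ‖h.act w b‖ ^ 2) / 2)) := by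
  rw [thetaTerm, (h.represents_act w).pair]
  simp only [flat, InnerProductSpace.toDual_apply_apply, add_zero, sgn]
  rw [add_comm (t * _)]

lemma ext_simple (h : IsAffineDatum Φ α θ ω) {x y : E n} (hxy : ∀ i, α i x = α i y) : x = y := by
  rw [← sub_eq_zero]
  exact h.simple.eq_zero_of_apply fun i => by rw [map_sub, hxy, sub_self]

lemma summable_exp_transPart (h : IsAffineDatum Φ α θ ω) (K : ℝ) {ε : ℝ} (hε : 0 < ε) :
    Summable fun w : affineWeylGroup α θ =>
      Real.exp (K * ‖h.transPart w‖ - ε * ‖h.transPart w‖ ^ 2) := by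
  have : Finite Φ := h.rootSet.finite
  choose ρ hρ hρ' using fun (w : affineWeylGroup α θ) (i : Fin n) =>
    (h.isAffineSymm w).root (α i) (h.simple.mem i)
  choose k hk using fun (w : affineWeylGroup α θ) (i : Fin n) =>
    (h.isAffineSymm w).int (α i) (h.simple.mem i)
  -- `w` is determined by the images of the simple roots and the coordinates of the translation
  have hf : Function.Injective fun w =>
      ((fun i => (⟨ρ w i, hρ w i⟩ : Φ), k w) : (Fin n → Φ) × (Fin n → ℤ)) := by
    intro w w' e
    have e1 : ∀ i, ρ w i = ρ w' i := fun i =>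
      congrArg Subtype.val (congrFun (congrArg Prod.fst e) i)
    have e2 : ∀ i, k w i = k w' i := fun i => congrFun (congrArg Prod.snd e) i
    have hact : h.act w = h.act w' := by
      funext b
      refine h.ext_simple fun i => ?_
      rw [act, act, map_add, map_add, hk, hk, e2, ← hρ', ← hρ', e1]
    have hr := h.represents_act w'
    rw [← hact] at hr
    exact Subtype.ext ((h.represents_act w).injective hr)
  obtain ⟨C, δ, hδ, hC⟩ := exists_exp_le_prod α K hε
  have hsum := summable_finite_prod (ι := Fin n → Φ)
    (summable_pi_prod (summable_exp_neg_int_sq hδ) (fun _ => (Real.exp_pos _).le) n)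
  have hsum' : Summable fun w : affineWeylGroup α θ =>
      C * ∏ i, Real.exp (-δ * (k w i : ℝ) ^ 2) := (hsum.comp_injective hf).mul_left C
  refine Summable.of_nonneg_of_le (fun _ => (Real.exp_pos _).le) (fun w => ?_) hsum'
  have hw := hC (h.transPart w)
  simp only [hk] at hw
  exact hw

lemma countable (h : IsAffineDatum Φ α θ ω) : Countable (affineWeylGroup α θ) := by
  have := h.summable_exp_transPart 0 one_pos
  have hc := this.countable_support
  rw [Function.support_eq_univ (fun w => (Real.exp_pos _).ne')] at hc
  exact Set.countable_univ_iff.1 hc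

lemma norm_act_le (h : IsAffineDatum Φ α θ ω) (w : affineWeylGroup α θ) (b : E n) :
    ‖h.act w b‖ ≤ ‖h.transPart w‖ + ‖b‖ := by
  rw [act, add_comm]
  refine (norm_add_le _ _).trans ?_
  rw [LinearIsometryEquiv.norm_map]

lemma norm_transPart_le (h : IsAffineDatum Φ α θ ω) (w : affineWeylGroup α θ) (b : E n) :
    ‖h.transPart w‖ ≤ ‖h.act w b‖ + ‖b‖ := by
  have : h.transPart w = h.act w b - h.linPart w b := by simp [act]
  rw [this]
  refine (norm_sub_le _ _).trans ?_
  rw [LinearIsometryEquiv.norm_map]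

/-- The basic convergence statement: the orbit of `b` is sparse enough for Gaussian sums. -/
lemma summable_exp_act (h : IsAffineDatum Φ α θ ω) (b : E n) (K : ℝ) {ε : ℝ} (hε : 0 < ε) :
    Summable fun w : affineWeylGroup α θ =>
      Real.exp (K * ‖h.act w b‖ - ε * ‖h.act w b‖ ^ 2) := by
  refine Summable.of_nonneg_of_le (fun _ => (Real.exp_pos _).le) (fun w => ?_)
    ((h.summable_exp_transPart |K| (half_pos hε)).mul_left
      (Real.exp (|K| * ‖b‖ + ε * ‖b‖ ^ 2)))
  rw [← Real.exp_add, Real.exp_le_exp]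
  have h1 := h.norm_act_le w b
  have h2 := h.norm_transPart_le w b
  have h3 : K * ‖h.act w b‖ ≤ |K| * (‖h.transPart w‖ + ‖b‖) :=
    (mul_le_mul_of_nonneg_right (le_abs_self K) (norm_nonneg _)).trans
      (mul_le_mul_of_nonneg_left h1 (abs_nonneg K))
  have h4 : ‖h.transPart w‖ ^ 2 ≤ 2 * ‖h.act w b‖ ^ 2 + 2 * ‖b‖ ^ 2 := by
    have : ‖h.transPart w‖ ^ 2 ≤ (‖h.act w b‖ + ‖b‖) ^ 2 := by gcongr
    nlinarith [sq_nonneg (‖h.act w b‖ - ‖b‖)]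
  nlinarith

lemma summable_thetaTerm (h : IsAffineDatum Φ α θ ω) (b : E n) {t : ℝ} (ht : 0 < t) (x : E n) :
    Summable fun w : affineWeylGroup α θ => thetaTerm b t x w := by
  refine Summable.of_norm_bounded
    ((h.summable_exp_act b ‖x‖ (half_pos ht)).mul_left (Real.exp (t * ‖b‖ ^ 2 / 2))) fun w => ?_
  rw [h.thetaTerm_eq, norm_mul, Real.norm_eq_abs, h.abs_sgn, one_mul, Real.norm_eq_abs,
    Real.abs_exp, ← Real.exp_add, Real.exp_le_exp]
  have := real_inner_le_norm x (h.act w b)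
  linarith

end IsAffineDatum

end

/-! ### The fundamental alcove -/

section

variable {Φ : Set (EDual n)} {α : Fin n → EDual n} {θ : EDual n} {ω : Fin n → E n}

/-- The interior of the fundamental alcove. -/
def openAlcove (Φp : Set (EDual n)) : Set (E n) := {x | ∀ β ∈ Φp, 0 < β x ∧ β x < 1}

lemma isClosed_chamber (Φp : Set (EDual n)) : IsClosed (chamber Φp) := by
  have : chamber Φp = {p : ℝ × E n | 0 ≤ p.1} ∩
      ⋂ β ∈ Φp, {p : ℝ × E n | 0 ≤ β p.2} ∩ {p : ℝ × E n | β p.2 ≤ p.1} := by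
    ext p
    simp [chamber, alcove]
  rw [this]
  refine (isClosed_le continuous_const continuous_fst).inter
    (isClosed_biInter fun β _ => (isClosed_le continuous_const ?_).inter
      (isClosed_le ?_ continuous_fst)) <;> fun_prop

namespace IsAffineDatum

lemma apply_eq_sum (h : IsAffineDatum Φ α θ ω) {β : EDual n} (hβ : β ∈ Φ) (x : E n) :
    β x = ∑ i, β (ω i) * α i x := by
  have := congrArg (fun f : EDual n => f x) (h.eq_sum hβ)
  simpa using this

lemma apply_nonneg (h : IsAffineDatum Φ α θ ω) {β : EDual n} (hβ : β ∈ posRoots Φ α) {x : E n}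
    (hx : ∀ i, 0 ≤ α i x) : 0 ≤ β x := by
  rw [h.apply_eq_sum hβ.1]
  exact Finset.sum_nonneg fun i _ => mul_nonneg (h.coord_nonneg hβ i) (hx i)

lemma apply_pos (h : IsAffineDatum Φ α θ ω) {β : EDual n} (hβ : β ∈ posRoots Φ α) {x : E n}
    (hx : ∀ i, 0 < α i x) : 0 < β x := by
  rw [h.apply_eq_sum hβ.1]
  obtain ⟨i, hi⟩ := h.exists_coord_pos hβ
  exact Finset.sum_pos' (fun k _ => mul_nonneg (h.coord_nonneg hβ k) (hx k).le)
    ⟨i, Finset.mem_univ i, mul_pos hi (hx i)⟩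

lemma apply_le_highest (h : IsAffineDatum Φ α θ ω) {β : EDual n} (hβ : β ∈ posRoots Φ α)
    {x : E n} (hx : ∀ i, 0 ≤ α i x) : β x ≤ θ x := by
  rw [h.apply_eq_sum hβ.1, h.apply_eq_sum h.highest.mem]
  exact Finset.sum_le_sum fun i _ => mul_le_mul_of_nonneg_right (h.coord_le_highest hβ.1 i) (hx i)

/-- A point of the chamber at positive level which lies on no wall is interior. -/
lemma eventually_mem_chamber (h : IsAffineDatum Φ α θ ω) {p : ℝ × E n}
    (hp : p ∈ chamber (posRoots Φ α)) (ht : 0 < p.1)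
    (hw : ∀ i, nodeRoot α θ i p.2 ≠ p.1 * nodeLevel i) :
    ∀ᶠ q in 𝓝 p, q ∈ chamber (posRoots Φ α) := by
  have h1 : ∀ i, ∀ᶠ q : ℝ × E n in 𝓝 p, 0 < α i q.2 := fun i => by
    have h2 : 0 < α i p.2 := by
      refine (hp.2 _ (h.simple_mem_posRoots i)).1.lt_of_ne fun he => hw (some i) ?_
      simp [nodeRoot, nodeLevel, ← he]
    exact (((α i).continuous.comp continuous_snd).tendsto p).eventually (lt_mem_nhds h2)
  have h3 : ∀ᶠ q : ℝ × E n in 𝓝 p, 0 < q.1 - θ q.2 := by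
    have h2 : 0 < p.1 - θ p.2 := by
      refine sub_pos.2 ((hp.2 _ h.highest_mem_posRoots).2.lt_of_ne fun he => hw none ?_)
      simp [nodeRoot, nodeLevel, he]
    exact ((continuous_fst.sub (θ.continuous.comp continuous_snd)).tendsto p).eventually
      (lt_mem_nhds h2)
  filter_upwards [eventually_all.2 h1, h3, (continuous_fst.tendsto p).eventually (lt_mem_nhds ht)]
    with q hq1 hq2 hq3
  exact ⟨hq3.le, fun β hβ => ⟨h.apply_nonneg hβ fun i => (hq1 i).le,
    (h.apply_le_highest hβ fun i => (hq1 i).le).trans (by linarith)⟩⟩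

lemma exists_node_of_mem_frontier (h : IsAffineDatum Φ α θ ω) {p : ℝ × E n}
    (hp : p ∈ frontier (chamber (posRoots Φ α))) (ht : 0 < p.1) :
    ∃ i, nodeRoot α θ i p.2 = p.1 * nodeLevel i := by
  by_contra! hc
  rw [(isClosed_chamber _).frontier_eq] at hp
  exact hp.2 (mem_interior_iff_mem_nhds.2 (h.eventually_mem_chamber hp.1 ht hc))

lemma norm_le_of_mem_alcove (h : IsAffineDatum Φ α θ ω) {τ : ℝ} {x : E n}
    (hx : x ∈ alcove (posRoots Φ α) τ) : ‖x‖ ≤ τ * ∑ i, ‖ω i‖ := by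
  have he : x = ∑ i, α i x • ω i := h.ext_simple fun k => by simp [h.coweight]
  conv_lhs => rw [he]
  rw [Finset.mul_sum]
  refine (norm_sum_le _ _).trans (Finset.sum_le_sum fun i _ => ?_)
  have := hx _ (h.simple_mem_posRoots i)
  rw [norm_smul, Real.norm_eq_abs, abs_of_nonneg this.1]
  exact mul_le_mul_of_nonneg_right this.2 (norm_nonneg _)

lemma isCompact_chamber (h : IsAffineDatum Φ α θ ω) (r R : ℝ) :
    IsCompact (chamber (posRoots Φ α) ∩ {p | r ≤ p.1 ∧ p.1 ≤ R}) := by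
  have hsub : chamber (posRoots Φ α) ∩ {p | r ≤ p.1 ∧ p.1 ≤ R} ⊆
      Set.Icc 0 R ×ˢ Metric.closedBall (0 : E n) (R * ∑ i, ‖ω i‖) := by
    rintro p ⟨hp, -, hR⟩
    refine ⟨⟨hp.1, hR⟩, mem_closedBall_zero_iff.2 ((h.norm_le_of_mem_alcove hp.2).trans ?_)⟩
    exact mul_le_mul_of_nonneg_right hR (Finset.sum_nonneg fun _ _ => norm_nonneg _)
  refine (isCompact_Icc.prod (isCompact_closedBall _ _)).of_isClosed_subset ?_ hsub
  exact (isClosed_chamber _).inter ((isClosed_le continuous_const continuous_fst).inter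
    (isClosed_le continuous_fst continuous_const))

lemma exists_mem_openAlcove (h : IsAffineDatum Φ α θ ω) : ∃ b, b ∈ openAlcove (posRoots Φ α) := by
  set ρ : E n := ∑ i, ω i with hρ
  have hα : ∀ i, α i ρ = 1 := fun i => by simp [hρ, h.coweight]
  have hθ : 0 < θ ρ := h.apply_pos h.highest_mem_posRoots fun i => by rw [hα]; exact one_pos
  have h1 : ∀ i, 0 < α i ((θ ρ + 1)⁻¹ • ρ) := fun i => by
    rw [map_smul, hα, smul_eq_mul, mul_one]
    positivity
  refine ⟨(θ ρ + 1)⁻¹ • ρ, fun β hβ => ⟨h.apply_pos hβ h1,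
    (h.apply_le_highest hβ fun i => (h1 i).le).trans_lt ?_⟩⟩
  rw [map_smul, smul_eq_mul, inv_mul_lt_one₀ (by positivity)]
  linarith

/-- Moving towards an interior point of the alcove, one enters the interior. -/
lemma add_smul_mem_openAlcove {Φp : Set (EDual n)} {γ b : E n} (hγ : γ ∈ alcove Φp 1)
    (hb : b ∈ openAlcove Φp) {s : ℝ} (hs : 0 < s) (hs1 : s ≤ 1) :
    γ + s • (b - γ) ∈ openAlcove Φp := by
  intro β hβ
  have h1 := hγ β hβ
  have h2 := hb β hβ
  simp only [map_add, map_smul, map_sub, smul_eq_mul]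
  constructor <;> nlinarith

lemma sinProd_pos (h : IsAffineDatum Φ α θ ω) {b : E n} (hb : b ∈ openAlcove (posRoots Φ α)) :
    0 < sinProd (posRoots Φ α) b := by
  rw [h.sinProd_eq]
  refine Finset.prod_pos fun β hβ => ?_
  have := hb β (by simpa using hβ)
  refine Real.sin_pos_of_pos_of_lt_pi (mul_pos Real.pi_pos this.1) ?_
  nlinarith [Real.pi_pos]

/-- The values of the roots at the orbit of an interior point stay away from the integers. -/
lemma exists_apply_act_notMem (h : IsAffineDatum Φ α θ ω) {b : E n}
    (hb : b ∈ openAlcove (posRoots Φ α)) : ∃ η > 0, ∀ w : affineWeylGroup α θ,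
      ∀ β ∈ posRoots Φ α, ∀ k : ℤ, η ≤ |β (h.act w b) - k| := by
  have hfin := h.posRoots_finite
  obtain ⟨η, hη0, hη⟩ : ∃ η > 0, ∀ β ∈ posRoots Φ α, η ≤ β b ∧ η ≤ 1 - β b := by
    have h1 : ∀ β ∈ posRoots Φ α, ∀ᶠ η : ℝ in 𝓝[>] 0, η ≤ β b ∧ η ≤ 1 - β b := fun β hβ => by
      have := hb β hβ
      filter_upwards [Ioo_mem_nhdsGT this.1, Ioo_mem_nhdsGT (sub_pos.2 this.2)] with η h2 h3
      exact ⟨h2.2.le, h3.2.le⟩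
    have h2 := (Filter.eventually_all_finite hfin).2 h1
    obtain ⟨η, h3, h4⟩ := (h2.and self_mem_nhdsWithin).exists
    exact ⟨η, h4, h3⟩
  refine ⟨η, hη0, fun w β hβ k => ?_⟩
  obtain ⟨β', hβ', he⟩ := (h.isAffineSymm w).root β hβ.1
  obtain ⟨l, hl⟩ := (h.isAffineSymm w).int β hβ.1
  have hv : β (h.act w b) - k = β' b - ((k - l : ℤ) : ℝ) := by
    rw [act, map_add, hl, he]
    push_cast
    ring
  rw [hv]
  generalize k - l = m
  have key : ∀ (y : ℝ) (m : ℤ), η ≤ y → η ≤ 1 - y → η ≤ |y - m| := by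
    intro y m h1 h2
    rcases le_or_gt m 0 with hm | hm
    · have : (m : ℝ) ≤ 0 := by exact_mod_cast hm
      exact (by linarith : η ≤ y - m).trans (le_abs_self _)
    · have : (1 : ℝ) ≤ m := by exact_mod_cast hm
      exact (by linarith : η ≤ -(y - m)).trans (neg_le_abs _)
  rcases h.mem_or_neg_mem_posRoots hβ' with hp | hp
  · exact key _ m (hη _ hp).1 (hη _ hp).2
  · have := key _ (-m) (hη _ hp).1 (hη _ hp).2
    rw [← abs_neg]
    refine this.trans (le_of_eq ?_)
    congr 1
    rw [neg_apply]
    push_cast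
    ring

/-- If an interior point of the alcove is moved into the alcove by `w`, then `det w = 1`. -/
lemma sgn_eq_one_of_act_mem (h : IsAffineDatum Φ α θ ω) {b : E n}
    (hb : b ∈ openAlcove (posRoots Φ α)) {w : affineWeylGroup α θ}
    (hw : h.act w b ∈ alcove (posRoots Φ α) 1) : sgn w = 1 := by
  obtain ⟨η, hη0, hη⟩ := h.exists_apply_act_notMem hb
  have hmem : h.act w b ∈ openAlcove (posRoots Φ α) := fun β hβ => by
    have h1 := hw β hβ
    refine ⟨h1.1.lt_of_ne fun he => ?_, h1.2.lt_of_ne fun he => ?_⟩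
    · have := hη w β hβ 0
      rw [← he] at this
      simp at this
      linarith
    · have := hη w β hβ 1
      rw [he] at this
      simp at this
      linarith
  have h1 := h.sinProd_pos hmem
  rw [h.sinProd_act] at h1
  have h2 := h.sinProd_pos hb
  rcases h.sgn_eq w with e | e
  · exact e
  · rw [e] at h1
    linarith

/-- The points of the orbit of an interior point with negative sign stay away from the alcove. -/
lemma exists_dist_act (h : IsAffineDatum Φ α θ ω) {b : E n}
    (hb : b ∈ openAlcove (posRoots Φ α)) : ∃ δ > 0, ∀ w : affineWeylGroup α θ, sgn w = -1 →
      ∀ u ∈ alcove (posRoots Φ α) 1, δ ≤ ‖h.act w b - u‖ := by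
  obtain ⟨η, hη0, hη⟩ := h.exists_apply_act_notMem hb
  obtain ⟨A, hA0, hA⟩ : ∃ A : ℝ, 0 < A ∧ ∀ β ∈ posRoots Φ α, ‖β‖ ≤ A := by
    obtain ⟨A, hA⟩ := (h.posRoots_finite.image fun β => ‖β‖).bddAbove
    exact ⟨max A 1, by positivity, fun β hβ => (hA ⟨β, hβ, rfl⟩).trans (le_max_left _ _)⟩
  refine ⟨η / A, by positivity, fun w hw u hu => ?_⟩
  have hn : h.act w b ∉ alcove (posRoots Φ α) 1 := fun hm => by
    rw [h.sgn_eq_one_of_act_mem hb hm] at hw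
    norm_num at hw
  simp only [alcove, Set.mem_ofPred_eq, not_forall] at hn
  obtain ⟨β, hβ, hn⟩ := hn
  have hle : η ≤ |β (h.act w b - u)| := by
    have h1 := hu β hβ
    rw [map_sub]
    rcases not_and_or.1 hn with h2 | h2
    · have h3 := hη w β hβ 0
      rw [Int.cast_zero, sub_zero, abs_of_neg (by linarith)] at h3
      rw [abs_of_neg (by linarith)]
      linarith
    · have h3 := hη w β hβ 1
      rw [Int.cast_one, abs_of_pos (by linarith)] at h3
      rw [abs_of_pos (by linarith)]
      linarith
  rw [div_le_iff₀' hA0]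
  refine hle.trans (((β.le_opNorm _)).trans ?_)
  exact mul_le_mul_of_nonneg_right (hA β hβ) (norm_nonneg _)

end IsAffineDatum

end

/-! ### Division of exponential integrals by linear forms -/

/-- A family, depending continuously on a parameter `p`, of absolutely convergent superpositions of
exponentials `b ↦ exp ⟪Y p z, b⟫` with weights `c p z`. -/
structure ExpFamily (P : Type*) [TopologicalSpace P] (n : ℕ) where
  Z : Type
  [measurableSpace : MeasurableSpace Z]
  μ : Measure Z
  [sFinite : SFinite μ]
  c : P → Z → ℝ
  Y : P → Z → E n
  measurable_c : ∀ p, Measurable (c p)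
  measurable_Y : ∀ p, Measurable (Y p)
  continuous_c : ∀ z, Continuous fun p => c p z
  continuous_Y : ∀ z, Continuous fun p => Y p z
  bound : ∀ (p₀ : P) (R : ℝ), ∃ G : Z → ℝ, Integrable G μ ∧
    ∀ᶠ p in 𝓝 p₀, ∀ z, |c p z| * Real.exp (R * ‖Y p z‖) ≤ G z

attribute [instance] ExpFamily.measurableSpace ExpFamily.sFinite

namespace ExpFamily

variable {P : Type*} [TopologicalSpace P]

/-- The function represented by an exponential family. -/
def eval (K : ExpFamily P n) (p : P) (b : E n) : ℝ :=
  ∫ z, K.c p z * Real.exp (inner ℝ (K.Y p z) b) ∂K.μ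

lemma norm_integrand_le (K : ExpFamily P n) (p : P) (b : E n) (z : K.Z) {R : ℝ} (hb : ‖b‖ ≤ R) :
    ‖K.c p z * Real.exp (inner ℝ (K.Y p z) b)‖ ≤ |K.c p z| * Real.exp (R * ‖K.Y p z‖) := by
  rw [norm_mul, Real.norm_eq_abs, Real.norm_eq_abs, Real.abs_exp]
  refine mul_le_mul_of_nonneg_left (Real.exp_le_exp.2 ?_) (abs_nonneg _)
  refine (real_inner_le_norm _ _).trans ?_
  rw [mul_comm]
  exact mul_le_mul_of_nonneg_right hb (norm_nonneg _)

lemma measurable_integrand (K : ExpFamily P n) (p : P) (b : E n) :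
    Measurable fun z => K.c p z * Real.exp (inner ℝ (K.Y p z) b) :=
  (K.measurable_c p).mul ((K.measurable_Y p).inner_const).exp

lemma integrable (K : ExpFamily P n) (p : P) (b : E n) :
    Integrable (fun z => K.c p z * Real.exp (inner ℝ (K.Y p z) b)) K.μ := by
  obtain ⟨G, hG, hle⟩ := K.bound p ‖b‖
  refine hG.mono' (K.measurable_integrand p b).aestronglyMeasurable (ae_of_all _ fun z => ?_)
  exact (K.norm_integrand_le p b z le_rfl).trans (hle.self_of_nhds z)

lemma continuous_eval [FirstCountableTopology P] (K : ExpFamily P n) :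
    Continuous fun q : P × E n => K.eval q.1 q.2 := by
  refine continuous_iff_continuousAt.2 fun q₀ => ?_
  obtain ⟨G, hG, hle⟩ := K.bound q₀.1 (‖q₀.2‖ + 1)
  refine continuousAt_of_dominated (bound := G) (Eventually.of_forall fun q =>
    (K.measurable_integrand q.1 q.2).aestronglyMeasurable) ?_ hG (ae_of_all _ fun z => ?_)
  · have h2 : ∀ᶠ q : P × E n in 𝓝 q₀, ‖q.2‖ < ‖q₀.2‖ + 1 :=
      (continuous_snd.norm.tendsto q₀).eventually (gt_mem_nhds (by simp))
    filter_upwards [(continuous_fst.tendsto q₀).eventually hle, h2] with q h1 h2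
    exact ae_of_all _ fun z => (K.norm_integrand_le q.1 q.2 z h2.le).trans (h1 z)
  · have h1 := K.continuous_c z
    have h2 := K.continuous_Y z
    fun_prop

lemma continuous_eval_right [FirstCountableTopology P] (K : ExpFamily P n) (p : P) :
    Continuous (K.eval p) := K.continuous_eval.comp (Continuous.prodMk_right p)

/-- The vector `v` with `β v = 1` which is orthogonal to the kernel of `β`. -/
def unitNormal (β : EDual n) : E n := (‖β‖ ^ 2)⁻¹ • sharp β

lemma apply_unitNormal {β : EDual n} (hβ : β ≠ 0) : β (unitNormal β) = 1 := by
  rw [unitNormal, map_smul, apply_sharp_self, smul_eq_mul, inv_mul_cancel₀]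
  simpa using hβ

/-- The exponential family obtained by writing, for `f b = 0` on the hyperplane `β b = k`,
`f b = f b - f (b - (β b - k) • v)` as the integral of the derivative of `f` in the normal
direction `v`, and removing the factor `β b - k`. -/
def div (K : ExpFamily P n) (β : EDual n) (k : ℝ) : ExpFamily P n where
  Z := K.Z × unitInterval
  μ := K.μ.prod volume
  c p z := K.c p z.1 * (inner ℝ (K.Y p z.1) (unitNormal β) *
    Real.exp ((1 - z.2) * k * inner ℝ (K.Y p z.1) (unitNormal β)))
  Y p z := K.Y p z.1 - ((1 - (z.2 : ℝ)) * inner ℝ (K.Y p z.1) (unitNormal β)) • sharp β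
  measurable_c p := by
    have h1 := K.measurable_c p
    have h2 : Measurable fun z => inner ℝ (K.Y p z) (unitNormal β) :=
      (K.measurable_Y p).inner_const
    exact (h1.comp measurable_fst).mul ((h2.comp measurable_fst).mul
      (Measurable.mul (by fun_prop) (h2.comp measurable_fst)).exp)
  measurable_Y p := by
    have h1 := K.measurable_Y p
    have h2 : Measurable fun z => inner ℝ (K.Y p z) (unitNormal β) :=
      (K.measurable_Y p).inner_const
    fun_prop
  continuous_c z := by
    have h1 := K.continuous_c z.1
    have h2 := K.continuous_Y z.1
    fun_prop
  continuous_Y z := by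
    have h2 := K.continuous_Y z.1
    fun_prop
  bound p₀ R := by
    set v := unitNormal β
    obtain ⟨G, hG, hle⟩ := K.bound p₀ (1 + |k| * ‖v‖ + |R| * (1 + ‖v‖ * ‖β‖))
    refine ⟨fun z => ‖v‖ * G z.1, (hG.comp_fst volume).const_mul _, ?_⟩
    filter_upwards [hle] with p hp
    rintro ⟨z, s, hs0, hs1⟩
    set y := K.Y p z
    set a : ℝ := inner ℝ y v with ha
    have h1 : |a| ≤ ‖v‖ * ‖y‖ := by rw [mul_comm]; exact abs_real_inner_le_norm _ _
    have h2 : |a| ≤ ‖v‖ * Real.exp ‖y‖ := h1.trans (mul_le_mul_of_nonneg_left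
      ((Real.add_one_le_exp ‖y‖).trans' (by linarith)) (norm_nonneg _))
    have hs : |1 - s| ≤ 1 := by rw [abs_le]; constructor <;> linarith
    have h3 : (1 - s) * k * a ≤ |k| * ‖v‖ * ‖y‖ := by
      refine (le_abs_self _).trans ?_
      rw [abs_mul, abs_mul, mul_assoc |k|]
      exact mul_le_mul (mul_le_of_le_one_left (abs_nonneg _) hs) h1 (abs_nonneg _) (abs_nonneg _)
    have h4 : ‖y - ((1 - s) * a) • sharp β‖ ≤ (1 + ‖v‖ * ‖β‖) * ‖y‖ := by
      refine (norm_sub_le _ _).trans ?_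
      rw [norm_smul, norm_sharp, Real.norm_eq_abs, abs_mul, add_mul, one_mul,
        mul_right_comm ‖v‖]
      refine add_le_add_right (mul_le_mul_of_nonneg_right ?_ (norm_nonneg _)) _
      exact (mul_le_of_le_one_left (abs_nonneg _) hs).trans h1
    have h5 : R * ‖y - ((1 - s) * a) • sharp β‖ ≤ |R| * ((1 + ‖v‖ * ‖β‖) * ‖y‖) :=
      mul_le_mul (le_abs_self R) h4 (norm_nonneg _) (abs_nonneg _)
    have h6 := hp z
    change |K.c p z * (a * Real.exp ((1 - s) * k * a))| *
      Real.exp (R * ‖y - ((1 - s) * a) • sharp β‖) ≤ ‖v‖ * G z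
    refine le_trans ?_ (mul_le_mul_of_nonneg_left h6 (norm_nonneg v))
    rw [abs_mul, abs_mul, Real.abs_exp]
    calc |K.c p z| * (|a| * Real.exp ((1 - s) * k * a)) *
          Real.exp (R * ‖y - ((1 - s) * a) • sharp β‖)
        ≤ |K.c p z| * ((‖v‖ * Real.exp ‖y‖) * Real.exp (|k| * ‖v‖ * ‖y‖)) *
          Real.exp (|R| * ((1 + ‖v‖ * ‖β‖) * ‖y‖)) := by gcongr
      _ = _ := by
        rw [show (1 + |k| * ‖v‖ + |R| * (1 + ‖v‖ * ‖β‖)) * ‖K.Y p z‖ = ‖y‖ + |k| * ‖v‖ * ‖y‖ +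
          |R| * ((1 + ‖v‖ * ‖β‖) * ‖y‖) by ring, Real.exp_add, Real.exp_add]
        ring

lemma integral_unitInterval (L a q : ℝ) :
    L * ∫ s : unitInterval, a * Real.exp (q - (1 - (s : ℝ)) * (L * a)) =
      Real.exp q - Real.exp (q - L * a) := by
  have h1 : ∫ s : unitInterval, a * Real.exp (q - (1 - (s : ℝ)) * (L * a)) =
      ∫ s in (0 : ℝ)..1, a * Real.exp (q - (1 - s) * (L * a)) := by
    rw [intervalIntegral.integral_of_le zero_le_one, ← integral_Icc_eq_integral_Ioc]
    exact integral_subtype (s := unitInterval) measurableSet_Icc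
      fun s => a * Real.exp (q - (1 - s) * (L * a))
  rw [h1, ← intervalIntegral.integral_const_mul]
  rw [intervalIntegral.integral_eq_sub_of_hasDerivAt
    (f := fun s => Real.exp (q - (1 - s) * (L * a)))]
  · simp
  · intro s _
    have h2 : HasDerivAt (fun s : ℝ => q - (1 - s) * (L * a)) (L * a) s := by
      have := (((hasDerivAt_id s).const_sub 1).mul_const (L * a)).const_sub q
      simpa using this
    refine h2.exp.congr_deriv ?_
    ring
  · exact Continuous.intervalIntegrable (by fun_prop) _ _

lemma eval_div (K : ExpFamily P n) {β : EDual n} (hβ : β ≠ 0) {k : ℝ} (p : P)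
    (hK : ∀ b, β b = k → K.eval p b = 0) (b : E n) :
    K.eval p b = (β b - k) * (K.div β k).eval p b := by
  set v := unitNormal β with hv
  set L := β b - k with hL
  have h0 : K.eval p (b - L • v) = 0 := hK _ (by
    rw [map_sub, map_smul, apply_unitNormal hβ, hL, smul_eq_mul]
    ring)
  have h1 : (K.div β k).eval p b = ∫ z, (∫ s : unitInterval, K.c p z *
      (inner ℝ (K.Y p z) v * Real.exp (inner ℝ (K.Y p z) b -
        (1 - (s : ℝ)) * (L * inner ℝ (K.Y p z) v)))) ∂K.μ := by
    have h2 := integral_prod _ ((K.div β k).integrable p b)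
    refine h2.trans (integral_congr_ae (ae_of_all _ fun z => integral_congr_ae
      (ae_of_all _ fun s => ?_)))
    simp only [div, inner_sub_left, real_inner_smul_left, inner_sharp, ← hv]
    rw [mul_assoc (K.c p z), mul_assoc (inner ℝ (K.Y p z) v), ← Real.exp_add]
    congr 3
    rw [hL]
    ring
  rw [h1, ← integral_const_mul]
  have h3 : ∀ z, L * ∫ s : unitInterval, K.c p z * (inner ℝ (K.Y p z) v *
      Real.exp (inner ℝ (K.Y p z) b - (1 - (s : ℝ)) * (L * inner ℝ (K.Y p z) v))) =
      K.c p z * Real.exp (inner ℝ (K.Y p z) b) -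
        K.c p z * Real.exp (inner ℝ (K.Y p z) (b - L • v)) := fun z => by
    rw [integral_const_mul, mul_left_comm, integral_unitInterval, mul_sub, inner_sub_right,
      real_inner_smul_right]
  simp_rw [h3]
  rw [integral_sub (K.integrable p b) (K.integrable p _)]
  change _ = K.eval p b - K.eval p (b - L • v)
  rw [h0, sub_zero]

/-- A continuous function which vanishes, off the hyperplane `β₀ b = k₀`, on the hyperplane
`β b = k`, vanishes on the whole of the latter hyperplane. -/
lemma _root_.AffineTheta.eq_zero_of_hyperplane {f : E n → ℝ} (hf : Continuous f) {β β₀ : EDual n}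
    (hβ : β ≠ 0) (hne : ∀ c : ℝ, β₀ ≠ c • β) {k k₀ : ℝ}
    (h0 : ∀ b, β b = k → β₀ b ≠ k₀ → f b = 0) {b : E n} (hb : β b = k) : f b = 0 := by
  set u : E n := sharp β₀ - (β (sharp β₀) / ‖β‖ ^ 2) • sharp β with hu
  have hβ2 : ‖β‖ ^ 2 ≠ 0 := by simpa using hβ
  have h1 : β u = 0 := by
    rw [hu, map_sub, map_smul, apply_sharp_self, smul_eq_mul, div_mul_cancel₀ _ hβ2, sub_self]
  have hune : u ≠ 0 := fun h => by
    refine hne (β (sharp β₀) / ‖β‖ ^ 2) ?_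
    rw [hu, ← sharp_smul, ← sharp_sub] at h
    have h2 : ‖β₀ - (β (sharp β₀) / ‖β‖ ^ 2) • β‖ = 0 := by rw [← norm_sharp, h, norm_zero]
    exact sub_eq_zero.1 (norm_eq_zero.1 h2)
  have h2 : β₀ u ≠ 0 := fun h => by
    have h3 : inner ℝ u u = (0 : ℝ) := by
      conv_lhs => rw [hu]
      rw [inner_sub_left, real_inner_smul_left, inner_sharp, inner_sharp, ← hu, h, h1]
      ring
    exact hune (inner_self_eq_zero.1 h3)
  by_cases hb0 : β₀ b = k₀
  · have hc : Tendsto (fun s : ℝ => f (b + s • u)) (𝓝[≠] 0) (𝓝 (f b)) := by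
      have : Continuous fun s : ℝ => f (b + s • u) := by fun_prop
      have h4 := this.tendsto 0
      rw [zero_smul, add_zero] at h4
      exact h4.mono_left nhdsWithin_le_nhds
    refine tendsto_nhds_unique hc (tendsto_const_nhds.congr' ?_)
    filter_upwards [self_mem_nhdsWithin] with s hs
    refine (h0 _ (by rw [map_add, map_smul, h1, hb, smul_zero, add_zero]) ?_).symm
    rw [map_add, map_smul, hb0, smul_eq_mul]
    intro h5
    exact mul_ne_zero hs h2 (by linarith)
  · exact h0 b hb hb0

/-- An exponential family vanishing on pairwise non-parallel hyperplanes is divisible by the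
product of their equations. -/
lemma exists_eval_eq_prod_mul [FirstCountableTopology P] (k : EDual n → ℝ) (S : Finset (EDual n))
    (hne : ∀ β ∈ S, β ≠ 0) (hS : ∀ β ∈ S, ∀ β' ∈ S, ∀ c : ℝ, β' = c • β → β' = β)
    (K : ExpFamily P n) (hK : ∀ β ∈ S, ∀ p b, β b = k β → K.eval p b = 0) :
    ∃ K' : ExpFamily P n, ∀ p b, K.eval p b = (∏ β ∈ S, (β b - k β)) * K'.eval p b := by
  classical
  induction S using Finset.induction_on generalizing K with
  | empty => exact ⟨K, fun p b => by simp⟩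
  | insert β₀ S hβ₀ ih =>
    have hdiv := fun p b => K.eval_div (hne β₀ (Finset.mem_insert_self _ _)) p
      (fun b => hK β₀ (Finset.mem_insert_self _ _) p b) b
    obtain ⟨K', hK'⟩ := ih (fun β hβ => hne β (Finset.mem_insert_of_mem hβ))
      (fun β hβ β' hβ' => hS β (Finset.mem_insert_of_mem hβ) β' (Finset.mem_insert_of_mem hβ'))
      (K.div β₀ (k β₀)) fun β hβ p b hb => by
        refine eq_zero_of_hyperplane ((K.div β₀ (k β₀)).continuous_eval_right p)
          (hne β (Finset.mem_insert_of_mem hβ)) (β₀ := β₀) (k₀ := k β₀) (fun c hc => ?_)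
          (fun b h1 h2 => ?_) hb
        · exact hβ₀ (hS β (Finset.mem_insert_of_mem hβ) β₀ (Finset.mem_insert_self _ _) c hc ▸ hβ)
        · have := hK β (Finset.mem_insert_of_mem hβ) p b h1
          rw [hdiv] at this
          exact (mul_eq_zero.1 this).resolve_left (sub_ne_zero.2 h2)
    refine ⟨K', fun p b => ?_⟩
    rw [hdiv, hK', Finset.prod_insert hβ₀, mul_assoc]

end ExpFamily

/-! ### Extension of the theta function across the zeros of the denominator -/

section

variable {Φ : Set (EDual n)} {α : Fin n → EDual n} {θ : EDual n} {ω : Fin n → E n}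

namespace IsAffineDatum

/-- The theta series as an exponential family, indexed by the affine Weyl group and depending on
the parameters `(t, x)` with `t > 0`. -/
def thetaFamily (h : IsAffineDatum Φ α θ ω) : ExpFamily {p : ℝ × E n // 0 < p.1} n where
  Z := affineWeylGroup α θ
  measurableSpace := ⊤
  μ := @Measure.count _ ⊤
  sFinite := by
    let _ : MeasurableSpace (affineWeylGroup α θ) := ⊤
    have := h.countable
    infer_instance
  c p w := sgn w * Real.exp (inner ℝ p.1.2 (h.transPart w) - p.1.1 * ‖h.transPart w‖ ^ 2 / 2)
  Y p w := (h.linPart w).symm (p.1.2 - p.1.1 • h.transPart w)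
  measurable_c p := measurable_from_top
  measurable_Y p := measurable_from_top
  continuous_c w := by fun_prop
  continuous_Y w := by fun_prop
  bound p₀ R := by
    let _ : MeasurableSpace (affineWeylGroup α θ) := ⊤
    have := h.countable
    obtain ⟨⟨t₀, x₀⟩, ht₀ : 0 < t₀⟩ := p₀
    refine ⟨fun w => Real.exp (|R| * (‖x₀‖ + 1)) *
      Real.exp ((‖x₀‖ + 1 + |R| * (2 * t₀)) * ‖h.transPart w‖ - t₀ / 4 * ‖h.transPart w‖ ^ 2),
      ?_, ?_⟩
    · refine (integrable_count_iff.2 ?_)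
      exact ((h.summable_exp_transPart _ (by positivity)).mul_left _).norm
    · have h1 : ∀ᶠ p : {p : ℝ × E n // 0 < p.1} in 𝓝 ⟨(t₀, x₀), ht₀⟩, t₀ / 2 < p.1.1 :=
        ((continuous_fst.comp continuous_subtype_val).tendsto _).eventually
          (lt_mem_nhds (show t₀ / 2 < t₀ by linarith))
      have h2 : ∀ᶠ p : {p : ℝ × E n // 0 < p.1} in 𝓝 ⟨(t₀, x₀), ht₀⟩, p.1.1 < 2 * t₀ :=
        ((continuous_fst.comp continuous_subtype_val).tendsto _).eventually
          (gt_mem_nhds (show t₀ < 2 * t₀ by linarith))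
      have h3 : ∀ᶠ p : {p : ℝ × E n // 0 < p.1} in 𝓝 ⟨(t₀, x₀), ht₀⟩, ‖p.1.2‖ < ‖x₀‖ + 1 :=
        ((continuous_snd.comp continuous_subtype_val).norm.tendsto _).eventually
          (gt_mem_nhds (show ‖x₀‖ < ‖x₀‖ + 1 by linarith))
      filter_upwards [h1, h2, h3]
      rintro ⟨⟨t, x⟩, ht : 0 < t⟩ h1 h2 h3 w
      simp only at h1 h2 h3 ⊢
      rw [abs_mul, h.abs_sgn, one_mul, Real.abs_exp, ← Real.exp_add, ← Real.exp_add,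
        Real.exp_le_exp, LinearIsometryEquiv.norm_map]
      set m := h.transPart w
      have e1 : inner ℝ x m ≤ (‖x₀‖ + 1) * ‖m‖ := (real_inner_le_norm _ _).trans
        (mul_le_mul_of_nonneg_right h3.le (norm_nonneg _))
      have e2 : R * ‖x - t • m‖ ≤ |R| * (‖x₀‖ + 1 + 2 * t₀ * ‖m‖) := by
        refine mul_le_mul (le_abs_self R) ((norm_sub_le _ _).trans (add_le_add h3.le ?_))
          (norm_nonneg _) (abs_nonneg _)
        rw [norm_smul, Real.norm_eq_abs, abs_of_pos ht]
        exact mul_le_mul_of_nonneg_right h2.le (norm_nonneg _)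
      have e3 : t₀ / 2 * ‖m‖ ^ 2 ≤ t * ‖m‖ ^ 2 :=
        mul_le_mul_of_nonneg_right h1.le (sq_nonneg _)
      nlinarith

lemma eval_thetaFamily (h : IsAffineDatum Φ α θ ω) (p : {p : ℝ × E n // 0 < p.1}) (b : E n) :
    h.thetaFamily.eval p b = thetaSum α θ b p.1.1 p.1.2 := by
  let _ : MeasurableSpace (affineWeylGroup α θ) := ⊤
  have := h.countable
  have h1 : Integrable (fun w : affineWeylGroup α θ => sgn w *
      Real.exp (inner ℝ p.1.2 (h.transPart w) - p.1.1 * ‖h.transPart w‖ ^ 2 / 2) *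
      Real.exp (inner ℝ ((h.linPart w).symm (p.1.2 - p.1.1 • h.transPart w)) b))
      Measure.count := h.thetaFamily.integrable p b
  refine (integral_countable h1).trans (tsum_congr fun w => ?_)
  rw [h.thetaTerm_eq]
  simp only [Measure.real, Measure.count_singleton, ENNReal.toReal_one, one_smul]
  rw [mul_assoc, ← Real.exp_add]
  congr 2
  rw [LinearIsometryEquiv.inner_map_eq_flip, LinearIsometryEquiv.symm_symm, act, inner_sub_left,
    inner_add_right, real_inner_smul_left, norm_add_sq_real, LinearIsometryEquiv.norm_map,
    real_inner_comm (h.linPart w b) (h.transPart w)]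
  ring

/-- Near a point `γ` of the alcove, numerator and denominator of `psiHat` have a common factor `D`, the
product of the equations of the hyperplanes `β = 0` and `β = 1` through `γ`; the remaining factor `S`
of the denominator does not vanish at `γ`. -/
lemma exists_continuous_extension (h : IsAffineDatum Φ α θ ω) {γ : E n}
    (hγ : γ ∈ alcove (posRoots Φ α) 1) : ∃ (Q : {p : ℝ × E n // 0 < p.1} → E n → ℝ) (D S : E n → ℝ),
      (Continuous fun q : {p : ℝ × E n // 0 < p.1} × E n => Q q.1 q.2) ∧ Continuous S ∧ S γ ≠ 0 ∧
      (∀ b, sinProd (posRoots Φ α) b = D b * S b) ∧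
      ∀ p b, thetaSum α θ b p.1.1 p.1.2 = D b * Q p b := by
  classical
  set N := h.posRoots_finite.toFinset
  have hN : ∀ {β}, β ∈ N ↔ β ∈ posRoots Φ α := by simp [N]
  set Z := N.filter fun β => β γ = 0 ∨ β γ = 1
  have hZ : ∀ {β}, β ∈ Z → β ∈ posRoots Φ α ∧ (β γ = 0 ∨ β γ = 1) := fun hβ =>
    ⟨hN.1 (Finset.mem_filter.1 hβ).1, (Finset.mem_filter.1 hβ).2⟩
  obtain ⟨K, hK⟩ := h.thetaFamily.exists_eval_eq_prod_mul (fun β => β γ) Z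
    (fun β hβ => h.ne_zero (hZ hβ).1.1) (fun β hβ β' hβ' c hc => h.eq_of_eq_smul (hZ hβ).1
      (hZ hβ').1 hc) (fun β hβ p b hb => by
        rw [h.eval_thetaFamily]
        rcases (hZ hβ).2 with e | e
        · exact thetaSum_eq_zero_of_reflection (h.hasReflection_posRoot_zero (hZ hβ).1)
            (hb.trans e) _ _
        · exact thetaSum_eq_zero_of_reflection (h.hasReflection_posRoot_one (hZ hβ).1)
            (hb.trans e) _ _)
  refine ⟨K.eval, fun b => ∏ β ∈ Z, (β b - β γ), fun b => (∏ β ∈ Z, (Real.cos (Real.pi * β γ) *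
    (Real.pi * Real.sinc (Real.pi * (β b - β γ))))) * ∏ β ∈ N with ¬(β γ = 0 ∨ β γ = 1),
      Real.sin (Real.pi * β b), K.continuous_eval, ?_, ?_, fun b => ?_, fun p b => ?_⟩
  · have := Real.continuous_sinc
    fun_prop
  · refine mul_ne_zero (Finset.prod_ne_zero_iff.2 fun β hβ => ?_)
      (Finset.prod_ne_zero_iff.2 fun β hβ => ?_)
    · rw [sub_self, mul_zero, Real.sinc_zero, mul_one]
      refine mul_ne_zero ?_ Real.pi_ne_zero
      rcases (hZ hβ).2 with e | e <;> simp [e]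
    · obtain ⟨h1, h2⟩ := Finset.mem_filter.1 hβ
      have h3 := hγ β (hN.1 h1)
      have h4 : 0 < β γ := h3.1.lt_of_ne fun e => h2 (Or.inl e.symm)
      have h5 : β γ < 1 := h3.2.lt_of_ne fun e => h2 (Or.inr e)
      exact (Real.sin_pos_of_pos_of_lt_pi (by positivity) (by nlinarith [Real.pi_pos])).ne'
  · rw [h.sinProd_eq, ← Finset.prod_filter_mul_prod_filter_not N fun β => β γ = 0 ∨ β γ = 1,
      ← mul_assoc, ← Finset.prod_mul_distrib]
    congr 1
    refine Finset.prod_congr rfl fun β hβ => ?_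
    have h0 : Real.sin (Real.pi * β γ) = 0 := by rcases (hZ hβ).2 with e | e <;> simp [e]
    have h1 : Real.sin (Real.pi * β b) =
        Real.cos (Real.pi * β γ) * Real.sin (Real.pi * (β b - β γ)) := by
      rw [show Real.pi * β b = Real.pi * (β b - β γ) + Real.pi * β γ by ring, Real.sin_add, h0]
      ring
    rw [h1]
    by_cases hb : β b - β γ = 0
    · simp [hb]
    · rw [Real.sinc_of_ne_zero (mul_ne_zero Real.pi_ne_zero hb)]
      field_simp [Real.pi_ne_zero]
  · rw [← h.eval_thetaFamily, hK]

/-- The segment from `γ` to an interior point of the alcove avoids the zeros of the denominator. -/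
lemma tendsto_segment (h : IsAffineDatum Φ α θ ω) {γ b : E n} (hγ : γ ∈ alcove (posRoots Φ α) 1)
    (hb : b ∈ openAlcove (posRoots Φ α)) : Tendsto (fun s : ℝ => γ + s • (b - γ)) (𝓝[>] 0)
      (𝓝[{b | sinProd (posRoots Φ α) b ≠ 0}] γ) := by
  refine tendsto_nhdsWithin_iff.2 ⟨?_, ?_⟩
  · have : Continuous fun s : ℝ => γ + s • (b - γ) := by fun_prop
    have h2 := this.tendsto 0
    rw [zero_smul, add_zero] at h2
    exact h2.mono_left nhdsWithin_le_nhds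
  · filter_upwards [Ioo_mem_nhdsGT one_pos] with s hs
    exact (h.sinProd_pos (add_smul_mem_openAlcove hγ hb hs.1 hs.2.le)).ne'

lemma neBot_nhdsWithin (h : IsAffineDatum Φ α θ ω) {γ : E n}
    (hγ : γ ∈ alcove (posRoots Φ α) 1) : (𝓝[{b | sinProd (posRoots Φ α) b ≠ 0}] γ).NeBot := by
  obtain ⟨b, hb⟩ := h.exists_mem_openAlcove
  exact (h.tendsto_segment hγ hb).neBot

/-- The theta functions `psiHat` near `γ` and the function `psi` at `γ` are restrictions of one
function which is jointly continuous in all the variables. -/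
lemma exists_continuousOn_extension (h : IsAffineDatum Φ α θ ω) {γ : E n}
    (hγ : γ ∈ alcove (posRoots Φ α) 1) : ∃ (q : (ℝ × E n) × E n → ℝ) (U : Set (E n)), IsOpen U ∧
      γ ∈ U ∧ ContinuousOn q ({p | 0 < p.1} ×ˢ U) ∧
      (∀ b ∈ U, sinProd (posRoots Φ α) b ≠ 0 → ∀ p : ℝ × E n, 0 < p.1 →
        psiHat (posRoots Φ α) α θ b p.1 p.2 = q (p, b)) ∧
      ∀ p : ℝ × E n, 0 < p.1 → psi (posRoots Φ α) α θ γ p.1 p.2 = q (p, γ) := by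
  obtain ⟨Q, D, S, hQ, hS, hSγ, hsin, hθ⟩ := h.exists_continuous_extension hγ
  set q : (ℝ × E n) × E n → ℝ := fun z => if ht : 0 < z.1.1 then Q ⟨z.1, ht⟩ z.2 / S z.2 else 0
  have hq : ∀ p : ℝ × E n, ∀ ht : 0 < p.1, ∀ b, q (p, b) = Q ⟨p, ht⟩ b / S b :=
    fun p ht b => dif_pos ht
  have hU : IsOpen {b | S b ≠ 0} := isOpen_ne_fun hS continuous_const
  have hpsi : ∀ b ∈ {b | S b ≠ 0}, sinProd (posRoots Φ α) b ≠ 0 → ∀ p : ℝ × E n, 0 < p.1 →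
      psiHat (posRoots Φ α) α θ b p.1 p.2 = q (p, b) := fun b hb hs p ht => by
    rw [psiHat_eq, hsin, hθ ⟨p, ht⟩, hq p ht]
    rw [hsin] at hs
    have := left_ne_zero_of_mul hs
    have hb' : S b ≠ 0 := hb
    field_simp
  have hcont : ContinuousOn q ({p | 0 < p.1} ×ˢ {b | S b ≠ 0}) := by
    rw [continuousOn_iff_continuous_domRestrict]
    have h1 : Continuous fun z : ↥({p : ℝ × E n | 0 < p.1} ×ˢ {b | S b ≠ 0}) =>
        Q ⟨z.1.1, z.2.1⟩ z.1.2 / S z.1.2 := by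
      refine (hQ.comp (f := fun z : ↥({p : ℝ × E n | 0 < p.1} ×ˢ {b | S b ≠ 0}) =>
        ((⟨z.1.1, z.2.1⟩ : {p : ℝ × E n // 0 < p.1}), z.1.2)) ?_).div
        (hS.comp (continuous_snd.comp continuous_subtype_val)) fun z => z.2.2
      fun_prop
    exact h1.congr fun z => (hq _ z.2.1 _).symm
  refine ⟨q, {b | S b ≠ 0}, hU, hSγ, hcont, hpsi, fun p ht => ?_⟩
  by_cases hγ0 : sinProd (posRoots Φ α) γ ≠ 0
  · rw [psi, if_pos hγ0]
    exact hpsi γ hSγ hγ0 p ht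
  · rw [psi, if_neg hγ0]
    have := h.neBot_nhdsWithin hγ
    refine Tendsto.limUnder_eq ?_
    have h1 : ContinuousAt (fun b => q (p, b)) γ :=
      (hcont.continuousAt (((isOpen_lt continuous_const continuous_fst).prod hU).mem_nhds
        (show (p, γ) ∈ _ from ⟨ht, hSγ⟩))).comp (Continuous.prodMk_right p).continuousAt
    refine (h1.tendsto.mono_left nhdsWithin_le_nhds).congr' ?_
    filter_upwards [self_mem_nhdsWithin, mem_nhdsWithin_of_mem_nhds (hU.mem_nhds hSγ)] with b h2 h3
    exact (hpsi b h3 h2 p ht).symm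

/-- The function `psi` is well defined. -/
lemma tendsto_psiHat (h : IsAffineDatum Φ α θ ω) {γ : E n}
    (hγ : γ ∈ alcove (posRoots Φ α) 1) {t : ℝ} (ht : 0 < t) (x : E n) :
    Tendsto (fun b => psiHat (posRoots Φ α) α θ b t x) (𝓝[{b | sinProd (posRoots Φ α) b ≠ 0}] γ)
      (𝓝 (psi (posRoots Φ α) α θ γ t x)) := by
  obtain ⟨q, U, hU, hγU, hq, hqb, hqγ⟩ := h.exists_continuousOn_extension hγ
  rw [hqγ (t, x) ht]
  have h1 : ContinuousAt (fun b => q ((t, x), b)) γ :=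
    (hq.continuousAt (((isOpen_lt continuous_const continuous_fst).prod hU).mem_nhds
      (show ((t, x), γ) ∈ _ from ⟨ht, hγU⟩))).comp (Continuous.prodMk_right _).continuousAt
  refine (h1.tendsto.mono_left nhdsWithin_le_nhds).congr' ?_
  filter_upwards [self_mem_nhdsWithin, mem_nhdsWithin_of_mem_nhds (hU.mem_nhds hγU)] with b h2 h3
  exact (hqb b h3 h2 (t, x) ht).symm

end IsAffineDatum

end

/-! ### Derivatives at a minimum and exponential series of one variable -/

lemma IsLocalMin.second_deriv_nonneg {f f' : ℝ → ℝ} {f'' x₀ : ℝ} (h : IsLocalMin f x₀)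
    (h1 : ∀ᶠ x in 𝓝 x₀, HasDerivAt f (f' x) x) (h2 : HasDerivAt f' f'' x₀) : 0 ≤ f'' := by
  by_contra! hneg
  have hd : deriv f =ᶠ[𝓝 x₀] f' := h1.mono fun x hx => hx.deriv
  have hdd : deriv (deriv f) x₀ = f'' := hd.deriv_eq.trans h2.deriv
  have hmax := isLocalMax_of_deriv_deriv_neg (hdd ▸ hneg) h.deriv_eq_zero
    h1.self_of_nhds.continuousAt
  have hconst : f =ᶠ[𝓝 x₀] fun _ => f x₀ := by
    filter_upwards [h, hmax] with x hx1 hx2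
    exact le_antisymm hx2 hx1
  have h3 : deriv f =ᶠ[𝓝 x₀] fun _ => 0 := by
    have := hconst.deriv
    simpa using this
  have h4 := h3.deriv_eq
  rw [hdd] at h4
  simp at h4
  linarith

lemma deriv_nonneg_of_eventually_le {f : ℝ → ℝ} {f' x₀ : ℝ} (h : HasDerivAt f f' x₀)
    (hle : ∀ᶠ x in 𝓝[>] x₀, f x₀ ≤ f x) : 0 ≤ f' := by
  have h1 : Tendsto (slope f x₀) (𝓝[>] x₀) (𝓝 f') := (hasDerivAt_iff_tendsto_slope.1 h).mono_left
    (nhdsWithin_mono x₀ fun x (hx : x₀ < x) => hx.ne')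
  refine ge_of_tendsto h1 ?_
  filter_upwards [hle, self_mem_nhdsWithin] with x hx1 hx2
  rw [slope_def_field]
  exact div_nonneg (sub_nonneg.2 hx1) (sub_nonneg.2 (le_of_lt hx2))

section

variable {ι : Type*} {a c : ι → ℝ} {ρ : ℝ}

lemma abs_le_exp_half (hρ : 0 < ρ) (y : ℝ) : |y| ≤ 2 / ρ * Real.exp (ρ / 2 * |y|) := by
  have h1 := Real.add_one_le_exp (ρ / 2 * |y|)
  rw [div_mul_eq_mul_div, le_div_iff₀ hρ]
  linarith

lemma summable_mul_exp_half (hρ : 0 < ρ) (h : Summable fun i => |a i| * Real.exp (ρ * |c i|)) :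
    Summable fun i => |a i * c i| * Real.exp (ρ / 2 * |c i|) := by
  refine Summable.of_nonneg_of_le (fun i => by positivity) (fun i => ?_) (h.mul_left (2 / ρ))
  rw [abs_mul]
  calc |a i| * |c i| * Real.exp (ρ / 2 * |c i|)
      ≤ |a i| * (2 / ρ * Real.exp (ρ / 2 * |c i|)) * Real.exp (ρ / 2 * |c i|) := by
        gcongr
        exact abs_le_exp_half hρ _
    _ = _ := by
        rw [show ρ * |c i| = ρ / 2 * |c i| + ρ / 2 * |c i| by ring, Real.exp_add]
        ring

lemma hasDerivAt_tsum_exp (hρ : 0 < ρ) (h : Summable fun i => |a i| * Real.exp (ρ * |c i|))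
    {s : ℝ} (hs : |s| < ρ / 2) : HasDerivAt (fun s => ∑' i, a i * Real.exp (c i * s))
      (∑' i, a i * c i * Real.exp (c i * s)) s := by
  refine hasDerivAt_tsum_of_isPreconnected (g := fun i y => a i * Real.exp (c i * y))
    (g' := fun i y => a i * c i * Real.exp (c i * y)) (t := Metric.ball (0 : ℝ) (ρ / 2)) (y₀ := 0)
    (summable_mul_exp_half hρ h) Metric.isOpen_ball (convex_ball _ _).isPreconnected
    (fun i y hy => ?_) (fun i y hy => ?_) (Metric.mem_ball_self (half_pos hρ)) ?_
    (by simpa using hs)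
  · have h1 : HasDerivAt (fun y : ℝ => c i * y) (c i) y := by
      simpa using (hasDerivAt_id y).const_mul (c i)
    refine (h1.exp.const_mul (a i)).congr_deriv ?_
    ring
  · rw [mem_ball_zero_iff, Real.norm_eq_abs] at hy
    rw [norm_mul, Real.norm_eq_abs, Real.norm_eq_abs, Real.abs_exp]
    refine mul_le_mul_of_nonneg_left (Real.exp_le_exp.2 ((le_abs_self _).trans ?_)) (abs_nonneg _)
    rw [abs_mul, mul_comm]
    exact mul_le_mul_of_nonneg_right hy.le (abs_nonneg _)
  · refine Summable.of_norm_bounded h fun i => ?_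
    rw [mul_zero, Real.exp_zero, mul_one, Real.norm_eq_abs]
    exact le_mul_of_one_le_right (abs_nonneg _) (Real.one_le_exp (by positivity))

end

/-! ### Positivity by the parabolic minimum principle -/

/-- The Gaussian weight `t ^ (-(n + 1)) exp (‖x‖² / 2t)`, a strict supersolution of the backward
heat equation. -/
def gaussianWeight (p : ℝ × E n) : ℝ :=
  Real.exp (‖p.2‖ ^ 2 / 2 * p.1⁻¹ - (n + 1) * Real.log p.1)

lemma gaussianWeight_pos (p : ℝ × E n) : 0 < gaussianWeight p := Real.exp_pos _

lemma hasDerivAt_gaussianWeight_time {t : ℝ} (ht : 0 < t) (x : E n) :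
    HasDerivAt (fun s => gaussianWeight (t + s, x))
      (gaussianWeight (t, x) * (-(‖x‖ ^ 2 / 2) / t ^ 2 - (n + 1) / t)) 0 := by
  have h0 : HasDerivAt (fun s : ℝ => t + s) 1 0 := (hasDerivAt_id _).const_add t
  have h1 : HasDerivAt (fun s : ℝ => ‖x‖ ^ 2 / 2 * (t + s)⁻¹ - (n + 1) * Real.log (t + s))
      (‖x‖ ^ 2 / 2 * (-1 / (t + 0) ^ 2) - (n + 1) * (1 / (t + 0))) 0 :=
    ((h0.inv (by simpa using ht.ne')).const_mul _).sub ((h0.log (by simpa using ht.ne')).const_mul _)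
  refine h1.exp.congr_deriv ?_
  simp only [gaussianWeight, add_zero]
  ring

lemma norm_add_smul_single_sq (x : E n) (i : Fin n) (s : ℝ) :
    ‖x + s • EuclideanSpace.single i (1 : ℝ)‖ ^ 2 = ‖x‖ ^ 2 + 2 * s * x i + s ^ 2 := by
  rw [norm_add_sq_real, norm_smul, real_inner_smul_right, EuclideanSpace.inner_single_right]
  simp
  ring

lemma hasDerivAt_gaussianWeight_space (t : ℝ) (x : E n) (i : Fin n) (s : ℝ) :
    HasDerivAt (fun s => gaussianWeight (t, x + s • EuclideanSpace.single i (1 : ℝ)))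
      (gaussianWeight (t, x + s • EuclideanSpace.single i (1 : ℝ)) * ((x i + s) / t)) s := by
  have h1 : HasDerivAt (fun s : ℝ => ‖x‖ ^ 2 + 2 * s * x i + s ^ 2) (2 * x i + 2 * s) s := by
    have := ((((hasDerivAt_id s).const_mul 2).mul_const (x i)).const_add (‖x‖ ^ 2)).add
      (hasDerivAt_pow 2 s)
    refine this.congr_deriv ?_
    simp
  have h2 := (((h1.div_const 2).mul_const t⁻¹).sub_const ((n + 1) * Real.log t)).exp
  simp only [gaussianWeight, norm_add_smul_single_sq]
  refine h2.congr_deriv ?_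
  ring

lemma hasDerivAt_gaussianWeight_space_space (t : ℝ) (x : E n) (i : Fin n) :
    HasDerivAt (fun s => gaussianWeight (t, x + s • EuclideanSpace.single i (1 : ℝ)) *
      ((x i + s) / t)) (gaussianWeight (t, x) * ((x i) ^ 2 / t ^ 2 + 1 / t)) 0 := by
  have h1 : HasDerivAt (fun s : ℝ => (x i + s) / t) (1 / t) 0 :=
    ((hasDerivAt_id _).const_add _).div_const t
  refine ((hasDerivAt_gaussianWeight_space t x i 0).mul h1).congr_deriv ?_
  simp
  ring

section

variable {Φ : Set (EDual n)} {α : Fin n → EDual n} {θ : EDual n} {ω : Fin n → E n}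

namespace IsAffineDatum

/-- The alternating sum of the exponential solutions `exp (⟪x, y⟫ - t ‖y‖² / 2)` of the backward
heat equation over the orbit of `b`. -/
def heatSum (h : IsAffineDatum Φ α θ ω) (b : E n) (p : ℝ × E n) : ℝ :=
  ∑' w, sgn w * Real.exp (inner ℝ p.2 (h.act w b) - p.1 * ‖h.act w b‖ ^ 2 / 2)

lemma thetaSum_eq_heatSum (h : IsAffineDatum Φ α θ ω) (b : E n) (t : ℝ) (x : E n) :
    thetaSum α θ b t x = Real.exp (t * ‖b‖ ^ 2 / 2) * h.heatSum b (t, x) := by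
  rw [thetaSum, heatSum, ← tsum_mul_left]
  refine tsum_congr fun w => ?_
  rw [h.thetaTerm_eq, mul_left_comm, ← Real.exp_add]
  congr 2
  ring

lemma continuousOn_heatSum (h : IsAffineDatum Φ α θ ω) (b : E n) :
    ContinuousOn (h.heatSum b) {p | 0 < p.1} := by
  rw [continuousOn_iff_continuous_domRestrict]
  have h1 : Continuous fun p : {p : ℝ × E n // 0 < p.1} =>
      Real.exp (-(p.1.1 * ‖b‖ ^ 2 / 2)) * h.thetaFamily.eval p b := by
    have h2 := h.thetaFamily.continuous_eval.comp (Continuous.prodMk_left b)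
    have h3 : Continuous fun p : {p : ℝ × E n // 0 < p.1} =>
      Real.exp (-(p.1.1 * ‖b‖ ^ 2 / 2)) := by fun_prop
    exact h3.mul h2
  refine h1.congr fun p => ?_
  rw [h.eval_thetaFamily, h.thetaSum_eq_heatSum, ← mul_assoc, ← Real.exp_add, neg_add_cancel,
    Real.exp_zero, one_mul]
  rfl

/-- The summands of `heatSum` are summable even after multiplication by exponentials which are
subordinate to the Gaussian decay. -/
lemma summable_heat_weight (h : IsAffineDatum Φ α θ ω) (b : E n) {t : ℝ} (x : E n) (K : ℝ) {κ : ℝ}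
    (hκ : κ < t / 2) : Summable fun w =>
      |sgn w * Real.exp (inner ℝ x (h.act w b) - t * ‖h.act w b‖ ^ 2 / 2)| *
        Real.exp (K * ‖h.act w b‖ + κ * ‖h.act w b‖ ^ 2) := by
  refine Summable.of_nonneg_of_le (fun w => by positivity) (fun w => ?_)
    (h.summable_exp_act b (‖x‖ + K) (sub_pos.2 hκ))
  rw [abs_mul, h.abs_sgn, one_mul, Real.abs_exp, ← Real.exp_add, Real.exp_le_exp]
  have := real_inner_le_norm x (h.act w b)
  linarith

/-- The series `heatSum` solves the backward heat equation, and no minimum of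
`heatSum + ε * gaussianWeight` can be attained at an interior point. -/
lemma not_isMin (h : IsAffineDatum Φ α θ ω) (b : E n) {ε : ℝ} (hε : 0 < ε) {t : ℝ} (ht : 0 < t)
    (x : E n) : ¬ ∀ᶠ q : ℝ × E n in 𝓝 (t, x), t ≤ q.1 →
      h.heatSum b (t, x) + ε * gaussianWeight (t, x) ≤ h.heatSum b q + ε * gaussianWeight q := by
  intro hmin
  set y := fun w => h.act w b
  set a := fun w => sgn w * Real.exp (inner ℝ x (y w) - t * ‖y w‖ ^ 2 / 2) with ha
  set φ := gaussianWeight (t, x) with hφ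
  -- the time derivative at the minimum is nonnegative
  have htime : 0 ≤ ∑' w, a w * (-‖y w‖ ^ 2 / 2) + ε * (φ * (-(‖x‖ ^ 2 / 2) / t ^ 2 - (n + 1) / t)) := by
    have hs : Summable fun w => |a w| * Real.exp (t / 2 * |-‖y w‖ ^ 2 / 2|) := by
      refine (h.summable_heat_weight b x 0 (show t / 4 < t / 2 by linarith)).congr fun w => ?_
      rw [abs_div, abs_neg, abs_of_nonneg (sq_nonneg ‖y w‖), abs_two, zero_mul, zero_add]
      congr 2
      ring
    have hd := (hasDerivAt_tsum_exp (half_pos ht) hs (s := 0) (by rw [abs_zero]; positivity)).add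
      ((hasDerivAt_gaussianWeight_time ht x).const_mul ε)
    simp only [mul_zero, Real.exp_zero, mul_one] at hd
    refine deriv_nonneg_of_eventually_le hd ?_
    have hu : ∀ s : ℝ, ∑' w, a w * Real.exp (-‖y w‖ ^ 2 / 2 * s) = h.heatSum b (t + s, x) :=
      fun s => tsum_congr fun w => by
        rw [ha, mul_assoc, ← Real.exp_add]
        congr 2
        ring
    have hcont : Tendsto (fun s : ℝ => (t + s, x)) (𝓝[>] 0) (𝓝 (t, x)) := by
      have : Continuous fun s : ℝ => (t + s, x) := by fun_prop
      have h2 := this.tendsto 0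
      rw [add_zero] at h2
      exact h2.mono_left nhdsWithin_le_nhds
    filter_upwards [hcont.eventually hmin, self_mem_nhdsWithin] with s hs1 (hs2 : 0 < s)
    simp only [Pi.add_apply, hu, add_zero]
    exact hs1 (by simpa using hs2.le)
  -- the second derivatives in space at the minimum are nonnegative
  have hspace : ∀ i, 0 ≤ ∑' w, a w * y w i * y w i + ε * (φ * ((x i) ^ 2 / t ^ 2 + 1 / t)) := by
    intro i
    have hs : Summable fun w => |a w| * Real.exp (1 * |y w i|) := by
      refine Summable.of_nonneg_of_le (fun w => by positivity) (fun w => ?_)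
        (h.summable_heat_weight b x 1 (half_pos ht))
      refine mul_le_mul_of_nonneg_left (Real.exp_le_exp.2 ?_) (abs_nonneg _)
      have := PiLp.norm_apply_le (y w) i
      rw [Real.norm_eq_abs] at this
      linarith
    have hs2 := summable_mul_exp_half one_pos hs
    have hu : ∀ s : ℝ, ∑' w, a w * Real.exp (y w i * s) =
        h.heatSum b (t, x + s • EuclideanSpace.single i (1 : ℝ)) :=
      fun s => tsum_congr fun w => by
        rw [ha, mul_assoc, ← Real.exp_add, inner_add_left, real_inner_smul_left,
          EuclideanSpace.inner_single_left]
        congr 2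
        simp
        ring
    have hd1 : ∀ᶠ s in 𝓝 (0 : ℝ), HasDerivAt (fun s => (∑' w, a w * Real.exp (y w i * s)) +
        ε * gaussianWeight (t, x + s • EuclideanSpace.single i (1 : ℝ)))
        ((∑' w, a w * y w i * Real.exp (y w i * s)) + ε * (gaussianWeight
          (t, x + s • EuclideanSpace.single i (1 : ℝ)) * ((x i + s) / t))) s := by
      filter_upwards [Metric.ball_mem_nhds (0 : ℝ) (show (0 : ℝ) < 1 / 2 by norm_num)] with s hsb
      rw [mem_ball_zero_iff, Real.norm_eq_abs] at hsb
      exact (hasDerivAt_tsum_exp one_pos hs hsb).add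
        ((hasDerivAt_gaussianWeight_space t x i s).const_mul ε)
    have hd2 := (hasDerivAt_tsum_exp (half_pos one_pos) hs2 (s := 0)
      (by rw [abs_zero]; positivity)).add ((hasDerivAt_gaussianWeight_space_space t x i).const_mul ε)
    simp only [mul_zero, Real.exp_zero, mul_one] at hd2
    refine IsLocalMin.second_deriv_nonneg ?_ hd1 hd2
    have hcont : Tendsto (fun s : ℝ => (t, x + s • EuclideanSpace.single i (1 : ℝ))) (𝓝 0)
        (𝓝 (t, x)) := by
      have : Continuous fun s : ℝ => (t, x + s • EuclideanSpace.single i (1 : ℝ)) := by fun_prop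
      have h2 := this.tendsto 0
      rwa [zero_smul, add_zero] at h2
    filter_upwards [hcont.eventually hmin] with s hs1
    simp only [hu, zero_smul, add_zero]
    exact hs1 le_rfl
  -- the series solves the backward heat equation, the weight is a strict supersolution
  have hsum : ∀ i, Summable fun w => a w * y w i * y w i := fun i => by
    have hs := h.summable_heat_weight b x 2 (half_pos ht)
    refine Summable.of_norm_bounded hs fun w => ?_
    rw [mul_assoc, norm_mul, Real.norm_eq_abs]
    refine mul_le_mul_of_nonneg_left ?_ (abs_nonneg _)
    have h1 := PiLp.norm_apply_le (y w) i
    have h2 := Real.add_one_le_exp ‖y w‖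
    have h3 : ‖y w i‖ ≤ Real.exp ‖y w‖ := by linarith
    rw [norm_mul, zero_mul, add_zero, two_mul, Real.exp_add]
    exact mul_le_mul h3 h3 (norm_nonneg _) (Real.exp_pos _).le
  have h1 : 0 ≤ ∑ i, (∑' w, a w * y w i * y w i + ε * (φ * ((x i) ^ 2 / t ^ 2 + 1 / t))) :=
    Finset.sum_nonneg fun i _ => hspace i
  have h2 : ∑ i, ∑' w, a w * y w i * y w i = -2 * ∑' w, a w * (-‖y w‖ ^ 2 / 2) := by
    rw [← Summable.tsum_finsetSum fun i _ => hsum i, ← tsum_mul_left]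
    refine tsum_congr fun w => ?_
    rw [EuclideanSpace.norm_sq_eq]
    simp only [mul_assoc, ← Finset.mul_sum, Real.norm_eq_abs, sq_abs, ← sq]
    ring
  have h3 : ∑ i, (x i) ^ 2 = ‖x‖ ^ 2 := by
    rw [EuclideanSpace.norm_sq_eq]
    simp
  rw [Finset.sum_add_distrib, h2, ← Finset.mul_sum, ← Finset.mul_sum, Finset.sum_add_distrib,
    ← Finset.sum_div, h3, Finset.sum_const, Finset.card_univ, Fintype.card_fin, nsmul_eq_mul] at h1
  have h4 : 0 < ε * φ * ((n + 2) / t) :=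
    mul_pos (mul_pos hε (gaussianWeight_pos _)) (by positivity)
  have h5 : ε * (φ * (‖x‖ ^ 2 / t ^ 2 + n * (1 / t))) +
      2 * (ε * (φ * (-(‖x‖ ^ 2 / 2) / t ^ 2 - (n + 1) / t))) = -(ε * φ * ((n + 2) / t)) := by
    field_simp
    ring
  linarith

/-- For large `t`, the negative terms of the series are negligible on the chamber. -/
lemma exists_heatSum_ge (h : IsAffineDatum Φ α θ ω) {b : E n}
    (hb : b ∈ openAlcove (posRoots Φ α)) : ∃ C δ : ℝ, 0 ≤ C ∧ 0 < δ ∧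
      ∀ p ∈ chamber (posRoots Φ α), 1 ≤ p.1 →
        -(C * Real.exp (‖p.2‖ ^ 2 / 2 * p.1⁻¹ - δ * p.1)) ≤ h.heatSum b p := by
  obtain ⟨δ, hδ, hdist⟩ := h.exists_dist_act hb
  set M := ∑ i, ‖ω i‖ with hM
  have hsC : Summable fun w => Real.exp (δ ^ 2 / 2 + M ^ 2 / 2) *
      Real.exp (0 * ‖h.act w b‖ - 1 / 4 * ‖h.act w b‖ ^ 2) :=
    (h.summable_exp_act b 0 (by norm_num)).mul_left _
  refine ⟨∑' w, Real.exp (δ ^ 2 / 2 + M ^ 2 / 2) *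
      Real.exp (0 * ‖h.act w b‖ - 1 / 4 * ‖h.act w b‖ ^ 2), δ ^ 2 / 2,
      tsum_nonneg fun _ => by positivity, by positivity, ?_⟩
  rintro ⟨t, x⟩ hp (ht : 1 ≤ t)
  have ht0 : 0 < t := by linarith
  set z := t⁻¹ • x with hz
  have hzx : x = t • z := by rw [hz, smul_smul, mul_inv_cancel₀ ht0.ne', one_smul]
  have hzA : z ∈ alcove (posRoots Φ α) 1 := fun β hβ => by
    have := hp.2 β hβ
    rw [hz, map_smul, smul_eq_mul]
    exact ⟨mul_nonneg (by positivity) this.1, by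
      rw [inv_mul_le_iff₀ ht0, mul_one]; exact this.2⟩
  have hzn : ‖z‖ ≤ M := by simpa using h.norm_le_of_mem_alcove hzA
  have hzn2 : ‖z‖ ^ 2 ≤ M ^ 2 := pow_le_pow_left₀ (norm_nonneg _) hzn 2
  have hsu : Summable fun w => sgn w *
      Real.exp (inner ℝ x (h.act w b) - t * ‖h.act w b‖ ^ 2 / 2) := by
    refine Summable.of_norm ((h.summable_heat_weight b x 0 (half_pos ht0)).congr fun w => ?_)
    simp
  rw [heatSum, ← tsum_mul_right, ← tsum_neg]
  refine Summable.tsum_le_tsum (fun w => ?_) (hsC.mul_right _).neg hsu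
  rcases h.sgn_eq w with e | e
  · rw [e, one_mul]
    exact (neg_nonpos.2 (by positivity)).trans (Real.exp_pos _).le
  · rw [e, neg_one_mul, neg_le_neg_iff, ← Real.exp_add, ← Real.exp_add, Real.exp_le_exp]
    have h1 := hdist w e z hzA
    set y := h.act w b
    have h2 : inner ℝ x y - t * ‖y‖ ^ 2 / 2 = ‖x‖ ^ 2 / 2 * t⁻¹ - t * ‖y - z‖ ^ 2 / 2 := by
      rw [norm_sub_sq_real, hzx, real_inner_smul_left, norm_smul, Real.norm_eq_abs, mul_pow, sq_abs,
        real_inner_comm y z]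
      field_simp
      ring
    have h3 : δ ^ 2 ≤ ‖y - z‖ ^ 2 := pow_le_pow_left₀ hδ.le h1 2
    have h4 : ‖y‖ ^ 2 ≤ 2 * ‖y - z‖ ^ 2 + 2 * ‖z‖ ^ 2 := by
      have h5 : ‖y‖ ≤ ‖y - z‖ + ‖z‖ := by simpa using norm_add_le (y - z) z
      nlinarith [sq_nonneg (‖y - z‖ - ‖z‖), norm_nonneg y]
    have h5 : (t - 1) * δ ^ 2 ≤ (t - 1) * ‖y - z‖ ^ 2 :=
      mul_le_mul_of_nonneg_left h3 (by linarith)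
    rw [h2]
    simp only
    nlinarith

lemma heatSum_nonneg (h : IsAffineDatum Φ α θ ω) {b : E n}
    (hb : b ∈ openAlcove (posRoots Φ α)) {p : ℝ × E n} (hp : p ∈ chamber (posRoots Φ α))
    (ht : 0 < p.1) : 0 ≤ h.heatSum b p := by
  obtain ⟨C, δ, hC, hδ, hbound⟩ := h.exists_heatSum_ge hb
  have key : ∀ ε > 0, 0 ≤ h.heatSum b p + ε * gaussianWeight p := by
    intro ε hε
    -- the last time `R` is so large that the sum is nonnegative there
    obtain ⟨R, hR1, hRp, hR⟩ : ∃ R : ℝ, 1 ≤ R ∧ p.1 ≤ R ∧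
        C * Real.exp (-δ * R) ≤ ε * Real.exp (-((n + 1) * Real.log R)) := by
      have h1 := (tendsto_rpow_mul_exp_neg_mul_atTop_nhds_zero (n + 1 : ℝ) δ hδ).const_mul C
      rw [mul_zero] at h1
      obtain ⟨R, ⟨h2, h3⟩, h4⟩ := ((eventually_ge_atTop 1).and (eventually_ge_atTop p.1)
        |>.and (h1.eventually (gt_mem_nhds hε))).exists
      refine ⟨R, h2, h3, ?_⟩
      rw [Real.exp_neg, ← div_eq_mul_inv, le_div_iff₀ (Real.exp_pos _)]
      rw [Real.rpow_def_of_pos (by linarith)] at h4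
      rw [mul_comm ((n : ℝ) + 1)]
      linarith
    set v : ℝ × E n → ℝ := fun q => h.heatSum b q + ε * gaussianWeight q with hv
    have hvc : ContinuousOn v {q | 0 < q.1} := by
      refine (h.continuousOn_heatSum b).add (continuousOn_const.mul ?_)
      refine ContinuousOn.rexp (ContinuousOn.sub ?_ (continuousOn_const.mul
        (continuousOn_fst.log fun q (hq : 0 < q.1) => hq.ne')))
      exact (Continuous.continuousOn (by fun_prop)).mul
        (continuousOn_fst.inv₀ fun q (hq : 0 < q.1) => hq.ne')
    obtain ⟨⟨t₀, x₀⟩, ⟨hp₀, ht₀, htR⟩, hmin⟩ := (h.isCompact_chamber p.1 R).exists_isMinOn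
      ⟨p, hp, le_rfl, hRp⟩ (hvc.mono fun q hq => ht.trans_le hq.2.1)
    refine le_trans ?_ (hmin ⟨hp, le_rfl, hRp⟩)
    by_contra! hneg
    have ht₀' : 0 < t₀ := ht.trans_le ht₀
    have hwall : ∀ i, nodeRoot α θ i x₀ ≠ t₀ * nodeLevel i := fun i hi => by
      have h1 := h.thetaSum_eq_zero_of_node hi b
      rw [h.thetaSum_eq_heatSum, mul_eq_zero, or_iff_right (Real.exp_pos _).ne'] at h1
      have h2 := gaussianWeight_pos (t₀, x₀)
      have h3 : v (t₀, x₀) = ε * gaussianWeight (t₀, x₀) := by rw [hv]; simp [h1]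
      rw [h3] at hneg
      nlinarith
    have htR' : t₀ < R := by
      refine lt_of_le_of_ne htR fun e => ?_
      have h1 := hbound (t₀, x₀) hp₀ (by rw [e]; exact hR1)
      have h2 : ε * gaussianWeight (t₀, x₀) = Real.exp (‖x₀‖ ^ 2 / 2 * t₀⁻¹) *
          (ε * Real.exp (-((n + 1) * Real.log R))) := by
        rw [gaussianWeight, sub_eq_add_neg, Real.exp_add, e]
        ring
      have h3 : C * Real.exp (‖x₀‖ ^ 2 / 2 * t₀⁻¹ - δ * t₀) = Real.exp (‖x₀‖ ^ 2 / 2 * t₀⁻¹) *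
          (C * Real.exp (-δ * R)) := by
        rw [sub_eq_add_neg, Real.exp_add, e, neg_mul]
        ring
      have h4 := mul_le_mul_of_nonneg_left hR (Real.exp_pos (‖x₀‖ ^ 2 / 2 * t₀⁻¹)).le
      have h5 : v (t₀, x₀) = h.heatSum b (t₀, x₀) + ε * gaussianWeight (t₀, x₀) := rfl
      simp only at h1
      linarith
    refine h.not_isMin b hε ht₀' x₀ ?_
    filter_upwards [h.eventually_mem_chamber hp₀ ht₀' hwall,
      (continuous_fst.tendsto (t₀, x₀)).eventually (gt_mem_nhds htR')] with q hq1 hq2 hq3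
    exact hmin ⟨hq1, ht₀.trans hq3, le_of_lt hq2⟩
  refine ge_of_tendsto (f := fun ε : ℝ => h.heatSum b p + ε * gaussianWeight p) (x := 𝓝[>] 0) ?_
    (by filter_upwards [self_mem_nhdsWithin] with ε hε using key ε hε)
  have : Continuous fun ε : ℝ => h.heatSum b p + ε * gaussianWeight p := by fun_prop
  have h2 := this.tendsto 0
  rw [zero_mul, add_zero] at h2
  exact h2.mono_left nhdsWithin_le_nhds

/-- The limit theta function inherits the sign of the theta functions of the nearby interior points
of the alcove. -/
lemma psi_nonneg (h : IsAffineDatum Φ α θ ω) {γ : E n} (hγ : γ ∈ alcove (posRoots Φ α) 1)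
    {p : ℝ × E n} (hp : p ∈ chamber (posRoots Φ α)) (ht : 0 < p.1) :
    0 ≤ psi (posRoots Φ α) α θ γ p.1 p.2 := by
  obtain ⟨b, hb⟩ := h.exists_mem_openAlcove
  refine ge_of_tendsto ((h.tendsto_psiHat hγ ht p.2).comp (h.tendsto_segment hγ hb)) ?_
  filter_upwards [Ioo_mem_nhdsGT one_pos] with s hs
  have hs' := add_smul_mem_openAlcove hγ hb hs.1 hs.2.le
  rw [Function.comp_apply, psiHat_eq, h.thetaSum_eq_heatSum]
  exact mul_nonneg (inv_nonneg.2 (h.sinProd_pos hs').le)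
    (mul_nonneg (Real.exp_pos _).le (h.heatSum_nonneg hs' hp ht))

end IsAffineDatum

end

/-! ### Optional stopping at an exit time -/

section Stopping

variable {Ω S : Type*}

open Classical in
/-- The time `q`, truncated at `t`, if the process is outside `C` at time `q`, and `t` otherwise. -/
def testTime (X : ℝ≥0 → Ω → S) (C : Set S) (t q : ℝ≥0) (ω : Ω) : ℝ≥0 :=
  if X q ω ∈ C then t else min q t

lemma testTime_of_mem {X : ℝ≥0 → Ω → S} {C : Set S} {t q : ℝ≥0} {ω : Ω} (h : X q ω ∈ C) :
    testTime X C t q ω = t := if_pos h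

lemma testTime_of_notMem {X : ℝ≥0 → Ω → S} {C : Set S} {t q : ℝ≥0} {ω : Ω} (h : X q ω ∉ C) :
    testTime X C t q ω = min q t := if_neg h

lemma testTime_le (X : ℝ≥0 → Ω → S) (C : Set S) (t q : ℝ≥0) (ω : Ω) : testTime X C t q ω ≤ t := by
  by_cases h : X q ω ∈ C
  · exact (testTime_of_mem h).le
  · exact (testTime_of_notMem h).trans_le (min_le_right _ _)

/-- The exit time from `C`, tested only at the first `N + 1` points of a dense sequence of times and
truncated at `t`. -/
def sampledExit (X : ℝ≥0 → Ω → S) (C : Set S) (t : ℝ≥0) (N : ℕ) (ω : Ω) : ℝ≥0 :=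
  (Finset.range (N + 1)).inf' Finset.nonempty_range_add_one fun j =>
    testTime X C t (TopologicalSpace.denseSeq ℝ≥0 j) ω

lemma sampledExit_le (X : ℝ≥0 → Ω → S) (C : Set S) (t : ℝ≥0) (N : ℕ) (ω : Ω) :
    sampledExit X C t N ω ≤ t := by
  exact (Finset.inf'_le _ (Finset.mem_range.2 N.succ_pos)).trans (testTime_le _ _ _ _ _)

lemma le_sampledExit {X : ℝ≥0 → Ω → S} {C : Set S} {t : ℝ≥0} {N : ℕ} {ω : Ω} {s : ℝ≥0} (hst : s ≤ t)
    (hs : ∀ u < s, X u ω ∈ C) : s ≤ sampledExit X C t N ω := by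
  refine Finset.le_inf' _ _ fun j _ => ?_
  by_cases h : X (TopologicalSpace.denseSeq ℝ≥0 j) ω ∈ C
  · rwa [testTime_of_mem h]
  · rw [testTime_of_notMem h]
    exact le_min (le_of_not_gt fun hlt => h (hs _ hlt)) hst

lemma sampledExit_le_of_notMem {X : ℝ≥0 → Ω → S} {C : Set S} {t : ℝ≥0} {N j : ℕ} {ω : Ω}
    (hj : j ≤ N) (h : X (TopologicalSpace.denseSeq ℝ≥0 j) ω ∉ C) :
    sampledExit X C t N ω ≤ TopologicalSpace.denseSeq ℝ≥0 j := by
  refine (Finset.inf'_le _ (Finset.mem_range.2 (Nat.lt_succ_of_le hj))).trans ?_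
  rw [testTime_of_notMem h]
  exact min_le_left _ _

lemma countable_range_sampledExit (X : ℝ≥0 → Ω → S) (C : Set S) (t : ℝ≥0) (N : ℕ) :
    (Set.range fun ω => (sampledExit X C t N ω : WithTop ℝ≥0)).Countable := by
  have h : Set.range (fun ω => (sampledExit X C t N ω : WithTop ℝ≥0)) ⊆
      (fun s : ℝ≥0 => (s : WithTop ℝ≥0)) '' ({t} ∪
        Set.range fun j => min (TopologicalSpace.denseSeq ℝ≥0 j) t) := by
    rintro _ ⟨ω, rfl⟩
    refine ⟨_, ?_, rfl⟩
    obtain ⟨j, -, hj⟩ := Finset.exists_mem_eq_inf' (s := Finset.range (N + 1))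
      Finset.nonempty_range_add_one fun j => testTime X C t (TopologicalSpace.denseSeq ℝ≥0 j) ω
    have hj' : sampledExit X C t N ω = testTime X C t (TopologicalSpace.denseSeq ℝ≥0 j) ω := hj
    rw [hj']
    by_cases h : X (TopologicalSpace.denseSeq ℝ≥0 j) ω ∈ C
    · exact Or.inl (testTime_of_mem h)
    · exact Or.inr ⟨j, (testTime_of_notMem h).symm⟩
  exact (((Set.countable_singleton t).union (Set.countable_range _)).image _).mono h

lemma isStoppingTime_sampledExit {m : MeasurableSpace Ω} {ℱ : Filtration ℝ≥0 m}
    {X : ℝ≥0 → Ω → S} {C : Set S} (hX : ∀ s, MeasurableSet[ℱ s] {ω | X s ω ∈ C}) (t : ℝ≥0) (N : ℕ) :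
    IsStoppingTime ℱ fun ω => (sampledExit X C t N ω : WithTop ℝ≥0) := by
  intro i
  have h : {ω | (sampledExit X C t N ω : WithTop ℝ≥0) ≤ i} =
      ⋃ j ∈ Finset.range (N + 1),
        {ω | testTime X C t (TopologicalSpace.denseSeq ℝ≥0 j) ω ≤ i} := by
    ext ω
    rw [Set.mem_ofPred_eq, WithTop.coe_le_coe, sampledExit, Finset.inf'_le_iff]
    simp
  rw [h]
  refine Finset.measurableSet_biUnion _ fun j _ => ?_
  set q := TopologicalSpace.denseSeq ℝ≥0 j
  by_cases ht : t ≤ i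
  · rw [Set.eq_univ_of_forall (s := {ω | testTime X C t q ω ≤ i}) fun ω =>
      (testTime_le X C t q ω).trans ht]
    exact @MeasurableSet.univ _ (ℱ i)
  by_cases hq : q ≤ i
  · have h1 : {ω | testTime X C t q ω ≤ i} = {ω | X q ω ∈ C}ᶜ := by
      ext ω
      by_cases hω : X q ω ∈ C
      · simpa [hω, testTime_of_mem hω] using ht
      · simp [hω, testTime_of_notMem hω, hq]
    rw [h1]
    exact (ℱ.mono hq _ (hX q)).compl
  · have h1 : {ω | testTime X C t q ω ≤ i} = ∅ := by
      ext ω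
      by_cases hω : X q ω ∈ C
      · simpa [testTime_of_mem hω] using ht
      · simpa [testTime_of_notMem hω, min_le_iff] using And.intro hq ht
    rw [h1]
    exact @MeasurableSet.empty _ (ℱ i)

/-- The exit time truncated at `t`. -/
def truncExit (X : ℝ≥0 → Ω → S) (C : Set S) (t : ℝ≥0) (ω : Ω) : ℝ≥0 :=
  (min (t : WithTop ℝ≥0) (exitTime X C ω)).untopA

lemma coe_truncExit (X : ℝ≥0 → Ω → S) (C : Set S) (t : ℝ≥0) (ω : Ω) :
    (truncExit X C t ω : WithTop ℝ≥0) = min (t : WithTop ℝ≥0) (exitTime X C ω) := by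
  obtain ⟨s, hs⟩ := WithTop.ne_top_iff_exists.1
    ((min_le_left (t : WithTop ℝ≥0) (exitTime X C ω)).trans_lt (WithTop.coe_lt_top t)).ne
  rw [truncExit, ← hs]
  rfl

lemma truncExit_le (X : ℝ≥0 → Ω → S) (C : Set S) (t : ℝ≥0) (ω : Ω) : truncExit X C t ω ≤ t := by
  rw [← WithTop.coe_le_coe, coe_truncExit]
  exact min_le_left _ _

lemma mem_of_lt_truncExit {X : ℝ≥0 → Ω → S} {C : Set S} {t : ℝ≥0} {ω : Ω} {s : ℝ≥0}
    (hs : s < truncExit X C t ω) : X s ω ∈ C := by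
  rw [← WithTop.coe_lt_coe, coe_truncExit] at hs
  by_contra h
  exact notMem_of_lt_hittingAfter (hs.trans_le (min_le_right _ _)) (zero_le) h

/-- As the complement of `C` is open, a continuous path which leaves `C` is outside `C` at some sampled
time shortly after the exit time. -/
lemma tendsto_sampledExit [TopologicalSpace S] {X : ℝ≥0 → Ω → S} {C : Set S} (hC : IsClosed C)
    (t : ℝ≥0) {ω : Ω} (hω : Continuous fun s => X s ω) :
    Tendsto (fun N => sampledExit X C t N ω) atTop (𝓝 (truncExit X C t ω)) := by
  have hle : ∀ N, truncExit X C t ω ≤ sampledExit X C t N ω := fun N =>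
    le_sampledExit (truncExit_le X C t ω) fun u hu => mem_of_lt_truncExit hu
  refine tendsto_order.2 ⟨fun a ha => Eventually.of_forall fun N => ha.trans_le (hle N),
    fun a ha => ?_⟩
  rcases (truncExit_le X C t ω).eq_or_lt with he | hlt
  · exact Eventually.of_forall fun N => (sampledExit_le X C t N ω).trans_lt (he ▸ ha)
  · have hexit : exitTime X C ω < (min a t : ℝ≥0) := by
      have h1 := coe_truncExit X C t ω
      rcases min_choice (t : WithTop ℝ≥0) (exitTime X C ω) with h2 | h2
      · rw [h2, WithTop.coe_inj] at h1
        exact absurd h1 hlt.ne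
      · rw [← h2, ← h1, WithTop.coe_lt_coe]
        exact lt_min ha hlt
    obtain ⟨u, ⟨-, hu⟩, hu'⟩ := hittingAfter_lt_iff.1 hexit
    have hopen : IsOpen {s : ℝ≥0 | s < min a t ∧ X s ω ∉ C} :=
      (isOpen_lt continuous_id continuous_const).inter (hC.isOpen_compl.preimage hω)
    obtain ⟨j, hs⟩ := (TopologicalSpace.denseRange_denseSeq ℝ≥0).exists_mem_open hopen
      ⟨u, hu, hu'⟩
    filter_upwards [eventually_ge_atTop j] with N hN
    exact (sampledExit_le_of_notMem hN hs.2).trans_lt (hs.1.trans_le (min_le_left _ _))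

lemma mem_of_truncExit [TopologicalSpace S] {X : ℝ≥0 → Ω → S} {C : Set S} (hC : IsClosed C)
    (t : ℝ≥0) {ω : Ω} (hω : Continuous fun s => X s ω) (h0 : X 0 ω ∈ C) :
    X (truncExit X C t ω) ω ∈ C := by
  rcases eq_zero_or_pos (truncExit X C t ω) with he | hpos
  · rwa [he]
  · have hne : (𝓝[<] truncExit X C t ω).NeBot := nhdsLT_neBot_of_exists_lt ⟨0, hpos⟩
    refine hC.mem_of_tendsto ((hω.tendsto _).mono_left
      (nhdsWithin_le_nhds (s := Set.Iio (truncExit X C t ω)))) ?_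
    filter_upwards [self_mem_nhdsWithin] with s hs
    exact mem_of_lt_truncExit hs

/-- Optional stopping: the values of a continuous martingale at the sampled exit times are uniformly
integrable, as conditional expectations of its value at time `t`, so that one can pass to the limit.
-/
lemma integral_martingale_truncExit [TopologicalSpace S] {m : MeasurableSpace Ω} {P : Measure Ω}
    [IsProbabilityMeasure P] {ℱ : Filtration ℝ≥0 m} {M : ℝ≥0 → Ω → ℝ} (hM : Martingale M ℱ P)
    {X : ℝ≥0 → Ω → S} {C : Set S} (hC : IsClosed C) (hX : ∀ s, MeasurableSet[ℱ s] {ω | X s ω ∈ C})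
    (hcont : ∀ᵐ ω ∂P, Continuous (fun s => X s ω) ∧ Continuous fun s => M s ω) (t : ℝ≥0) :
    Integrable (fun ω => M (truncExit X C t ω) ω) P ∧
      ∫ ω, M (truncExit X C t ω) ω ∂P = ∫ ω, M t ω ∂P := by
  have hst := fun N => isStoppingTime_sampledExit hX t N
  have hle : ∀ N ω, (sampledExit X C t N ω : WithTop ℝ≥0) ≤ t := fun N ω =>
    WithTop.coe_le_coe.2 (sampledExit_le X C t N ω)
  have hcond : ∀ N, (fun ω => M (sampledExit X C t N ω) ω) =ᵐ[P] P[M t | (hst N).measurableSpace] :=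
    fun N => by
      have := hM.stoppedValue_ae_eq_condExp_of_le_const_of_countable_range (hst N) (hle N)
        (countable_range_sampledExit X C t N)
      exact this
  have hUI : UniformIntegrable (fun N ω => M (sampledExit X C t N ω) ω) 1 P :=
    ((hM.integrable t).uniformIntegrable_condExp fun N => (hst N).measurableSpace_le).ae_eq
      fun N => (hcond N).symm
  have hlim : ∀ᵐ ω ∂P, Tendsto (fun N => M (sampledExit X C t N ω) ω) atTop
      (𝓝 (M (truncExit X C t ω) ω)) := by
    filter_upwards [hcont] with ω hω
    exact (hω.2.tendsto _).comp (tendsto_sampledExit hC t hω.1)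
  have hint := hUI.integrable_of_ae_tendsto hlim
  refine ⟨hint, ?_⟩
  have hL1 := tendsto_Lp_finite_of_tendsto_ae le_rfl ENNReal.one_ne_top hUI.1
    (memLp_one_iff_integrable.2 hint) hUI.2.1 hlim
  have hto := tendsto_integral_of_L1' _ hint.1 (Eventually.of_forall fun N =>
    memLp_one_iff_integrable.1 (hUI.memLp N)) hL1
  refine tendsto_nhds_unique hto (tendsto_const_nhds.congr fun N => ?_)
  rw [integral_congr_ae (hcond N), integral_condExp]

end Stopping

/-! ### Exponential martingales of Brownian motion -/

section Brownian

lemma iIndepFun_bool {Ω : Type*} {β : Bool → Type*} [∀ c, MeasurableSpace (β c)]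
    [MeasurableSpace Ω] {P : Measure Ω} [IsProbabilityMeasure P] {f : ∀ c, Ω → β c}
    (h : IndepFun (f true) (f false) P) : iIndepFun f P := by
  have hT : ∀ T : Finset Bool, T = ∅ ∨ T = {true} ∨ T = {false} ∨ T = {true, false} := by
    decide
  rw [iIndepFun_iff_measure_inter_preimage_eq_mul]
  intro T sets hsets
  rcases hT T with rfl | rfl | rfl | rfl
  · simp
  · simp
  · simp
  · rw [Finset.prod_pair (by decide), Finset.set_biInter_insert, Finset.set_biInter_singleton]
    exact h.measure_inter_preimage_eq_mul _ _ (hsets true (by simp)) (hsets false (by simp))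

variable {Ω : Type*} [MeasurableSpace Ω] {P : Measure Ω} {b : ℝ≥0 → Ω → E n}

namespace IsStandardBrownian

/-- The filtration generated by the Brownian motion. -/
def filtration (hb : IsStandardBrownian P b) : Filtration ℝ≥0 ‹MeasurableSpace Ω› :=
  Filtration.natural b fun t => (hb.measurable t).stronglyMeasurable

lemma measurable_filtration (hb : IsStandardBrownian P b) (t : ℝ≥0) :
    Measurable[hb.filtration t] (b t) := by
  have h1 : MeasurableSpace.comap (b t) inferInstance ≤ hb.filtration t :=
    le_iSup₂_of_le (f := fun j (_ : j ≤ t) => MeasurableSpace.comap (b j) _) t le_rfl le_rfl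
  exact measurable_iff_comap_le.2 h1

lemma measurable_coord (hb : IsStandardBrownian P b) (t : ℝ≥0) (i : Fin n) :
    Measurable fun ω => b t ω i :=
  (EuclideanSpace.proj (𝕜 := ℝ) i).continuous.measurable.comp (hb.measurable t)

/-- The increments after time `s` are independent of the past of `s`, for the whole vector. -/
lemma indepFun_increment [IsProbabilityMeasure P] (hb : IsStandardBrownian P b) {s t : ℝ≥0} (hst : s ≤ t) :
    IndepFun (fun ω => b t ω - b s ω) (fun ω (u : Set.Iic s) => b u ω) P := by
  -- the pair of the increments (`true`) and the stopped path (`false`) of each coordinate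
  set X : Fin n → Bool → Ω → (ℝ≥0 → ℝ) := fun i c ω u =>
    if c then b (s + u) ω i - b s ω i else b (min u s) ω i with hXdef
  have hX : ∀ i c, Measurable (X i c) := fun i c => by
    refine measurable_pi_lambda _ fun u => ?_
    have h1 := hb.measurable_coord
    cases c
    · exact h1 _ i
    · exact (h1 _ i).sub (h1 _ i)
  have h1 : iIndepFun (fun i ω => fun c => X i c ω) P := by
    refine hb.indep.comp (fun _ path (c : Bool) u => if c then path (s + u) - path s else path (min u s))
      fun i => ?_
    refine measurable_pi_lambda _ fun c => measurable_pi_lambda _ fun u => ?_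
    cases c
    · exact measurable_pi_apply _
    · exact (measurable_pi_apply _).sub (measurable_pi_apply _)
  have h2 : ∀ i, iIndepFun (X i) P := fun i => by
    have h3 := (hb.brownian i).toIsPreBrownianReal.indepFun_shift s
    have h4 : IndepFun (X i true) (X i false) P := by
      refine h3.comp (φ := id) (ψ := fun path u => path ⟨min u s, show min u s ≤ s from min_le_right _ _⟩) measurable_id ?_
      exact measurable_pi_lambda _ fun u => measurable_pi_apply _
    exact iIndepFun_bool h4
  have h3 := iIndepFun_uncurry' hX h1 h2
  set T : Finset (Fin n × Bool) := Finset.univ ×ˢ {true}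
  set F : Finset (Fin n × Bool) := Finset.univ ×ˢ {false}
  have h4 := h3.indepFun_finset T F (by
    rw [Finset.disjoint_left]
    rintro ⟨i, c⟩ h5 h6
    simp [T, F] at h5 h6
    simp [h5] at h6) fun p => hX p.1 p.2
  have hφ : Measurable fun y : T → (ℝ≥0 → ℝ) =>
      (WithLp.toLp 2 fun i : Fin n => y ⟨(i, true), by simp [T]⟩ (t - s) : E n) := by
    refine (WithLp.measurable_toLp 2 _).comp (measurable_pi_lambda _ fun i => ?_)
    exact (measurable_pi_apply _).comp (measurable_pi_apply _)
  have hψ : Measurable fun (y : F → (ℝ≥0 → ℝ)) (u : Set.Iic s) =>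
      (WithLp.toLp 2 fun i : Fin n => y ⟨(i, false), by simp [F]⟩ u : E n) := by
    refine measurable_pi_lambda _ fun u => (WithLp.measurable_toLp 2 _).comp
      (measurable_pi_lambda _ fun i => ?_)
    exact (measurable_pi_apply _).comp (measurable_pi_apply _)
  convert h4.comp hφ hψ using 1
  · ext ω i
    simp [hXdef, add_tsub_cancel_of_le hst]
  · ext ω u i
    have : min (u : ℝ≥0) s = u := min_eq_left u.2
    simp [hXdef, this]

lemma mgf_increment (hb : IsStandardBrownian P b) (η : E n) {s t : ℝ≥0} (hst : s ≤ t) :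
    ∫ ω, Real.exp (inner ℝ η (b t ω - b s ω)) ∂P =
      Real.exp (((t : ℝ) - s) * ‖η‖ ^ 2 / 2) := by
  have h1 : iIndepFun (fun (i : Fin n) ω => η i * (b t ω i - b s ω i)) P :=
    hb.indep.comp (fun i path => η i * (path t - path s)) fun i => by fun_prop
  have h2 := h1.mgf_sum (t := 1) (fun i => ((hb.measurable_coord t i).sub
    (hb.measurable_coord s i)).const_mul _) Finset.univ
  have h3 : ∀ i, mgf (fun ω => η i * (b t ω i - b s ω i)) P 1 =
      Real.exp (((t : ℝ) - s) * (η i) ^ 2 / 2) := fun i => by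
    have h4 := (hb.brownian i).toIsPreBrownianReal.hasLaw_sub t s
    have h5 : ((nndist (t : ℝ) s : ℝ≥0) : ℝ) = t - s := by
      rw [coe_nndist, Real.dist_eq, abs_of_nonneg (sub_nonneg.2 (NNReal.coe_le_coe.2 hst))]
    have h6 := mgf_gaussianReal h4.map_eq (η i)
    rw [zero_mul, zero_add] at h6
    change _ = Real.exp (((nndist (t : ℝ) s : ℝ≥0) : ℝ) * _ / 2) at h6
    rw [h5] at h6
    rw [mgf_const_mul, mul_one]
    exact h6
  rw [Finset.prod_congr rfl fun i _ => h3 i, ← Real.exp_sum, ← Finset.sum_div, ← Finset.mul_sum]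
    at h2
  rw [EuclideanSpace.norm_sq_eq]
  simp only [Real.norm_eq_abs, sq_abs]
  rw [← h2, mgf]
  refine integral_congr_ae (ae_of_all _ fun ω => ?_)
  simp only [one_mul, Finset.sum_apply, PiLp.inner_apply, PiLp.sub_apply]
  congr 1
  refine Finset.sum_congr rfl fun i _ => ?_
  simp [mul_comm]

lemma integrable_exp_increment (hb : IsStandardBrownian P b) (η : E n) {s t : ℝ≥0} (hst : s ≤ t) :
    Integrable (fun ω => Real.exp (inner ℝ η (b t ω - b s ω))) P := by
  by_contra h
  have h1 := hb.mgf_increment η hst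
  rw [integral_undef h] at h1
  exact (Real.exp_pos _).ne h1

lemma ae_zero (hb : IsStandardBrownian P b) : ∀ᵐ ω ∂P, b 0 ω = 0 := by
  have h1 : ∀ᵐ ω ∂P, ∀ i, b 0 ω i = 0 := ae_all_iff.2 fun i =>
    (hb.brownian i).toIsPreBrownianReal.eval_zero_ae_eq_zero
  filter_upwards [h1] with ω hω
  ext i
  simp [hω i]

lemma ae_continuous (hb : IsStandardBrownian P b) : ∀ᵐ ω ∂P, Continuous fun t => b t ω := by
  have h1 : ∀ᵐ ω ∂P, ∀ i, Continuous fun t => b t ω i := ae_all_iff.2 fun i => (hb.brownian i).cont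
  filter_upwards [h1] with ω hω
  exact (PiLp.continuous_toLp 2 _).comp (continuous_pi hω)

/-- The exponential martingale `exp (⟪η, b_t⟫ - t ‖η‖² / 2)`. -/
def expMartingale (b : ℝ≥0 → Ω → E n) (η : E n) (t : ℝ≥0) (ω : Ω) : ℝ :=
  Real.exp (inner ℝ η (b t ω) - (t : ℝ) * ‖η‖ ^ 2 / 2)

lemma integrable_expMartingale [IsProbabilityMeasure P] (hb : IsStandardBrownian P b) (η : E n)
    (t : ℝ≥0) : Integrable (expMartingale b η t) P := by
  refine ((hb.integrable_exp_increment η (zero_le : (0 : ℝ≥0) ≤ t)).mul_const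
    (Real.exp (-((t : ℝ) * ‖η‖ ^ 2 / 2)))).congr ?_
  filter_upwards [hb.ae_zero] with ω hω
  rw [hω, sub_zero, ← Real.exp_add, ← sub_eq_add_neg, expMartingale]

lemma martingale_expMartingale [IsProbabilityMeasure P] (hb : IsStandardBrownian P b) (η : E n) :
    Martingale (expMartingale b η) hb.filtration P := by
  have hadapt : ∀ t, StronglyMeasurable[hb.filtration t] (expMartingale b η t) := fun t => by
    have h1 : Measurable fun y : E n => Real.exp (inner ℝ η y - (t : ℝ) * ‖η‖ ^ 2 / 2) := by
      fun_prop
    exact (h1.comp (hb.measurable_filtration t)).stronglyMeasurable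
  refine ⟨hadapt, fun s t hst => ?_⟩
  set V : Ω → ℝ := fun ω => Real.exp (inner ℝ η (b t ω - b s ω) - ((t : ℝ) - s) * ‖η‖ ^ 2 / 2)
  have hV : ∀ ω, V ω = Real.exp (inner ℝ η (b t ω - b s ω)) *
      Real.exp (-(((t : ℝ) - s) * ‖η‖ ^ 2 / 2)) := fun ω => by
    rw [← Real.exp_add, ← sub_eq_add_neg]
  have hVint : Integrable V P := ((hb.integrable_exp_increment η hst).mul_const _).congr
    (ae_of_all _ fun ω => (hV ω).symm)
  have hV1 : ∫ ω, V ω ∂P = 1 := by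
    simp_rw [hV]
    rw [integral_mul_const, hb.mgf_increment η hst, ← Real.exp_add, add_neg_cancel, Real.exp_zero]
  have hprod : expMartingale b η t = expMartingale b η s * V := by
    ext ω
    rw [Pi.mul_apply, expMartingale, expMartingale, ← Real.exp_add, inner_sub_right]
    congr 1
    ring
  have hcond : P[V | hb.filtration s] =ᵐ[P] fun _ => ∫ ω, V ω ∂P := by
    have hmeas : Measurable fun ω => b t ω - b s ω := (hb.measurable t).sub (hb.measurable s)
    refine condExp_indep_eq (m₁ := MeasurableSpace.comap (fun ω => b t ω - b s ω) inferInstance)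
      hmeas.comap_le (hb.filtration.le s) ?_ ?_
    · have h1 : Measurable fun y : E n => Real.exp (inner ℝ η y - ((t : ℝ) - s) * ‖η‖ ^ 2 / 2) := by
        fun_prop
      exact (h1.comp (comap_measurable _)).stronglyMeasurable
    · rw [filtration, Filtration.natural_eq_comap]
      exact (IndepFun_iff_Indep _ _ _).1 (hb.indepFun_increment hst)
  rw [hprod]
  refine (condExp_mul_of_stronglyMeasurable_left (hadapt s)
    (hprod ▸ hb.integrable_expMartingale η t) hVint).trans ?_
  filter_upwards [hcond] with ω hω
  rw [Pi.mul_apply, hω, hV1, mul_one]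

lemma integral_expMartingale [IsProbabilityMeasure P] (hb : IsStandardBrownian P b) (η : E n)
    (t : ℝ≥0) : ∫ ω, expMartingale b η t ω ∂P = 1 := by
  have h1 := hb.mgf_increment η (zero_le : (0 : ℝ≥0) ≤ t)
  have h2 : ∀ᵐ ω ∂P, expMartingale b η t ω = Real.exp (inner ℝ η (b t ω - b 0 ω)) *
      Real.exp (-((t : ℝ) * ‖η‖ ^ 2 / 2)) := by
    filter_upwards [hb.ae_zero] with ω hω
    rw [hω, sub_zero, ← Real.exp_add, ← sub_eq_add_neg, expMartingale]
  rw [integral_congr_ae h2, integral_mul_const, h1, ← Real.exp_add, NNReal.coe_zero, sub_zero,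
    add_neg_cancel, Real.exp_zero]

/-- The exponential solutions `exp (⟪y - γ, x⟫ + t (‖γ‖² - ‖y‖²) / 2)` are harmonic for the
space-time Brownian motion with drift `γ` stopped at the exit time of a closed set. -/
lemma integral_exp_killed [IsProbabilityMeasure P] (hb : IsStandardBrownian P b) (γ y : E n)
    {C : Set (ℝ × E n)} (hC : IsClosed C) (p : ℝ × E n) (t : ℝ≥0) :
    Integrable (fun ω => Real.exp (inner ℝ (y - γ) (killed b γ C p t ω).2 +
        (killed b γ C p t ω).1 * (‖γ‖ ^ 2 - ‖y‖ ^ 2) / 2)) P ∧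
      ∫ ω, Real.exp (inner ℝ (y - γ) (killed b γ C p t ω).2 +
        (killed b γ C p t ω).1 * (‖γ‖ ^ 2 - ‖y‖ ^ 2) / 2) ∂P =
      Real.exp (inner ℝ (y - γ) p.2 + p.1 * (‖γ‖ ^ 2 - ‖y‖ ^ 2) / 2) := by
  set τ := truncExit (spaceTime b γ p) C t
  have hval : ∀ ω, Real.exp (inner ℝ (y - γ) (killed b γ C p t ω).2 +
      (killed b γ C p t ω).1 * (‖γ‖ ^ 2 - ‖y‖ ^ 2) / 2) =
      Real.exp (inner ℝ (y - γ) p.2 + p.1 * (‖γ‖ ^ 2 - ‖y‖ ^ 2) / 2) *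
        expMartingale b (y - γ) (τ ω) ω := fun ω => by
    have h1 : killed b γ C p t ω = spaceTime b γ p (τ ω) ω := rfl
    rw [h1, expMartingale, ← Real.exp_add, spaceTime]
    congr 1
    simp only [inner_add_right, real_inner_smul_right]
    rw [norm_sub_sq_real, inner_sub_left y γ γ, real_inner_self_eq_norm_sq]
    ring
  have hopt := integral_martingale_truncExit (hb.martingale_expMartingale (y - γ)) hC
    (X := spaceTime b γ p) (fun s => ?_) ?_ t
  · simp_rw [hval]
    refine ⟨hopt.1.const_mul _, ?_⟩
    rw [integral_const_mul, hopt.2, hb.integral_expMartingale, mul_one]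
  · have h1 : Measurable fun z : E n => ((p.1 + s, p.2 + z + (s : ℝ) • γ) : ℝ × E n) := by fun_prop
    exact (h1.comp (hb.measurable_filtration s)) hC.measurableSet
  · filter_upwards [hb.ae_continuous] with ω hω
    refine ⟨?_, ?_⟩
    · unfold spaceTime
      fun_prop
    · unfold expMartingale
      fun_prop

/-- Almost surely the killed process stays in a compact part of a closed set. -/
lemma ae_killed_mem (hb : IsStandardBrownian P b) (γ : E n) {C : Set (ℝ × E n)} (hC : IsClosed C)
    {p : ℝ × E n} (hp : p ∈ C) (t : ℝ≥0) : ∀ᵐ ω ∂P, killed b γ C p t ω ∈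
      C ∩ {q | p.1 ≤ q.1 ∧ q.1 ≤ p.1 + t} := by
  filter_upwards [hb.ae_continuous, hb.ae_zero] with ω hω h0
  have h1 : killed b γ C p t ω =
    spaceTime b γ p (truncExit (spaceTime b γ p) C t ω) ω := rfl
  have h2 := truncExit_le (spaceTime b γ p) C t ω
  refine ⟨?_, ?_, ?_⟩
  · rw [h1]
    refine mem_of_truncExit hC t ?_ ?_
    · unfold spaceTime
      fun_prop
    · simpa [spaceTime, h0] using hp
  · rw [h1, spaceTime]
    simp
  · rw [h1, spaceTime]
    simpa using h2

end IsStandardBrownian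

end Brownian

/-! ### Harmonicity -/

section

variable {Φ : Set (EDual n)} {α : Fin n → EDual n} {θ : EDual n} {ω : Fin n → E n}
  {Ω : Type*} [MeasurableSpace Ω] {P : Measure Ω} {B : ℝ≥0 → Ω → E n}

/-- The exponential factor which turns `psiHat` for the parameter `b` into a harmonic function for
the Brownian motion with drift `γ`; for `b = γ` it is the factor in the definition of `Psi`. -/
def driftWeight (γ b : E n) (q : ℝ × E n) : ℝ :=
  Real.exp (-inner ℝ γ q.2 + q.1 * (‖γ‖ ^ 2 - ‖b‖ ^ 2) / 2)

lemma continuous_driftWeight (γ : E n) :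
    Continuous fun z : (ℝ × E n) × E n => driftWeight γ z.2 z.1 := by
  unfold driftWeight
  fun_prop

namespace IsAffineDatum

lemma driftWeight_mul_thetaTerm (h : IsAffineDatum Φ α θ ω) (γ b : E n) (q : ℝ × E n)
    (w : affineWeylGroup α θ) : driftWeight γ b q * thetaTerm b q.1 q.2 w =
      sgn w * Real.exp (inner ℝ (h.act w b - γ) q.2 +
        q.1 * (‖γ‖ ^ 2 - ‖h.act w b‖ ^ 2) / 2) := by
  rw [h.thetaTerm_eq, driftWeight, mul_left_comm, ← Real.exp_add, inner_sub_left,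
    real_inner_comm q.2 (h.act w b)]
  congr 2
  ring

/-- For an arbitrary parameter `b` the theta function is a superposition of exponential solutions,
hence harmonic. -/
lemma integral_psiHat_killed (h : IsAffineDatum Φ α θ ω) [IsProbabilityMeasure P]
    (hB : IsStandardBrownian P B) (γ b : E n) (Φp : Set (EDual n)) {C : Set (ℝ × E n)}
    (hC : IsClosed C) {p : ℝ × E n} (hp : 0 < p.1) (t : ℝ≥0) :
    AEStronglyMeasurable (fun ξ => driftWeight γ b (killed B γ C p t ξ) *
        psiHat Φp α θ b (killed B γ C p t ξ).1 (killed B γ C p t ξ).2) P ∧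
      ∫ ξ, driftWeight γ b (killed B γ C p t ξ) *
        psiHat Φp α θ b (killed B γ C p t ξ).1 (killed B γ C p t ξ).2 ∂P =
      driftWeight γ b p * psiHat Φp α θ b p.1 p.2 := by
  have := h.countable
  set e : affineWeylGroup α θ → ℝ × E n → ℝ := fun w q => sgn w *
    Real.exp (inner ℝ (h.act w b - γ) q.2 + q.1 * (‖γ‖ ^ 2 - ‖h.act w b‖ ^ 2) / 2)
  have he : ∀ q : ℝ × E n, driftWeight γ b q * psiHat Φp α θ b q.1 q.2 =
      (sinProd Φp b)⁻¹ * ∑' w, e w q := fun q => by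
    rw [psiHat, mul_left_comm, ← tsum_mul_left]
    simp_rw [h.driftWeight_mul_thetaTerm γ b q]
    rfl
  have habs : ∀ w q, ‖e w q‖ = Real.exp (inner ℝ (h.act w b - γ) q.2 +
      q.1 * (‖γ‖ ^ 2 - ‖h.act w b‖ ^ 2) / 2) := fun w q => by
    rw [norm_mul, Real.norm_eq_abs, h.abs_sgn, one_mul, Real.norm_eq_abs, Real.abs_exp]
  have hopt := fun w => hB.integral_exp_killed γ (h.act w b) hC p t
  have hint : ∀ w, Integrable (fun ξ => e w (killed B γ C p t ξ)) P :=
    fun w => (hopt w).1.const_mul _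
  have hval : ∀ w, ∫ ξ, e w (killed B γ C p t ξ) ∂P = e w p := fun w => by
    rw [integral_const_mul, (hopt w).2]
  have hnorm : ∀ w, ∫ ξ, ‖e w (killed B γ C p t ξ)‖ ∂P = ‖e w p‖ := fun w => by
    simp_rw [habs]
    exact (hopt w).2
  have hsum : Summable fun w => ∫ ξ, ‖e w (killed B γ C p t ξ)‖ ∂P := by
    simp_rw [hnorm]
    refine (((h.summable_thetaTerm b hp p.2).mul_left (driftWeight γ b p)).congr fun w => ?_).norm
    exact h.driftWeight_mul_thetaTerm γ b p w
  simp_rw [he]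
  refine ⟨?_, ?_⟩
  · refine AEStronglyMeasurable.const_mul ?_ _
    refine aestronglyMeasurable_of_tendsto_ae atTop (f := fun (T : Finset (affineWeylGroup α θ)) ξ =>
      ∑ w ∈ T, e w (killed B γ C p t ξ)) (fun T => ?_) (ae_of_all _ fun ξ => ?_)
    · exact Finset.aestronglyMeasurable_fun_sum T fun w _ => (hint w).1
    · refine Summable.hasSum (((h.summable_thetaTerm b (t := (killed B γ C p t ξ).1) ?_
        (killed B γ C p t ξ).2).mul_left (driftWeight γ b (killed B γ C p t ξ))).congr fun w =>
          h.driftWeight_mul_thetaTerm γ b _ w)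
      exact add_pos_of_pos_of_nonneg hp (NNReal.coe_nonneg _)
  rw [integral_const_mul, ← integral_tsum_of_summable_integral_norm hint hsum]
  simp_rw [hval]

/-- Harmonicity of `Psi`, by dominated convergence along parameters `b → γ` inside the alcove: the
killed process stays in a compact set, on which the theta functions are bounded uniformly in `b`. -/
lemma isHarmonicForKilled (h : IsAffineDatum Φ α θ ω) [IsProbabilityMeasure P]
    (hB : IsStandardBrownian P B) {γ : E n} (hγ : γ ∈ alcove (posRoots Φ α) 1) :
    IsHarmonicForKilled P B γ (chamber (posRoots Φ α))
      {p | p ∈ chamber (posRoots Φ α) ∧ 0 < p.1} (Psi (posRoots Φ α) α θ γ) := by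
  rintro p ⟨hpC, hp⟩ t
  obtain ⟨q, U, hU, hγU, hq, hqb, hqγ⟩ := h.exists_continuousOn_extension hγ
  obtain ⟨b₀, hb₀⟩ := h.exists_mem_openAlcove
  set X := killed B γ (chamber (posRoots Φ α)) p t
  have hX := hB.ae_killed_mem γ (isClosed_chamber (posRoots Φ α)) hpC t
  set K := chamber (posRoots Φ α) ∩ {q | p.1 ≤ q.1 ∧ q.1 ≤ p.1 + t}
  have hK : IsCompact K := h.isCompact_chamber p.1 (p.1 + t)
  have hKpos : ∀ {z}, z ∈ K → 0 < z.1 := fun hz => hp.trans_le hz.2.1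
  have hpK : p ∈ K := ⟨hpC, le_rfl, by simp⟩
  -- the parameters `b s` tend to `γ` as `s → 0`
  set b : ℝ → E n := fun s => γ + s • (b₀ - γ)
  have hb := h.tendsto_segment hγ hb₀
  obtain ⟨r, hr, hrU⟩ := Metric.nhds_basis_closedBall.mem_iff.1 (hU.mem_nhds hγU)
  have hbr : ∀ᶠ s in 𝓝[>] (0 : ℝ), b s ∈ Metric.closedBall γ r :=
    (tendsto_nhdsWithin_iff.1 hb).1 (Metric.closedBall_mem_nhds γ hr)
  have hbne : ∀ᶠ s in 𝓝[>] (0 : ℝ), sinProd (posRoots Φ α) (b s) ≠ 0 :=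
    (tendsto_nhdsWithin_iff.1 hb).2
  have hcont : ContinuousOn (fun z : (ℝ × E n) × E n => driftWeight γ z.2 z.1 * q z)
      ({p | 0 < p.1} ×ˢ U) := (continuous_driftWeight γ).continuousOn.mul hq
  obtain ⟨M, hM⟩ := (hK.prod (isCompact_closedBall γ r)).exists_bound_of_continuousOn
    (hcont.mono (Set.prod_mono (fun z hz => hKpos hz) hrU))
  have hPsi : ∀ z ∈ K, Psi (posRoots Φ α) α θ γ z = driftWeight γ γ z * q (z, γ) := fun z hz => by
    rw [Psi, hqγ z (hKpos hz), driftWeight, sub_self, mul_zero, zero_div, add_zero]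
  have hlim : ∀ z ∈ K, Tendsto (fun s => driftWeight γ (b s) z *
      psiHat (posRoots Φ α) α θ (b s) z.1 z.2) (𝓝[>] 0) (𝓝 (Psi (posRoots Φ α) α θ γ z)) := by
    intro z hz
    rw [hPsi z hz]
    have h1 : ContinuousAt (fun z' => driftWeight γ z' z * q (z, z')) γ :=
      (hcont.continuousAt (((isOpen_lt continuous_const continuous_fst).prod hU).mem_nhds
        (show (z, γ) ∈ _ from ⟨hKpos hz, hγU⟩))).comp (Continuous.prodMk_right z).continuousAt
    refine (h1.tendsto.comp (tendsto_nhdsWithin_iff.1 hb).1).congr' ?_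
    filter_upwards [hbr, hbne] with s hs1 hs2
    rw [Function.comp_apply, hqb _ (hrU hs1) hs2 z (hKpos hz)]
  have hbound : ∀ᶠ s in 𝓝[>] (0 : ℝ), ∀ z ∈ K, ‖driftWeight γ (b s) z *
      psiHat (posRoots Φ α) α θ (b s) z.1 z.2‖ ≤ M := by
    filter_upwards [hbr, hbne] with s hs1 hs2 z hz
    rw [hqb _ (hrU hs1) hs2 z (hKpos hz)]
    exact hM (z, b s) ⟨hz, hs1⟩
  have hharm := fun s => h.integral_psiHat_killed hB γ (b s) (posRoots Φ α)
    (isClosed_chamber (posRoots Φ α)) hp t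
  have hlimae : ∀ᵐ ξ ∂P, Tendsto (fun s => driftWeight γ (b s) (X ξ) *
      psiHat (posRoots Φ α) α θ (b s) (X ξ).1 (X ξ).2) (𝓝[>] 0)
      (𝓝 (Psi (posRoots Φ α) α θ γ (X ξ))) := by
    filter_upwards [hX] with ξ hξ using hlim _ hξ
  have hmeas : AEStronglyMeasurable (fun ξ => Psi (posRoots Φ α) α θ γ (X ξ)) P :=
    aestronglyMeasurable_of_tendsto_ae (𝓝[>] (0 : ℝ)) (fun s => (hharm s).1) hlimae
  refine ⟨Integrable.of_bound hmeas M ?_, ?_⟩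
  · filter_upwards [hX] with ξ hξ
    rw [hPsi _ hξ]
    exact hM (X ξ, γ) ⟨hξ, Metric.mem_closedBall_self hr.le⟩
  · have hto := tendsto_integral_filter_of_norm_le_const
      (Eventually.of_forall fun s => (hharm s).1)
      ⟨M, hbound.mono fun s hs => hX.mono fun ξ hξ => hs _ hξ⟩ hlimae
    refine tendsto_nhds_unique hto ((hlim p hpK).congr fun s => ?_)
    exact (hharm s).2.symm

/-- On the walls all the functions `psiHat` vanish, and so does their limit. -/
lemma psi_eq_zero_of_mem_frontier (h : IsAffineDatum Φ α θ ω) {γ : E n}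
    (hγ : γ ∈ alcove (posRoots Φ α) 1) {p : ℝ × E n}
    (hp : p ∈ frontier (chamber (posRoots Φ α))) (ht : 0 < p.1) :
    psi (posRoots Φ α) α θ γ p.1 p.2 = 0 := by
  have := h.neBot_nhdsWithin hγ
  obtain ⟨i, hi⟩ := h.exists_node_of_mem_frontier hp ht
  refine tendsto_nhds_unique (h.tendsto_psiHat hγ ht p.2) (tendsto_const_nhds.congr fun b => ?_)
  rw [psiHat_eq, h.thetaSum_eq_zero_of_node hi, mul_zero]

end IsAffineDatum

end

end AffineTheta

end

open AffineTheta in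
theorem mainTheorem7 {𝔤 : Type*} [LieRing 𝔤] [LieAlgebra ℝ 𝔤] [FiniteDimensional ℝ 𝔤]
    [LieAlgebra.IsSimple ℝ 𝔤]
    (B : LinearMap.BilinForm ℝ 𝔤) (hB : IsInvariantScalarProduct B)
    {n : ℕ} (j : E n →ₗ[ℝ] 𝔤) (hj : IsMaximalTorus B j)
    (α : Fin n → EDual n) (hα : IsSimpleSystem (realRoots j) α)
    (θ : EDual n) (hθ : IsHighestRoot (realRoots j) α θ) (hnorm : ‖θ‖ ^ 2 = 2)
    (Φp : Set (EDual n)) (hΦp : Φp = posRoots (realRoots j) α)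
    (γ : E n) (hγ : γ ∈ alcove Φp 1) :
    -- the theta series converges, and `ψ_γ` is well defined, also when `π(γ) = 0`
    (∀ (b : E n) (t : ℝ) (x : E n), 0 < t →
      Summable (fun w : affineWeylGroup α θ => thetaTerm b t x w)) ∧
    (∀ (t : ℝ) (x : E n), 0 < t →
      Tendsto (fun b => psiHat Φp α θ b t x) (𝓝[{b | sinProd Φp b ≠ 0}] γ)
        (𝓝 (psi Φp α θ γ t x))) ∧
    -- constant sign
    (∀ p ∈ chamber Φp, 0 < p.1 → 0 ≤ Psi Φp α θ γ p) ∧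
    -- vanishing on the boundary
    (∀ p ∈ frontier (chamber Φp), 0 < p.1 → Psi Φp α θ γ p = 0) ∧
    -- harmonicity
    (∀ (Ω : Type*) [MeasurableSpace Ω] (P : Measure Ω) [IsProbabilityMeasure P]
      (b : ℝ≥0 → Ω → E n), IsStandardBrownian P b →
      IsHarmonicForKilled P b γ (chamber Φp) {p | p ∈ chamber Φp ∧ 0 < p.1} (Psi Φp α θ γ)) := by
  subst hΦp
  obtain ⟨ω, hω⟩ := hα.exists_coweights
  have h : IsAffineDatum (realRoots j) α θ ω := ⟨isRootSet_realRoots hB hj, hα, hθ, hnorm, hω⟩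
  refine ⟨fun b t x ht => h.summable_thetaTerm b ht x, fun t x ht => h.tendsto_psiHat hγ ht x,
    fun p hp ht => mul_nonneg (Real.exp_pos _).le (h.psi_nonneg hγ hp ht), fun p hp ht => ?_,
    fun Ω _ P _ b hb => h.isHarmonicForKilled hb hγ⟩
  rw [Psi, h.psi_eq_zero_of_mem_frontier hγ hp ht, mul_zero]
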